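/- Let $k,M\ge 1$ be fixed integers and let $V$ be a symmetric positive definite $k\times k$ matrix. Let $(Y(0),Y(1),X,W)$ be a superpopulation with real potential outcomes, covariates $X\in\mathbb{R}^k$ and treatment $W\in\{0,1\}$, $\Pr(W=w)>0$ for $w=0,1$, and observed outcome $Y=WY(1)+(1-W)Y(0)$. Write $\mathbb{X}_w$ for the (closed) support of $X$ given $W=w$, $\mu(x,w)=\mathbb{E}[Y\mid X=x,W=w]$, $\sigma^2(x,w)=\mathrm{Var}[Y\mid X=x,W=w]$, $\epsilon=Y-\mu(X,W)$ and $\tau=\mathbb{E}[Y(1)-Y(0)\mid W=1]$. For each $n$, one observes $N_1=N_1(n)$ treated units drawn from the law of $(Y,X)\mid W=1$ and $N_0=N_0(n)$ control units drawn from the law of $(Y,X)\mid W=0$, all mutually independent. Assume: 1. (Conditional independence) $Y(0)\perp W\mid X$. 2. (Covariates) $X$ is absolutely continuous; $\mathbb{X}_1\subseteq\mathbb{X}_0$ and both are compact; $X$ given $W=w$ has a density $f_w$ that is differentiable in the interior of $\mathbb{X}_w$ and bounded above on $\mathbb{X}_1$ ($w=0,1$), and $f_0$ is bounded below on $\mathbb{X}_1$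 by a positive constant; there are $\varphi>0$ and $\rho_0>0$ such that, for all $x\in\mathbb{X}_1$ and $0<\rho\le\rho_0$, at least a fraction $\varphi$ of the volume of the ball of radius $\rho$ around $x$ belongs to $\mathbb{X}_1$. 3. (Sampling rates) $N_1,N_0\to\infty$ and, for some $r>\max\{k/2,2\}$ and some $0<\theta<\infty$, $N_1^r/N_0\to\theta$. 4. (Outcomes) For $w=0,1$, $\mu(\cdot,w)$ and $\sigma^2(\cdot,w)$ have versions that are Lipschitz on $\mathbb{X}_0$; for some $\gamma>0$, $\mathbb{E}[|\epsilon|^{4+\gamma}\mid X=x,W=w]$ exists and is bounded uniformly in $x\in\mathbb{X}_w$; and $\sigma^2(x,w)$ is bounded away from zero on $\mathbb{X}_w$. Given $c\in\mathbb{R}$, for each treated unit $i=1,\dots,N_1$ put $S_i^0=Y_i-c$ and, for $m=1,\dots,M$, let $S_i^m$ be the outcome of the $m$-th nearest neighbour of $X_i$ among the controls in the distance $d(a,b)=[(a-b)'V(a-b)]^{1/2}$. Let $\mathbf{G}$ be the set of all $\pi=(\pi_1,\dots,\pi_{N_1})$ where each $\pi_i$ is a permutation of $\{0,\dots,M\}$;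 let $K=|\mathbf{G}|$, $S^\pi=(S_i^{\pi_i(j)})_{i,j}$, and $$D_i(S)=S_i^0-\frac1M\sum_{m=1}^M S_i^m,\qquad \bar D(S)=\frac1{N_1}\sum_{i=1}^{N_1}D_i(S),\qquad T(S)=\frac{|\bar D(S)|}{\sqrt{\frac1{N_1-1}\sum_{i=1}^{N_1}\big(D_i(S)-\bar D(S)\big)^2}} .$$ The permutation test of level $\alpha$ rejects $H_0:\tau=c$ if and only if $T(S)>T^{(\lceil K(1-\alpha)\rceil)}$, where $T^{(1)}\le\dots\le T^{(K)}$ are the ordered values of $T(S^\pi)$, $\pi\in\mathbf{G}$. Then this test is asymptotically valid: if $\tau=c$, then for every $\alpha\in(0,1)$, $$\limsup_{n\to\infty}\Pr(\text{the test rejects})\le\alpha .$$ (No homoskedasticity or treatment-effect homogeneity is assumed.) -/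

import Mathlib

open MeasureTheory ProbabilityTheory Filter Topology
open scoped ENNReal NNReal Matrix

noncomputable section

namespace Matching

/-- The covariate space `ℝᵏ` with its Euclidean norm. -/
abbrev Cov (k : ℕ) : Type := EuclideanSpace ℝ (Fin k)

/-! ### Superpopulation -/

/-- A superpopulation of potential outcomes `Y 0`, `Y 1`, covariates `X ∈ ℝᵏ` and a binary
treatment `W`, in which both treatment arms have positive probability. -/
structure Population (k : ℕ) (Ω : Type*) [MeasurableSpace Ω] where
  P : Measure Ω
  isProb : IsProbabilityMeasure P
  Y : Fin 2 → Ω → ℝ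
  X : Ω → Cov k
  W : Ω → Fin 2
  measurable_Y : ∀ w, Measurable (Y w)
  measurable_X : Measurable X
  measurable_W : Measurable W
  pos_arm : ∀ w, P (W ⁻¹' {w}) ≠ 0

attribute [instance] Population.isProb

namespace Population

variable {k : ℕ} {Ω : Type*} [MeasurableSpace Ω] (pop : Population k Ω)

/-- The observed outcome `Y = W Y(1) + (1 - W) Y(0)`. -/
def obs (ω : Ω) : ℝ := pop.Y (pop.W ω) ω

/-- The conditional probability `P(· | W = w)`. -/
def arm (w : Fin 2) : Measure Ω := cond pop.P (pop.W ⁻¹' {w})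

/-- The law of `X` given `W = w`. -/
def lawX (w : Fin 2) : Measure (Cov k) := (pop.arm w).map pop.X

/-- The law of `(Y, X)` given `W = w`. -/
def lawYX (w : Fin 2) : Measure (ℝ × Cov k) :=
  (pop.arm w).map (fun ω => (pop.obs ω, pop.X ω))

/-- The (closed) support of `X` given `W = w`. -/
def supp (w : Fin 2) : Set (Cov k) := (pop.lawX w).support

/-- The average treatment effect on the treated, `τ = E[Y(1) - Y(0) | W = 1]`. -/
def att : ℝ := ∫ ω, (pop.Y 1 ω - pop.Y 0 ω) ∂(pop.arm 1)

/-- Conditional independence assumption: `Y(0) ⫫ W | X`. -/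
def CIA [StandardBorelSpace Ω] : Prop :=
  CondIndepFun (MeasurableSpace.comap pop.X inferInstance) pop.measurable_X.comap_le
    (pop.Y 0) pop.W pop.P

/-- Assumption on the distribution of the covariates. The functions `f w` are densities of `X`
given `W = w`. In the last clause, "sphere" means a solid sphere of small radius (the supports
are bounded, so no positive fraction could work for all radii). -/
def CovariateAssumption : Prop :=
  pop.P.map pop.X ≪ volume ∧
  pop.supp 1 ⊆ pop.supp 0 ∧ IsCompact (pop.supp 1) ∧ IsCompact (pop.supp 0) ∧
  (∃ f : Fin 2 → Cov k → ℝ,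
    (∀ w, Measurable (f w) ∧ (∀ x, 0 ≤ f w x) ∧
      pop.lawX w = volume.withDensity (fun x => ENNReal.ofReal (f w x))) ∧
    (∀ w, ∀ x ∈ interior (pop.supp w), DifferentiableAt ℝ (f w) x) ∧
    (∃ C : ℝ, ∀ w, ∀ x ∈ pop.supp 1, f w x ≤ C) ∧
    (∃ b : ℝ, 0 < b ∧ ∀ x ∈ pop.supp 1, b ≤ f 0 x)) ∧
  (∃ φ : ℝ, 0 < φ ∧ ∃ ρ₀ : ℝ, 0 < ρ₀ ∧ ∀ x ∈ pop.supp 1, ∀ ρ : ℝ, 0 < ρ → ρ ≤ ρ₀ →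
    ENNReal.ofReal φ * volume (Metric.ball x ρ) ≤ volume (Metric.ball x ρ ∩ pop.supp 1))

/-- `g` is a version of the regression function `x ↦ E[F | X = x, W = w]`
(and this conditional expectation exists). -/
def IsCondMean (w : Fin 2) (F : Ω → ℝ) (g : Cov k → ℝ) : Prop :=
  Integrable F (pop.arm w) ∧
    (pop.arm w)[F | MeasurableSpace.comap pop.X inferInstance] =ᵐ[pop.arm w] fun ω => g (pop.X ω)

/-- Assumption on the conditional distribution of outcomes: `μ x w = E[Y | X = x, W = w]` and
`σsq x w = Var[Y | X = x, W = w]` are Lipschitz on the support of the control covariates; for some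
`γ > 0` the conditional moments `E[|ε|^(4+γ) | X = x, W = w]` of `ε = Y - μ(X, W)` exist and are
uniformly bounded; and the conditional variances are bounded away from zero. -/
def OutcomeAssumption : Prop :=
  ∃ μ σsq : Cov k → Fin 2 → ℝ,
    (∀ w, pop.IsCondMean w pop.obs (fun x => μ x w)) ∧
    (∀ w, pop.IsCondMean w (fun ω => (pop.obs ω - μ (pop.X ω) (pop.W ω)) ^ 2)
      (fun x => σsq x w)) ∧
    (∀ w, ∃ L : ℝ≥0, LipschitzOnWith L (fun x => μ x w) (pop.supp 0)) ∧
    (∀ w, ∃ L : ℝ≥0, LipschitzOnWith L (fun x => σsq x w) (pop.supp 0)) ∧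
    (∃ γ : ℝ, 0 < γ ∧ ∀ w, ∃ κ : Cov k → ℝ,
      pop.IsCondMean w (fun ω => |pop.obs ω - μ (pop.X ω) (pop.W ω)| ^ (4 + γ)) κ ∧
      ∃ C : ℝ, ∀ x ∈ pop.supp w, κ x ≤ C) ∧
    (∃ b : ℝ, 0 < b ∧ ∀ w, ∀ x ∈ pop.supp w, b ≤ σsq x w)

/-- Pooled sample: `N₁` treated units (indexed by `Sum.inl`) drawn from the law of
`(Y, X) | W = 1` and `N₀` control units (`Sum.inr`) drawn from the law of `(Y, X) | W = 0`,
all mutually independent. -/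
structure IsPooledSample {N₁ N₀ : ℕ} {S : Type*} [MeasurableSpace S] (Q : Measure S)
    (Z : Fin N₁ ⊕ Fin N₀ → S → ℝ × Cov k) : Prop where
  indep : iIndepFun Z Q
  law_treated : ∀ i, HasLaw (Z (Sum.inl i)) (pop.lawYX 1) Q
  law_control : ∀ j, HasLaw (Z (Sum.inr j)) (pop.lawYX 0) Q

end Population

/-- Sampling rates: `N₁ ^ r / N₀ → θ` for some `r > max (k/2) 2` and `0 < θ < ∞`. -/
def SamplingRates (k : ℕ) (N₁ N₀ : ℕ → ℕ) : Prop :=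
  ∃ r θ : ℝ, max ((k : ℝ) / 2) 2 < r ∧ 0 < θ ∧
    Tendsto (fun n => (N₁ n : ℝ) ^ r / (N₀ n : ℝ)) atTop (𝓝 θ)

/-! ### Nearest neighbours -/

/-- The distance `d(a, b) = [(a - b)' V (a - b)] ^ (1/2)`. -/
def matchDist {k : ℕ} (V : Matrix (Fin k) (Fin k) ℝ) (a b : Cov k) : ℝ :=
  Real.sqrt ((fun l => a l - b l) ⬝ᵥ (V *ᵥ (fun l => a l - b l)))

/-- The outcome of the `(m+1)`-th nearest neighbour of the point `x` among the control units
`ctrl` (units being pairs (outcome, covariates)). Controls are sorted by their distance to `x`;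
ties are broken by the index. The value is `0` if there are at most `m` controls. -/
def neighborOutcome {k N₀ : ℕ} (V : Matrix (Fin k) (Fin k) ℝ) (ctrl : Fin N₀ → ℝ × Cov k)
    (x : Cov k) (m : ℕ) : ℝ :=
  if h : m < N₀ then (ctrl (Tuple.sort (fun j => matchDist V x (ctrl j).2) ⟨m, h⟩)).1 else 0

/-- The array of entries `S i 0 = Y_i - c` and `S i m = Y^i_(m)`, `m = 1, …, M`: the outcome of
treated unit `i` minus `c`, and the outcomes of its `M` nearest neighbours. -/
def matchedOutcomes {k N₁ N₀ : ℕ} (V : Matrix (Fin k) (Fin k) ℝ) (M : ℕ) (c : ℝ)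
    (z : Fin N₁ ⊕ Fin N₀ → ℝ × Cov k) : Fin N₁ → Fin (M + 1) → ℝ :=
  fun i => Fin.cons ((z (Sum.inl i)).1 - c)
    (fun m : Fin M => neighborOutcome V (fun j => z (Sum.inr j)) (z (Sum.inl i)).2 m)

/-! ### The within-match permutation test -/

section Test

variable {N M : ℕ}

/-- `S i 0 - (1/M) ∑_{m=1}^M S i m`. -/
def contrast (S : Fin N → Fin (M + 1) → ℝ) (i : Fin N) : ℝ :=
  S i 0 - (1 / (M : ℝ)) * ∑ m : Fin M, S i m.succ

/-- The average of the contrasts over the matched groups. -/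
def avgContrast (S : Fin N → Fin (M + 1) → ℝ) : ℝ :=
  (1 / (N : ℝ)) * ∑ i, contrast S i

/-- The standardized test statistic. -/
def stdStat (S : Fin N → Fin (M + 1) → ℝ) : ℝ :=
  |avgContrast S| /
    Real.sqrt ((1 / ((N : ℝ) - 1)) * ∑ i, (contrast S i - avgContrast S) ^ 2)

/-- All families of permutations `π_i` of `{0, …, M}`, one for each treated unit `i`. -/
abbrev PermGroup (N M : ℕ) : Type := Fin N → Equiv.Perm (Fin (M + 1))

/-- The permuted array `S^π`, with entries `S i (π_i j)`. -/
def permute (S : Fin N → Fin (M + 1) → ℝ) (π : PermGroup N M) : Fin N → Fin (M + 1) → ℝ :=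
  fun i j => S i (π i j)

/-- The `j`-th smallest value (`j = 1, 2, …`, counted with multiplicity) of a finite family. -/
def orderStat {ι : Type*} [Fintype ι] (f : ι → ℝ) (j : ℕ) : ℝ :=
  ((Finset.univ.val.map f).sort (· ≤ ·)).getD (j - 1) 0

/-- The permutation test of level `α` rejects: the statistic exceeds the `⌈K (1 - α)⌉`-th
smallest of its values over all `K` permutations. -/
def PermTestRejects (α : ℝ) (S : Fin N → Fin (M + 1) → ℝ) : Prop :=
  orderStat (fun π : PermGroup N M => stdStat (permute S π))
    ⌈(Fintype.card (PermGroup N M) : ℝ) * (1 - α)⌉₊ < stdStat S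

end Test

end Matching

end

/-!
The idea is to compare the permutation distribution of the studentized statistic with its sampling
distribution: both are asymptotically normal with variance one, whatever the conditional variances
and the treatment effects are.

*Permutation distribution.* Given the matched array `S`, the permuted contrasts are independent over
the treated units, with mean zero, and the variance of each is a fixed combination of the squared
differences within its group. The statistic is an increasing function of `|∑ D_i| / √(∑ D_i²)`, and
for the permuted array both the central limit theorem for the numerator and the concentration of
the denominator are uniform over all arrays with `∑ D_i² ≥ a N` and `∑ S_ij⁴ ≤ N √N`. Hence on such
arrays the critical value is at least `z / √N` for large `N`, as soon as a standard normal variable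
lies in a slightly larger interval than `[-z, z]` with probability less than `1 - α`
(`exists_lt_orderStat_stdStat`). This uses an explicit bound for characteristic functions
(`norm_integral_exp_sum_sub_le`), which Lévy's theorem turns into bounds for probabilities
(`eventually_measure_le_of_tendsto_charFun`).

*Sampling distribution.* Outcomes are written as functions of the covariates and of independent
uniform variables (`Population.exists_outcomeModel`); by conditional independence the control
regression function describes `Y(0)` among the treated as well, so that `τ = c` says that the
effects `g₁ - g₀ - c` have mean zero. Because `N₁ ^ r / N₀` converges for some `r > max (k / 2) 2`,
there is a scale negligible against `N₁ ^ (-1/2)` at which every treated unit has `M` controls close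
to it, while distinct treated units are far apart, with probability tending to one
(`Population.exists_vanishingDiscrepancy`). Then no control is used twice, so the matched outcomes
are independent given the covariates (`OutcomeModel.indepArray_matched`), and the matching bias
disappears. The conditional central limit theorem, combined with the one for the effects, gives
`∑ D_i / √(s² N₁) → N(0, 1)` with `s² = E[(g₁ - g₀ - c)² + σ₁² + σ₀² / M]`
(`OutcomeModel.VanishingDiscrepancy.tendsto_charFun`), and `∑ D_i² / N₁` is asymptotically at least
`s²` (`OutcomeModel.VanishingDiscrepancy.tendsto_sum_sq_contrast_lt`).

*Conclusion.* Up to events of vanishing probability, a rejection forces `|∑ D_i| / √(s² N₁)` to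
exceed a number slightly smaller than the normal critical value
(`exists_forall_permTestRejects_imp`), which has asymptotic probability at most `α + η` for every
`η > 0`.
-/

namespace Matching

/-! ### A quantitative Lyapunov central limit theorem -/

lemma norm_exp_mul_I_sub_taylor_le (x : ℝ) :
    ‖Complex.exp (x * Complex.I) - 1 - x * Complex.I + (x : ℂ) ^ 2 / 2‖ ≤ 4 * |x| ^ 3 := by
  rcases le_or_gt |x| 1 with h | h
  · have hx : ‖(x : ℂ) * Complex.I‖ ≤ 1 := by simpa using h
    have := Complex.exp_bound hx (n := 3) (by norm_num)
    have e : ∑ m ∈ Finset.range 3, ((x : ℂ) * Complex.I) ^ m / (m.factorial : ℂ)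
        = 1 + x * Complex.I - (x : ℂ) ^ 2 / 2 := by
      simp [Finset.sum_range_succ, Nat.factorial, mul_pow]
      ring
    rw [e] at this
    have e2 : Complex.exp (x * Complex.I) - 1 - x * Complex.I + (x : ℂ) ^ 2 / 2
      = Complex.exp (x * Complex.I) - (1 + x * Complex.I - (x : ℂ) ^ 2 / 2) := by ring
    rw [e2]
    refine this.trans ?_
    have hn : ‖(x : ℂ) * Complex.I‖ = |x| := by simp
    rw [hn, mul_comm]
    gcongr
    norm_num [Nat.factorial]
  · have h1 : ‖Complex.exp (x * Complex.I)‖ = 1 := Complex.norm_exp_ofReal_mul_I x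
    have h3 : ‖(x : ℂ) * Complex.I‖ = |x| := by simp
    have h4 : ‖(x : ℂ) ^ 2 / 2‖ = |x| ^ 2 / 2 := by simp
    calc _ ≤ ‖Complex.exp (x * Complex.I)‖ + ‖(1 : ℂ)‖ + ‖(x : ℂ) * Complex.I‖
          + ‖(x : ℂ) ^ 2 / 2‖ :=
          (norm_add_le _ _).trans (add_le_add_left ((norm_sub_le _ _).trans
            (add_le_add_left (norm_sub_le _ _) _)) _)
      _ = 2 + |x| + |x| ^ 2 / 2 := by rw [h1, h3, h4, norm_one]; ring
      _ ≤ 4 * |x| ^ 3 := by nlinarith [mul_pos (sub_pos.2 h) (sub_pos.2 h), abs_nonneg x, pow_pos (sub_pos.2 h) 3]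

lemma abs_exp_neg_sub_taylor_le {a : ℝ} (ha : 0 ≤ a) : |Real.exp (-a) - 1 + a| ≤ a ^ 2 := by
  rcases le_or_gt a 1 with h | h
  · have := Real.norm_exp_sub_one_sub_id_le (x := -a) (by simpa [abs_of_nonneg ha] using h)
    simpa [abs_of_nonneg ha] using this
  · have h1 := Real.exp_pos (-a)
    have h2 : Real.exp (-a) ≤ 1 := Real.exp_le_one_iff.2 (by linarith)
    rw [abs_le]
    constructor <;> nlinarith

lemma norm_prod_sub_prod_le {ι : Type*} (s : Finset ι) (a b : ι → ℂ) (ha : ∀ i, ‖a i‖ ≤ 1)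
    (hb : ∀ i, ‖b i‖ ≤ 1) : ‖∏ i ∈ s, a i - ∏ i ∈ s, b i‖ ≤ ∑ i ∈ s, ‖a i - b i‖ := by
  classical
  induction s using Finset.induction_on with
  | empty => simp
  | insert i s hi ih =>
    rw [Finset.prod_insert hi, Finset.prod_insert hi, Finset.sum_insert hi]
    have e : a i * ∏ j ∈ s, a j - b i * ∏ j ∈ s, b j
      = (a i - b i) * ∏ j ∈ s, a j + b i * (∏ j ∈ s, a j - ∏ j ∈ s, b j) := by ring
    rw [e]
    refine (norm_add_le _ _).trans (add_le_add ?_ ?_)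
    · rw [norm_mul]
      refine mul_le_of_le_one_right (norm_nonneg _) ?_
      rw [norm_prod]
      exact Finset.prod_le_one (fun _ _ => norm_nonneg _) (fun j _ => ha j)
    · rw [norm_mul]
      exact (mul_le_of_le_one_left (norm_nonneg _) (hb i)).trans ih

section Moments
variable {Ω : Type*} [MeasurableSpace Ω] {P : Measure Ω} [IsProbabilityMeasure P]

omit [IsProbabilityMeasure P] in
lemma memLp_of_integrable_pow_four {X : Ω → ℝ} (hX : AEStronglyMeasurable X P)
    (h4 : Integrable (fun ω => X ω ^ 4) P) : MemLp X 4 P := by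
  refine (integrable_norm_rpow_iff hX (by norm_num) (by norm_num)).1 ?_
  refine h4.congr (.of_forall fun ω => ?_)
  have : ((4 : ℝ≥0∞).toReal) = ((4 : ℕ) : ℝ) := by norm_num
  simp only [this, Real.rpow_natCast, Real.norm_eq_abs]
  exact (Even.pow_abs (by decide) _).symm

lemma integrable_of_pow_four {X : Ω → ℝ} (hX : AEStronglyMeasurable X P)
    (h4 : Integrable (fun ω => X ω ^ 4) P) : Integrable X P :=
  (memLp_of_integrable_pow_four hX h4).integrable (by norm_num)

lemma integrable_sq_of_pow_four {X : Ω → ℝ} (hX : AEStronglyMeasurable X P)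
    (h4 : Integrable (fun ω => X ω ^ 4) P) : Integrable (fun ω => X ω ^ 2) P :=
  ((memLp_of_integrable_pow_four hX h4).mono_exponent (by norm_num) : MemLp X 2 P).integrable_sq

lemma sq_integral_le {X : Ω → ℝ} (hX : MemLp X 2 P) : (∫ ω, X ω ∂P) ^ 2 ≤ ∫ ω, X ω ^ 2 ∂P := by
  have h := variance_nonneg X P
  rw [variance_eq_sub hX] at h
  simpa using h

omit [IsProbabilityMeasure P] in
lemma memLp_sq_of_pow_four {X : Ω → ℝ} (hX : AEStronglyMeasurable X P)
    (h4 : Integrable (fun ω => X ω ^ 4) P) : MemLp (fun ω => X ω ^ 2) 2 P := by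
  exact (memLp_two_iff_integrable_sq (hX.pow 2)).2 (h4.congr (.of_forall fun ω => by
    simp only [Pi.pow_apply]; ring))

lemma sq_integral_sq_le {X : Ω → ℝ} (hX : AEStronglyMeasurable X P)
    (h4 : Integrable (fun ω => X ω ^ 4) P) :
    (∫ ω, X ω ^ 2 ∂P) ^ 2 ≤ ∫ ω, X ω ^ 4 ∂P := by
  refine (sq_integral_le (memLp_sq_of_pow_four hX h4)).trans (le_of_eq ?_)
  exact integral_congr_ae (.of_forall fun ω => by ring)

/-- The third-order Taylor estimate of a characteristic function. The third absolute moment is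
split between the second and the fourth by `2 |x|³ ≤ η x² + x⁴ / η`. -/
lemma norm_integral_exp_sub_le {X : Ω → ℝ} (hX : AEStronglyMeasurable X P)
    (h0 : ∫ ω, X ω ∂P = 0) (h4 : Integrable (fun ω => X ω ^ 4) P) {η : ℝ} (hη : 0 < η) :
    ‖∫ ω, Complex.exp (X ω * Complex.I) ∂P - Complex.exp (-(∫ ω, X ω ^ 2 ∂P : ℝ) / 2)‖
      ≤ 2 * η * ∫ ω, X ω ^ 2 ∂P + (2 / η + 1) * ∫ ω, X ω ^ 4 ∂P := by
  have i1 := integrable_of_pow_four hX h4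
  have i2 := integrable_sq_of_pow_four hX h4
  set v := ∫ ω, X ω ^ 2 ∂P with hv
  have hv0 : 0 ≤ v := integral_nonneg fun _ => sq_nonneg _
  have iexp : Integrable (fun ω => Complex.exp (X ω * Complex.I)) P := by
    refine Integrable.of_bound (C := 1) ?_ (.of_forall fun ω => ?_)
    · exact (Complex.continuous_exp.comp_aestronglyMeasurable
        ((Complex.continuous_ofReal.comp_aestronglyMeasurable hX).mul_const _))
    · exact (Complex.norm_exp_ofReal_mul_I _).le
  have iX : Integrable (fun ω => (X ω : ℂ) * Complex.I) P := i1.ofReal.mul_const _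
  have iX2 : Integrable (fun ω => (X ω : ℂ) ^ 2 / 2) P := by
    have := i2.ofReal (𝕜 := ℂ)
    refine (this.div_const 2).congr (.of_forall fun ω => ?_)
    simp
  have e1 : ∫ ω, (Complex.exp (X ω * Complex.I) - 1 - X ω * Complex.I + (X ω : ℂ) ^ 2 / 2) ∂P
      = ∫ ω, Complex.exp (X ω * Complex.I) ∂P - 1 + (v : ℂ) / 2 := by
    have j1 : Integrable (fun ω => Complex.exp (X ω * Complex.I) - 1) P :=
      iexp.sub (integrable_const _)
    have j2 : Integrable (fun ω => Complex.exp (X ω * Complex.I) - 1 - X ω * Complex.I) P :=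
      j1.sub iX
    rw [integral_add j2 iX2, integral_sub j1 iX, integral_sub iexp (integrable_const _)]
    have hX0 : ∫ ω, (X ω : ℂ) ∂P = 0 := by
      rw [integral_complex_ofReal, h0, Complex.ofReal_zero]
    rw [integral_mul_const, hX0, integral_div]
    have : ∫ ω, (X ω : ℂ) ^ 2 ∂P = (v : ℂ) := by
      rw [hv, ← integral_complex_ofReal]
      simp
    rw [this]
    simp
  have e2 : ‖∫ ω, Complex.exp (X ω * Complex.I) ∂P - 1 + (v : ℂ) / 2‖
      ≤ 2 * η * v + 2 / η * ∫ ω, X ω ^ 4 ∂P := by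
    rw [← e1]
    calc _ ≤ ∫ ω, (2 * η * X ω ^ 2 + 2 / η * X ω ^ 4) ∂P := by
          refine norm_integral_le_of_norm_le ((i2.const_mul _).add (h4.const_mul _))
            (.of_forall fun ω => ?_)
          refine (norm_exp_mul_I_sub_taylor_le _).trans ?_
          rw [show X ω ^ 2 = |X ω| ^ 2 by simp,
            show X ω ^ 4 = |X ω| ^ 4 from (Even.pow_abs (by decide) _).symm]
          set y := |X ω|
          have : 2 * η * y ^ 2 + 2 / η * y ^ 4 - 4 * y ^ 3 = 2 / η * (y * (η - y)) ^ 2 := by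
            field_simp
            ring
          have h : 0 ≤ 2 / η * (y * (η - y)) ^ 2 := by positivity
          linarith
      _ = _ := by
          rw [integral_add (i2.const_mul _) (h4.const_mul _), integral_const_mul,
            integral_const_mul]
  have e3 : ‖(1 : ℂ) - (v : ℂ) / 2 - Complex.exp (-(v : ℝ) / 2)‖ ≤ ∫ ω, X ω ^ 4 ∂P := by
    have : (1 : ℂ) - (v : ℂ) / 2 - Complex.exp (-(v : ℝ) / 2)
        = -((Real.exp (-(v / 2)) - 1 + v / 2 : ℝ) : ℂ) := by
      push_cast
      rw [neg_div]
      ring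
    rw [this, norm_neg, Complex.norm_real]
    refine (abs_exp_neg_sub_taylor_le (by positivity)).trans ?_
    have := sq_integral_sq_le hX h4
    nlinarith
  calc _ = ‖(∫ ω, Complex.exp (X ω * Complex.I) ∂P - 1 + (v : ℂ) / 2)
        + ((1 : ℂ) - (v : ℂ) / 2 - Complex.exp (-(v : ℝ) / 2))‖ := by congr 1; ring
    _ ≤ _ := (norm_add_le _ _).trans (by linarith [add_le_add e2 e3])

/-- Lyapunov's theorem in quantitative form, for independent centred summands whose fourth moments
sum to at most `l`. -/
theorem norm_integral_exp_sum_sub_le {ι : Type*} [Fintype ι] {ξ : ι → Ω → ℝ}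
    (hm : ∀ i, Measurable (ξ i)) (hind : iIndepFun ξ P) (h0 : ∀ i, ∫ ω, ξ i ω ∂P = 0)
    (h4 : ∀ i, Integrable (fun ω => ξ i ω ^ 4) P) {l : ℝ} (hl0 : 0 < l)
    (hl : ∑ i, ∫ ω, ξ i ω ^ 4 ∂P ≤ l) :
    ‖∫ ω, Complex.exp ((∑ i, ξ i ω : ℝ) * Complex.I) ∂P
        - Complex.exp (-(∑ i, ∫ ω, ξ i ω ^ 2 ∂P : ℝ) / 2)‖
      ≤ 2 * √l * ∑ i, ∫ ω, ξ i ω ^ 2 ∂P + 2 * √l + l := by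
  have hmE : ∀ i, Measurable fun ω => Complex.exp (ξ i ω * Complex.I) := fun i => by
    have := hm i
    fun_prop
  have e1 : ∫ ω, Complex.exp ((∑ i, ξ i ω : ℝ) * Complex.I) ∂P
      = ∏ i, ∫ ω, Complex.exp (ξ i ω * Complex.I) ∂P := by
    have hc := hind.comp (fun _ x => Complex.exp ((x : ℝ) * Complex.I))
      (fun _ => by fun_prop)
    have := hc.integral_fun_prod_eq_prod_integral (fun i => (hmE i).aestronglyMeasurable)
    simp only [Function.comp_def] at this
    rw [← this]
    congr 1
    ext ω
    rw [← Complex.exp_sum]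
    push_cast
    rw [Finset.sum_mul]
  have e2 : Complex.exp (-(∑ i, ∫ ω, ξ i ω ^ 2 ∂P : ℝ) / 2)
      = ∏ i, Complex.exp (-(∫ ω, ξ i ω ^ 2 ∂P : ℝ) / 2) := by
    rw [← Complex.exp_sum]
    push_cast
    rw [← Finset.sum_neg_distrib, Finset.sum_div]
  rw [e1, e2]
  have hsq : 0 < √l := Real.sqrt_pos.2 hl0
  refine (norm_prod_sub_prod_le _ _ _ (fun i => ?_) (fun i => ?_)).trans ?_
  · refine (norm_integral_le_of_norm_le (integrable_const 1) (.of_forall fun ω =>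
      (Complex.norm_exp_ofReal_mul_I _).le)).trans ?_
    simp
  · have hv : 0 ≤ ∫ ω, ξ i ω ^ 2 ∂P := integral_nonneg fun _ => sq_nonneg _
    have : (-(∫ ω, ξ i ω ^ 2 ∂P : ℝ) / 2 : ℂ) = ((-(∫ ω, ξ i ω ^ 2 ∂P) / 2 : ℝ) : ℂ) := by
      push_cast; rfl
    rw [this, ← Complex.ofReal_exp, Complex.norm_real, Real.norm_eq_abs,
      abs_of_pos (Real.exp_pos _)]
    exact Real.exp_le_one_iff.2 (by linarith)
  · calc _ ≤ ∑ i, (2 * √l * ∫ ω, ξ i ω ^ 2 ∂P + (2 / √l + 1) * ∫ ω, ξ i ω ^ 4 ∂P) :=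
          Finset.sum_le_sum fun i _ =>
            norm_integral_exp_sub_le (hm i).aestronglyMeasurable (h0 i) (h4 i) hsq
      _ = 2 * √l * ∑ i, ∫ ω, ξ i ω ^ 2 ∂P + (2 / √l + 1) * ∑ i, ∫ ω, ξ i ω ^ 4 ∂P := by
          rw [Finset.sum_add_distrib, Finset.mul_sum, Finset.mul_sum]
      _ ≤ 2 * √l * ∑ i, ∫ ω, ξ i ω ^ 2 ∂P + (2 / √l + 1) * l := by gcongr
      _ = _ := by
          have : 2 / √l * l = 2 * √l := by
            rw [div_mul_eq_mul_div, div_eq_iff hsq.ne', mul_assoc, Real.mul_self_sqrt hl0.le]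
          rw [add_mul, this]
          ring

end Moments

/-- Lévy's continuity theorem with the portmanteau theorem: an asymptotic upper bound for closed
sets from pointwise convergence of characteristic functions. -/
lemma eventually_measure_le_of_tendsto_charFun (ν : ℕ → Measure ℝ)
    [∀ n, IsProbabilityMeasure (ν n)]
    (h : ∀ t : ℝ, Tendsto (fun n => charFun (ν n) t) atTop (𝓝 (Complex.exp (-(t : ℂ) ^ 2 / 2))))
    {F : Set ℝ} (hF : IsClosed F) {ε : ℝ≥0∞} (hε : 0 < ε) :
    ∀ᶠ n in atTop, ν n F ≤ gaussianReal 0 1 F + ε := by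
  let G : ProbabilityMeasure ℝ := ⟨gaussianReal 0 1, inferInstance⟩
  let νp : ℕ → ProbabilityMeasure ℝ := fun n => ⟨ν n, inferInstance⟩
  have hT : Tendsto νp atTop (𝓝 G) := by
    refine ProbabilityMeasure.tendsto_iff_tendsto_charFun.2 fun t => ?_
    have : charFun (gaussianReal 0 1) t = Complex.exp (-(t : ℂ) ^ 2 / 2) := by
      rw [charFun_gaussianReal]
      congr 1
      simp
      ring
    simpa only [G, νp, ProbabilityMeasure.coe_mk, this] using h t
  have hls := ProbabilityMeasure.limsup_measure_closed_le_of_tendsto hT hF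
  have hlt : limsup (fun n => ν n F) atTop < gaussianReal 0 1 F + ε :=
    lt_of_le_of_lt hls (ENNReal.lt_add_right (measure_ne_top _ _) hε.ne')
  exact (eventually_lt_of_limsup_lt hlt).mono fun _ h => h.le

/-- A version of the Lyapunov theorem that is uniform over all laws with a small error term in the
characteristic function. -/
lemma exists_measure_le_of_charFun_close {F : Set ℝ} (hF : IsClosed F) {ε : ℝ≥0∞} (hε : 0 < ε) :
    ∃ l₀ : ℝ, 0 < l₀ ∧ ∀ ν : Measure ℝ, IsProbabilityMeasure ν →
      (∀ t : ℝ, t ≠ 0 → ‖charFun ν t - Complex.exp (-(t : ℂ) ^ 2 / 2)‖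
        ≤ 2 * √(t ^ 4 * l₀) * t ^ 2 + 2 * √(t ^ 4 * l₀) + t ^ 4 * l₀) →
      ν F ≤ gaussianReal 0 1 F + ε := by
  by_contra! hcon
  have hpos : ∀ n : ℕ, (0 : ℝ) < 1 / ((n : ℝ) + 1) := fun n => by positivity
  choose ν hν hch hbad using fun n : ℕ => hcon _ (hpos n)
  have hl : Tendsto (fun n : ℕ => 1 / ((n : ℝ) + 1)) atTop (𝓝 0) :=
    tendsto_one_div_add_atTop_nhds_zero_nat
  have hev := eventually_measure_le_of_tendsto_charFun ν (fun t => ?_) hF hε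
  · obtain ⟨n, hn⟩ := hev.exists
    exact absurd hn (not_le.2 (hbad n))
  · rcases eq_or_ne t 0 with rfl | ht
    · simp
    rw [tendsto_iff_norm_sub_tendsto_zero]
    refine squeeze_zero (fun _ => norm_nonneg _) (fun n => hch n t ht) ?_
    have h1 : Tendsto (fun n : ℕ => t ^ 4 * (1 / ((n : ℝ) + 1))) atTop (𝓝 0) := by
      simpa using hl.const_mul (t ^ 4)
    have h2 : Tendsto (fun n : ℕ => √(t ^ 4 * (1 / ((n : ℝ) + 1)))) atTop (𝓝 0) := by
      have := (Real.continuous_sqrt.tendsto 0).comp h1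
      simpa [Function.comp_def] using this
    simpa using (((h2.const_mul 2).mul_const (t ^ 2)).add (h2.const_mul 2)).add h1

end Matching

namespace Matching

/-! ### Self-normalized sums -/

/-- The absolute mean of a vector divided by its sample standard deviation. -/
noncomputable def tStat {N : ℕ} (d : Fin N → ℝ) : ℝ :=
  |(1 / (N : ℝ)) * ∑ i, d i| /
    Real.sqrt ((1 / ((N : ℝ) - 1)) * ∑ i, (d i - (1 / (N : ℝ)) * ∑ i, d i) ^ 2)

lemma stdStat_eq_tStat {N M : ℕ} (S : Fin N → Fin (M + 1) → ℝ) :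
    stdStat S = tStat (contrast S) := rfl

lemma tStat_div {N : ℕ} (d : Fin N → ℝ) {a : ℝ} (ha : 0 < a) :
    tStat (fun i => d i / a) = tStat d := by
  unfold tStat
  have e1 : (1 / (N : ℝ)) * ∑ i, d i / a = ((1 / (N : ℝ)) * ∑ i, d i) / a := by
    rw [← Finset.sum_div]; ring
  rw [e1]
  set m := (1 / (N : ℝ)) * ∑ i, d i
  have e2 : (1 / ((N : ℝ) - 1)) * ∑ i, (d i / a - m / a) ^ 2
      = ((1 / ((N : ℝ) - 1)) * ∑ i, (d i - m) ^ 2) / a ^ 2 := by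
    simp_rw [← sub_div, div_pow]
    rw [← Finset.sum_div, mul_div_assoc]
  rw [e2, Real.sqrt_div' _ (by positivity), Real.sqrt_sq ha.le, abs_div, abs_of_pos ha,
    div_div_div_cancel_right₀ ha.ne']

lemma sum_sub_mean_sq {N : ℕ} (hN : 0 < N) (d : Fin N → ℝ) :
    ∑ i, (d i - (1 / (N : ℝ)) * ∑ i, d i) ^ 2 = ∑ i, d i ^ 2 - (∑ i, d i) ^ 2 / N := by
  have hN' : (N : ℝ) ≠ 0 := by positivity
  simp only [sub_sq, Finset.sum_add_distrib, Finset.sum_sub_distrib, ← Finset.sum_mul,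
    ← Finset.mul_sum, Finset.sum_const, Finset.card_univ, Fintype.card_fin, nsmul_eq_mul]
  field_simp
  ring

/-- If the statistic is small, then so is the self-normalized sum; the second alternative covers a
vanishing sample variance, where the statistic is `0` by division by zero. -/
lemma sq_sum_le_of_tStat_le {N : ℕ} (hN : 2 ≤ N) {d : Fin N → ℝ} {z : ℝ}
    (h : tStat d ≤ z / √N) :
    (∑ i, d i) ^ 2 ≤ z ^ 2 * (N / (N - 1)) * ∑ i, d i ^ 2 ∨
      N * ∑ i, d i ^ 2 ≤ (∑ i, d i) ^ 2 := by
  have hN' : (2 : ℝ) ≤ N := by exact_mod_cast hN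
  have hN0 : (0 : ℝ) < N := by linarith
  have hN1 : (0 : ℝ) < N - 1 := by linarith
  unfold tStat at h
  rw [sum_sub_mean_sq (by omega)] at h
  set s := ∑ i, d i
  set q := ∑ i, d i ^ 2
  rcases le_or_gt (q - s ^ 2 / N) 0 with hR | hR
  · right
    have : N * (q - s ^ 2 / N) ≤ 0 := mul_nonpos_of_nonneg_of_nonpos hN0.le hR
    have e : N * (q - s ^ 2 / N) = N * q - s ^ 2 := by field_simp
    linarith
  · left
    have hR' : 0 < (1 / ((N : ℝ) - 1)) * (q - s ^ 2 / N) := by positivity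
    rw [div_le_div_iff₀ (Real.sqrt_pos.2 hR') (Real.sqrt_pos.2 hN0)] at h
    have h2 := pow_le_pow_left₀ (by positivity) h 2
    rw [mul_pow, mul_pow, Real.sq_sqrt hN0.le, Real.sq_sqrt hR'.le, sq_abs] at h2
    have e : (1 / (N : ℝ) * s) ^ 2 * N = s ^ 2 / N := by field_simp
    rw [e, div_le_iff₀ hN0] at h2
    refine h2.trans ?_
    have : z ^ 2 * (1 / ((N : ℝ) - 1) * (q - s ^ 2 / N)) * N
      = z ^ 2 * (N / (N - 1)) * (q - s ^ 2 / N) := by field_simp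
    rw [this]
    have h0 : 0 ≤ s ^ 2 / N := by positivity
    gcongr
    linarith

/-- The converse comparison of the statistic with the self-normalized sum. Since `0 ≤ z`, the
hypothesis excludes a vanishing sample variance. -/
lemma le_sq_sum_of_lt_tStat {N : ℕ} (hN : 2 ≤ N) {d : Fin N → ℝ} {z : ℝ} (hz : 0 ≤ z)
    (h : z / √N < tStat d) :
    z ^ 2 * ∑ i, d i ^ 2 ≤ (1 + z ^ 2 / N) * (∑ i, d i) ^ 2 := by
  have hN' : (2 : ℝ) ≤ N := by exact_mod_cast hN
  have hN0 : (0 : ℝ) < N := by linarith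
  have hN1 : (0 : ℝ) < N - 1 := by linarith
  unfold tStat at h
  rw [sum_sub_mean_sq (by omega)] at h
  set s := ∑ i, d i
  set q := ∑ i, d i ^ 2
  rcases le_or_gt (q - s ^ 2 / N) 0 with hR | hR
  · have hR' : (1 / ((N : ℝ) - 1)) * (q - s ^ 2 / N) ≤ 0 :=
      mul_nonpos_of_nonneg_of_nonpos (by positivity) hR
    rw [Real.sqrt_eq_zero_of_nonpos hR', div_zero] at h
    exact absurd h (not_lt.2 (by positivity))
  · have hR' : 0 < (1 / ((N : ℝ) - 1)) * (q - s ^ 2 / N) := by positivity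
    rw [div_lt_div_iff₀ (Real.sqrt_pos.2 hN0) (Real.sqrt_pos.2 hR')] at h
    have h2 := pow_le_pow_left₀ (by positivity) h.le 2
    rw [mul_pow, mul_pow, Real.sq_sqrt hN0.le, Real.sq_sqrt hR'.le, sq_abs] at h2
    have e : (1 / (N : ℝ) * s) ^ 2 * N = s ^ 2 / N := by field_simp
    rw [e] at h2
    have h3 : z ^ 2 * (q - s ^ 2 / N) ≤ N * (z ^ 2 * (1 / ((N : ℝ) - 1) * (q - s ^ 2 / N))) := by
      have e3 : N * (z ^ 2 * (1 / ((N : ℝ) - 1) * (q - s ^ 2 / N)))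
        = (z ^ 2 * (q - s ^ 2 / N)) * (N / (N - 1)) := by field_simp
      rw [e3]
      refine le_mul_of_one_le_right (by positivity) ?_
      rw [le_div_iff₀ hN1]
      linarith
    have h4 : N * (z ^ 2 * (1 / ((N : ℝ) - 1) * (q - s ^ 2 / N))) ≤ s ^ 2 := by
      have := mul_le_mul_of_nonneg_left h2 hN0.le
      rwa [mul_div_cancel₀ _ hN0.ne'] at this
    have e5 : (1 + z ^ 2 / N) * s ^ 2 = s ^ 2 + z ^ 2 * (s ^ 2 / N) := by field_simp
    rw [e5]
    linarith

section
variable {Ω : Type*} [MeasurableSpace Ω] {P : Measure Ω} [IsProbabilityMeasure P]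

/-- Chebyshev's inequality for a sum of pairwise independent variables. -/
lemma measure_abs_sum_sub_ge_le {ι : Type*} [Fintype ι] {X : ι → Ω → ℝ}
    (h2 : ∀ i, MemLp (X i) 2 P) (hind : Pairwise fun i j => IndepFun (X i) (X j) P)
    {δ B : ℝ} (hδ : 0 < δ) (hB : ∑ i, ∫ ω, X i ω ^ 2 ∂P ≤ B) :
    P {ω | δ ≤ |∑ i, X i ω - ∑ i, ∫ ω, X i ω ∂P|} ≤ ENNReal.ofReal (B / δ ^ 2) := by
  have hs : MemLp (∑ i, X i) 2 P := memLp_finsetSum' _ fun i _ => h2 i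
  have h := meas_ge_le_variance_div_sq hs hδ
  have e : ∫ ω, (∑ i, X i) ω ∂P = ∑ i, ∫ ω, X i ω ∂P := by
    simp only [Finset.sum_apply]
    exact integral_finsetSum _ fun i _ => (h2 i).integrable (by norm_num)
  rw [e] at h
  simp only [Finset.sum_apply] at h
  refine h.trans (ENNReal.ofReal_le_ofReal ?_)
  gcongr
  rw [IndepFun.variance_sum (fun i _ => h2 i) (fun i _ j _ hij => hind hij)]
  refine le_trans (Finset.sum_le_sum fun i _ => ?_) hB
  exact variance_le_expectation_sq (h2 i).1

/-- For independent centred summands of total variance `1` and small total fourth moment, the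
self-normalized statistic is small at most as often as a standard normal variable is. -/
theorem exists_measure_tStat_le {z z' : ℝ} (hz : 0 ≤ z) (hzz : z < z') {ε : ℝ≥0∞}
    (hε : 0 < ε) :
    ∃ l₀ : ℝ, 0 < l₀ ∧ ∃ n₀ : ℕ, ∀ (Ω : Type) (_ : MeasurableSpace Ω) (P : Measure Ω),
      IsProbabilityMeasure P → ∀ (N : ℕ) (ξ : Fin N → Ω → ℝ), n₀ ≤ N →
      (∀ i, Measurable (ξ i)) → iIndepFun ξ P → (∀ i, ∫ ω, ξ i ω ∂P = 0) →
      (∀ i, Integrable (fun ω => ξ i ω ^ 4) P) → ∑ i, ∫ ω, ξ i ω ^ 2 ∂P = 1 →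
      ∑ i, ∫ ω, ξ i ω ^ 4 ∂P ≤ l₀ →
      P {ω | tStat (fun i => ξ i ω) ≤ z / √N} ≤ gaussianReal 0 1 {w | |w| ≤ z'} + ε := by
  have hz' : 0 < z' := hz.trans_lt hzz
  have hε3 : 0 < ε / 3 := ENNReal.div_pos hε.ne' (by norm_num)
  rcases eq_or_ne ε ⊤ with rfl | hεtop
  · exact ⟨1, one_pos, 0, by simp⟩
  set e : ℝ := (ε / 3).toReal with he
  have he0 : 0 < e := ENNReal.toReal_pos hε3.ne' (by
    exact (ENNReal.div_lt_top hεtop (by norm_num)).ne)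
  have hee : ENNReal.ofReal e = ε / 3 := ENNReal.ofReal_toReal
    (ENNReal.div_lt_top hεtop (by norm_num)).ne
  -- the slack `δ` in the normalization is paid for by the gap between `z` and `z'`
  obtain ⟨δ, hδ0, hδ1, hδ⟩ : ∃ δ : ℝ, 0 < δ ∧ δ ≤ 1 / 2 ∧ z ^ 2 * (1 + δ) ^ 2 ≤ z' ^ 2 := by
    have hlt : z ^ 2 < z' ^ 2 := by gcongr
    have hc : Tendsto (fun δ : ℝ => z ^ 2 * (1 + δ) ^ 2) (𝓝[>] 0) (𝓝 (z ^ 2 * (1 + 0) ^ 2)) :=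
      ((by fun_prop : Continuous fun δ : ℝ => z ^ 2 * (1 + δ) ^ 2).tendsto 0).mono_left
        nhdsWithin_le_nhds
    have h1 := hc.eventually (gt_mem_nhds (by simpa using hlt : z ^ 2 * (1 + 0) ^ 2 < z' ^ 2))
    have h2 : ∀ᶠ δ : ℝ in 𝓝[>] 0, δ < 1 / 2 :=
      nhdsWithin_le_nhds (gt_mem_nhds (by norm_num))
    obtain ⟨δ, ⟨ha, hb⟩, hc⟩ := ((h1.and h2).and self_mem_nhdsWithin).exists
    exact ⟨δ, hc, hb.le, ha.le⟩
  have hF : IsClosed {w : ℝ | |w| ≤ z'} := isClosed_le continuous_abs continuous_const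
  obtain ⟨l₁, hl₁, hclt⟩ := exists_measure_le_of_charFun_close hF hε3
  obtain ⟨n₁, hn₁⟩ := exists_nat_gt (2 / e)
  obtain ⟨n₂, hn₂⟩ := exists_nat_gt (1 / δ)
  refine ⟨min l₁ (e * δ ^ 2), by positivity, n₁ + n₂ + 2, ?_⟩
  intro Ω _ P hP N ξ hN hm hind h0 h4 h2 hl
  have hN2 : 2 ≤ N := by omega
  have hNr : (2 : ℝ) ≤ N := by exact_mod_cast hN2
  have hNn1 : (n₁ : ℝ) ≤ N := by exact_mod_cast (by omega : n₁ ≤ N)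
  have hNn2 : (n₂ : ℝ) + 1 ≤ N := by exact_mod_cast (by omega : n₂ + 1 ≤ N)
  have hN1 : (0 : ℝ) < N - 1 := by linarith
  have hNd : (N : ℝ) / (N - 1) ≤ 1 + δ := by
    rw [div_le_iff₀ hN1]
    have : 1 / δ < N - 1 := by linarith
    rw [div_lt_iff₀ hδ0] at this
    linarith
  have i2 : ∀ i, Integrable (fun ω => ξ i ω ^ 2) P := fun i =>
    integrable_sq_of_pow_four (hm i).aestronglyMeasurable (h4 i)
  have m2 : ∀ i, MemLp (ξ i) 2 P := fun i =>
    (memLp_two_iff_integrable_sq (hm i).aestronglyMeasurable).2 (i2 i)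
  have hsub : {ω | tStat (fun i => ξ i ω) ≤ z / √N} ⊆
      ({ω | |∑ i, ξ i ω| ≤ z'} ∪ {ω | δ ≤ |∑ i, ξ i ω ^ 2 - ∑ i, ∫ ω, ξ i ω ^ 2 ∂P|})
        ∪ {ω | √(N / 2) ≤ |∑ i, ξ i ω - ∑ i, ∫ ω, ξ i ω ∂P|} := by
    intro ω hω
    by_cases hB : δ ≤ |∑ i, ξ i ω ^ 2 - ∑ i, ∫ ω, ξ i ω ^ 2 ∂P|
    · exact Or.inl (Or.inr hB)
    rw [h2, not_le, abs_lt] at hB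
    rcases sq_sum_le_of_tStat_le hN2 hω with h | h
    · refine Or.inl (Or.inl ?_)
      refine abs_le_of_sq_le_sq (h.trans (le_trans ?_ hδ)) hz'.le
      calc z ^ 2 * (N / (N - 1)) * ∑ i, ξ i ω ^ 2 ≤ z ^ 2 * (1 + δ) * (1 + δ) := by
            gcongr
            linarith [hB.2]
        _ = _ := by ring
    · refine Or.inr ?_
      simp only [h0, Finset.sum_const_zero, sub_zero, Set.mem_ofPred_eq]
      refine Real.sqrt_le_iff.2 ⟨abs_nonneg _, ?_⟩
      rw [sq_abs]
      refine le_trans ?_ h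
      rw [div_eq_mul_inv]
      gcongr
      norm_num at hB ⊢
      linarith [hB.1]
  have hmW : Measurable fun ω => ∑ i, ξ i ω := Finset.measurable_fun_sum _ fun i _ => hm i
  have b1 : P {ω | |∑ i, ξ i ω| ≤ z'} ≤ gaussianReal 0 1 {w | |w| ≤ z'} + ε / 3 := by
    have : IsProbabilityMeasure (P.map fun ω => ∑ i, ξ i ω) :=
      Measure.isProbabilityMeasure_map hmW.aemeasurable
    have := hclt (P.map fun ω => ∑ i, ξ i ω) this fun t ht => ?_
    · rwa [Measure.map_apply hmW hF.measurableSet] at this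
    · rw [charFun_apply_real, integral_map hmW.aemeasurable (by fun_prop)]
      have hind' : iIndepFun (fun i ω => t * ξ i ω) P :=
        hind.comp (fun _ x => t * x) (fun _ => by fun_prop)
      have hb := norm_integral_exp_sum_sub_le (P := P) (ξ := fun i ω => t * ξ i ω)
        (fun i => (hm i).const_mul t) hind'
        (fun i => by rw [integral_const_mul, h0, mul_zero])
        (fun i => by simpa only [mul_pow] using (h4 i).const_mul (t ^ 4))
        (l := t ^ 4 * l₁) (by positivity)
        (by
          simp only [mul_pow, integral_const_mul, ← Finset.mul_sum]
          gcongr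
          exact hl.trans (min_le_left _ _))
      simp only [mul_pow, integral_const_mul, ← Finset.mul_sum, h2, mul_one] at hb
      convert hb using 4
      · push_cast; rfl
      · push_cast; rfl
  have b2 : P {ω | δ ≤ |∑ i, ξ i ω ^ 2 - ∑ i, ∫ ω, ξ i ω ^ 2 ∂P|} ≤ ε / 3 := by
    refine (measure_abs_sum_sub_ge_le (X := fun i ω => ξ i ω ^ 2) (B := e * δ ^ 2)
      (fun i => memLp_sq_of_pow_four (hm i).aestronglyMeasurable (h4 i))
      (fun i j hij => (hind.indepFun hij).comp (φ := (· ^ 2)) (ψ := (· ^ 2))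
        (by fun_prop) (by fun_prop)) hδ0 ?_).trans ?_
    · simp only [← pow_mul]
      exact hl.trans (min_le_right _ _)
    · rw [mul_div_assoc, div_self (by positivity), mul_one, hee]
  have b3 : P {ω | √(N / 2) ≤ |∑ i, ξ i ω - ∑ i, ∫ ω, ξ i ω ∂P|} ≤ ε / 3 := by
    refine (measure_abs_sum_sub_ge_le (B := 1) m2 (fun i j hij => hind.indepFun hij)
      (by positivity) h2.le).trans ?_
    rw [← hee, Real.sq_sqrt (by positivity)]
    refine ENNReal.ofReal_le_ofReal ?_
    rw [one_div_div, div_le_iff₀ (by linarith)]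
    rw [div_lt_iff₀ he0] at hn₁
    nlinarith
  calc _ ≤ P {ω | |∑ i, ξ i ω| ≤ z'}
        + P {ω | δ ≤ |∑ i, ξ i ω ^ 2 - ∑ i, ∫ ω, ξ i ω ^ 2 ∂P|}
        + P {ω | √(N / 2) ≤ |∑ i, ξ i ω - ∑ i, ∫ ω, ξ i ω ∂P|} :=
        (measure_mono hsub).trans ((measure_union_le _ _).trans
          (add_le_add_left (measure_union_le _ _) _))
    _ ≤ gaussianReal 0 1 {w | |w| ≤ z'} + ε / 3 + ε / 3 + ε / 3 := by gcongr
    _ = _ := by rw [add_assoc, add_assoc, ← add_assoc (ε / 3), ENNReal.add_thirds]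

end
end Matching

namespace Matching

/-! ### The permutation distribution -/

/-- An order statistic exceeds `t` once fewer values than its rank are at most `t`. -/
lemma lt_orderStat {ι : Type*} [Fintype ι] (f : ι → ℝ) {j : ℕ} (hj : 1 ≤ j)
    (hjK : j ≤ Fintype.card ι) {t : ℝ}
    (h : (Finset.univ.filter fun i => f i ≤ t).card < j) : t < orderStat f j := by
  by_contra hcon
  rw [not_lt] at hcon
  unfold orderStat at hcon
  set l := (Finset.univ.val.map f).sort (· ≤ ·) with hl
  have hlen : l.length = Fintype.card ι := by simp [hl]
  have hsort : l.Pairwise (· ≤ ·) := Multiset.pairwise_sort _ _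
  have hjl : j - 1 < l.length := by omega
  rw [List.getD_eq_getElem _ _ hjl] at hcon
  have hall : ∀ x ∈ l.take j, x ≤ t := by
    intro x hx
    obtain ⟨i, hi, rfl⟩ := List.mem_take_iff_getElem.1 hx
    refine le_trans ?_ hcon
    have hi' : i ≤ j - 1 := by omega
    rcases hi'.eq_or_lt with h | h
    · simp [h]
    · exact List.pairwise_iff_getElem.1 hsort _ _ _ _ h
  have hc : l.countP (· ≤ t) = (Finset.univ.filter fun i => f i ≤ t).card := by
    have : (l : Multiset ℝ) = Finset.univ.val.map f := Multiset.sort_eq _ _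
    rw [← Multiset.coe_countP, this, Multiset.countP_map]
    rfl
  have h1 : (l.take j).countP (· ≤ t) = j := by
    rw [List.countP_eq_length.2 (by simpa using hall), List.length_take]
    omega
  have h2 := (List.take_sublist j l).countP_le (p := fun x => decide (x ≤ t))
  rw [hc] at h2
  omega

/-- The first entry of a vector minus the average of the others. -/
noncomputable def headContrast {M : ℕ} (v : Fin (M + 1) → ℝ) : ℝ :=
  v 0 - (1 / (M : ℝ)) * ∑ m : Fin M, v m.succ

lemma contrast_eq {N M : ℕ} (S : Fin N → Fin (M + 1) → ℝ) (i : Fin N) :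
    contrast S i = headContrast (S i) := rfl

lemma sum_perm_apply_eq {M : ℕ} (v : Fin (M + 1) → ℝ) (j : Fin (M + 1)) :
    ∑ σ : Equiv.Perm (Fin (M + 1)), v (σ j) = ∑ σ : Equiv.Perm (Fin (M + 1)), v (σ 0) := by
  refine Fintype.sum_equiv (Equiv.mulRight (Equiv.swap 0 j)) _ _ fun σ => ?_
  simp

/-- The contrast of a randomly permuted vector is centred. -/
lemma sum_perm_headContrast {M : ℕ} (hM : 1 ≤ M) (v : Fin (M + 1) → ℝ) :
    ∑ σ : Equiv.Perm (Fin (M + 1)), headContrast (fun j => v (σ j)) = 0 := by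
  unfold headContrast
  rw [Finset.sum_sub_distrib, ← Finset.mul_sum, Finset.sum_comm]
  simp_rw [sum_perm_apply_eq v]
  have : (M : ℝ) ≠ 0 := by positivity
  simp [this]

lemma headContrast_pow_four_le {M : ℕ} (hM : 1 ≤ M) (v : Fin (M + 1) → ℝ) :
    headContrast v ^ 4 ≤ 16 * ∑ j, v j ^ 4 := by
  obtain ⟨j, -, hj⟩ := Finset.exists_max_image Finset.univ (fun j => |v j|) ⟨0, Finset.mem_univ _⟩
  have hM' : (0 : ℝ) < M := by positivity
  have h1 : |headContrast v| ≤ 2 * |v j| := by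
    have h2 : |(1 / (M : ℝ)) * ∑ m : Fin M, v m.succ| ≤ |v j| := by
      rw [abs_mul, abs_of_pos (by positivity : 0 < 1 / (M : ℝ)), one_div, inv_mul_le_iff₀ hM']
      refine (Finset.abs_sum_le_sum_abs _ _).trans ?_
      refine (Finset.sum_le_sum fun m _ => hj _ (Finset.mem_univ _)).trans ?_
      simp
    calc |headContrast v| ≤ |v 0| + |(1 / (M : ℝ)) * ∑ m : Fin M, v m.succ| := abs_sub _ _
      _ ≤ |v j| + |v j| := add_le_add (hj _ (Finset.mem_univ _)) h2
      _ = _ := by ring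
  calc headContrast v ^ 4 = |headContrast v| ^ 4 := (Even.pow_abs (by decide) _).symm
    _ ≤ (2 * |v j|) ^ 4 := by gcongr
    _ = 16 * v j ^ 4 := by
      rw [mul_pow, Even.pow_abs (by decide)]; norm_num
    _ ≤ _ := by
      gcongr
      exact Finset.single_le_sum (f := fun j => v j ^ 4) (fun i _ => by positivity)
        (Finset.mem_univ j)

/-- The permutation critical value is asymptotically at least the normal one, uniformly over all
arrays whose contrasts have second moments bounded below and whose entries have fourth moments of
smaller order than their number. -/
theorem exists_lt_orderStat_stdStat {M : ℕ} (hM : 1 ≤ M) {z z' a α : ℝ} (hz : 0 ≤ z)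
    (hzz : z < z') (ha : 0 < a) (hα₀ : 0 < α) (hα₁ : α < 1)
    (hα : gaussianReal 0 1 {w | |w| ≤ z'} < ENNReal.ofReal (1 - α)) :
    ∃ n₀ : ℕ, ∀ (N : ℕ) (S : Fin N → Fin (M + 1) → ℝ), n₀ ≤ N →
      a * N ≤ ∑ i, contrast S i ^ 2 → ∑ i, ∑ j, S i j ^ 4 ≤ N * √N →
      z / √N < orderStat (fun π : PermGroup N M => stdStat (permute S π))
        ⌈(Fintype.card (PermGroup N M) : ℝ) * (1 - α)⌉₊ := by
  obtain ⟨ε, hε, hεα⟩ : ∃ ε : ℝ≥0∞, 0 < ε ∧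
      gaussianReal 0 1 {w | |w| ≤ z'} + ε < ENNReal.ofReal (1 - α) := by
    obtain ⟨ε, h1, h2⟩ := ENNReal.lt_iff_exists_add_pos_lt.1 hα
    exact ⟨ε, by exact_mod_cast h1, h2⟩
  obtain ⟨l₀, hl₀, n₁, hclt⟩ := exists_measure_tStat_le hz hzz hε
  -- permutations are given the discrete σ-algebra, and a uniform family of permutations is seen as
  -- an independent family of uniform ones
  let _ : MeasurableSpace (Equiv.Perm (Fin (M + 1))) := ⊤
  have hdisc : DiscreteMeasurableSpace (Equiv.Perm (Fin (M + 1))) :=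
    ⟨fun _ => MeasurableSpace.measurableSet_top⟩
  set K : ℝ := (Fintype.card (Equiv.Perm (Fin (M + 1))) : ℝ) with hK
  have hK0 : 0 < K := by rw [hK]; exact_mod_cast Fintype.card_pos
  obtain ⟨n₂, hn₂⟩ := exists_nat_gt ((16 * K ^ 2 / (a ^ 2 * l₀)) ^ 2)
  refine ⟨n₁ + n₂ + 1, fun N S hN hA hL => ?_⟩
  have hNpos : (0 : ℝ) < N := by exact_mod_cast (by omega : 0 < N)
  let μ : Measure (Equiv.Perm (Fin (M + 1))) := uniformOn Set.univ
  have hμ : IsProbabilityMeasure μ :=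
    isProbabilityMeasure_uniformOn Set.finite_univ Set.univ_nonempty
  let P : Measure (PermGroup N M) := Measure.pi fun _ => μ
  have hPu : P = uniformOn Set.univ := by
    have := (uniformOn_pi (Ω := Equiv.Perm (Fin (M + 1))) (f := fun _ : Fin N => (Set.univ : Set (Equiv.Perm (Fin (M + 1)))))).symm
    rwa [Set.pi_univ] at this
  have hint : ∀ f : Equiv.Perm (Fin (M + 1)) → ℝ, ∫ σ, f σ ∂μ = (∑ σ, f σ) / K := by
    intro f
    rw [integral_fintype .of_finite, Finset.sum_div]
    refine Finset.sum_congr rfl fun σ _ => ?_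
    rw [measureReal_def, uniformOn_univ, Measure.count_singleton]
    simp [hK, div_eq_inv_mul]
  set D : Fin N → Equiv.Perm (Fin (M + 1)) → ℝ := fun i σ => headContrast (fun j => S i (σ j)) with hD
  -- the permutation variance, of order at least `N`
  set V : ℝ := ∑ i, ∫ σ, D i σ ^ 2 ∂μ with hV
  have hVlow : a * N / K ≤ V := by
    rw [hV]
    refine (div_le_div_of_nonneg_right hA hK0.le).trans ?_
    rw [Finset.sum_div]
    refine Finset.sum_le_sum fun i _ => ?_
    rw [hint]
    gcongr
    -- the identity permutation alone contributes the observed contrast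
    have := Finset.single_le_sum (f := fun σ => D i σ ^ 2) (fun _ _ => sq_nonneg _)
      (Finset.mem_univ (1 : Equiv.Perm (Fin (M + 1))))
    exact this
  have hVpos : 0 < V := lt_of_lt_of_le (by positivity) hVlow
  have hsV : 0 < √V := Real.sqrt_pos.2 hVpos
  set ξ : Fin N → PermGroup N M → ℝ := fun i π => D i (π i) / √V with hξ
  have heval : ∀ (i : Fin N) (f : Equiv.Perm (Fin (M + 1)) → ℝ), ∫ π, f (π i) ∂P = ∫ σ, f σ ∂μ := fun i f =>
    integral_comp_eval (μ := fun _ : Fin N => μ) (i := i) .of_discrete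
  have hsq : √V ^ 2 = V := Real.sq_sqrt hVpos.le
  have hbound := hclt (PermGroup N M) inferInstance P inferInstance N ξ (by omega)
    (fun i => .of_discrete) (iIndepFun_pi (X := fun i σ => D i σ / √V)
      (fun i => Measurable.of_discrete.aemeasurable))
    (fun i => by
      rw [heval i (fun σ => D i σ / √V), hint, ← Finset.sum_div, sum_perm_headContrast hM]
      simp)
    (fun i => .of_finite)
    (by
      simp only [hξ, div_pow, hsq]
      simp_rw [fun i => heval i (fun σ => D i σ ^ 2 / V), integral_div, ← Finset.sum_div]
      exact div_self hVpos.ne')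
    (by
      have h4 : √V ^ 4 = V ^ 2 := by rw [show √V ^ 4 = (√V ^ 2) ^ 2 by ring, hsq]
      simp only [hξ, div_pow, h4]
      simp_rw [fun i => heval i (fun σ => D i σ ^ 4 / V ^ 2), integral_div, ← Finset.sum_div]
      have hD4 : ∀ i, ∫ σ, D i σ ^ 4 ∂μ ≤ 16 * ∑ j, S i j ^ 4 := by
        intro i
        rw [hint, div_le_iff₀ hK0]
        calc ∑ σ, D i σ ^ 4 ≤ ∑ _σ : Equiv.Perm (Fin (M + 1)), 16 * ∑ j, S i j ^ 4 := by
              refine Finset.sum_le_sum fun σ _ => ?_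
              refine (headContrast_pow_four_le hM _).trans (le_of_eq ?_)
              rw [Equiv.sum_comp σ (fun j => S i j ^ 4)]
          _ = _ := by simp [hK, mul_comm]
      have hsum : ∑ i, ∫ σ, D i σ ^ 4 ∂μ ≤ 16 * (N * √N) := by
        refine (Finset.sum_le_sum fun i _ => hD4 i).trans ?_
        rw [← Finset.mul_sum]
        gcongr
      rw [div_le_iff₀ (by positivity)]
      refine hsum.trans ?_
      have hsN : 16 * K ^ 2 / (a ^ 2 * l₀) ≤ √N := by
        refine Real.le_sqrt_of_sq_le (hn₂.le.trans ?_)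
        exact_mod_cast (by omega : n₂ ≤ N)
      rw [div_le_iff₀ (by positivity)] at hsN
      have hNN : (N : ℝ) = √N * √N := (Real.mul_self_sqrt hNpos.le).symm
      calc 16 * ((N : ℝ) * √N) ≤ l₀ * (a * N / K) ^ 2 := by
            rw [div_pow, mul_div_assoc', le_div_iff₀ (by positivity)]
            have h0 : 0 ≤ (N : ℝ) * √N := by positivity
            have := mul_le_mul_of_nonneg_right hsN h0
            calc _ = 16 * K ^ 2 * (N * √N) := by ring
              _ ≤ √N * (a ^ 2 * l₀) * (N * √N) := this
              _ = (√N * √N) * (a ^ 2 * l₀) * N := by ring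
              _ = _ := by rw [← hNN]; ring
        _ ≤ l₀ * V ^ 2 := by gcongr)
  have hstat : ∀ π : PermGroup N M, tStat (fun i => ξ i π) = stdStat (permute S π) := fun π => by
    rw [stdStat_eq_tStat]
    exact tStat_div (contrast (permute S π)) hsV
  simp_rw [hstat] at hbound
  have hlt := hbound.trans_lt hεα
  have hcK : 0 < (Fintype.card (PermGroup N M) : ℝ) := by exact_mod_cast Fintype.card_pos
  refine lt_orderStat _ ?_ ?_ ?_
  · exact Nat.one_le_iff_ne_zero.2 (Nat.ceil_pos.2 (by
      have : 0 < 1 - α := by linarith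
      positivity)).ne'
  · refine Nat.ceil_le.2 ?_
    nlinarith
  · rw [hPu, uniformOn_univ, Measure.count_apply (Set.toFinite _).measurableSet] at hlt
    have hcard : Set.encard {π : PermGroup N M | stdStat (permute S π) ≤ z / √N}
        = ((Finset.univ.filter fun π : PermGroup N M =>
          stdStat (permute S π) ≤ z / √N).card : ℕ) := by
      rw [← Set.encard_coe_eq_coe_finsetCard]
      simp
    rw [hcard] at hlt
    rw [Nat.lt_ceil]
    have h3 : ENNReal.ofReal (((Finset.univ.filter fun π : PermGroup N M =>
        stdStat (permute S π) ≤ z / √N).card : ℝ) / Fintype.card (PermGroup N M))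
        < ENNReal.ofReal (1 - α) := by
      rw [ENNReal.ofReal_div_of_pos hcK, ENNReal.ofReal_natCast, ENNReal.ofReal_natCast]
      simpa using hlt
    have h4 := (ENNReal.ofReal_lt_ofReal_iff (by linarith)).1 h3
    rw [div_lt_iff₀ hcK] at h4
    linarith

end Matching

namespace Matching

/-! ### Nearest neighbours -/

lemma continuous_quadForm {k : ℕ} (V : Matrix (Fin k) (Fin k) ℝ) :
    Continuous fun v : Cov k => (fun l => v l) ⬝ᵥ (V *ᵥ (fun l => v l)) := by
  refine Continuous.dotProduct (by fun_prop) (Continuous.matrix_mulVec continuous_const (by fun_prop))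

lemma matchDist_eq {k : ℕ} (V : Matrix (Fin k) (Fin k) ℝ) (a b : Cov k) :
    matchDist V a b = √((fun l => (a - b) l) ⬝ᵥ (V *ᵥ (fun l => (a - b) l))) := rfl

lemma measurable_matchDist {k : ℕ} (V : Matrix (Fin k) (Fin k) ℝ) :
    Measurable fun p : Cov k × Cov k => matchDist V p.1 p.2 := by
  simp only [matchDist_eq]
  exact ((Real.continuous_sqrt.comp (continuous_quadForm V)).comp
    (continuous_fst.sub continuous_snd)).measurable

/-- The matching metric is equivalent to the Euclidean one. -/
lemma exists_matchDist_equiv {k : ℕ} (hk : 1 ≤ k) {V : Matrix (Fin k) (Fin k) ℝ}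
    (hV : V.PosDef) :
    ∃ l u : ℝ, 0 < l ∧ 0 < u ∧
      ∀ a b : Cov k, l * ‖a - b‖ ≤ matchDist V a b ∧ matchDist V a b ≤ u * ‖a - b‖ := by
  set q : Cov k → ℝ := fun v => (fun l => v l) ⬝ᵥ (V *ᵥ (fun l => v l)) with hq
  have hcont : Continuous q := continuous_quadForm V
  have hpos : ∀ v, v ≠ 0 → 0 < q v := by
    intro v hv
    have hv' : (fun l => v l) ≠ 0 := fun h => hv (by ext i; exact congrFun h i)
    have := hV.dotProduct_mulVec_pos hv'
    simpa using this
  have hhom : ∀ (c : ℝ) v, q (c • v) = c ^ 2 * q v := by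
    intro c v
    have : (fun l => (c • v) l) = c • (fun l => v l) := rfl
    simp only [hq]
    rw [this, Matrix.mulVec_smul, dotProduct_smul, smul_dotProduct, smul_eq_mul, smul_eq_mul]
    ring
  have hne : (Metric.sphere (0 : Cov k) 1).Nonempty :=
    ⟨EuclideanSpace.single ⟨0, hk⟩ 1, by simp⟩
  obtain ⟨p, hp, hmin⟩ := (isCompact_sphere (0 : Cov k) 1).exists_isMinOn hne hcont.continuousOn
  obtain ⟨p', hp', hmax⟩ := (isCompact_sphere (0 : Cov k) 1).exists_isMaxOn hne hcont.continuousOn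
  have hn : ∀ p ∈ Metric.sphere (0 : Cov k) 1, 0 < q p := fun p hp => hpos p (by
    rintro rfl
    simp at hp)
  refine ⟨√(q p), √(q p'), Real.sqrt_pos.2 (hn p hp), Real.sqrt_pos.2 (hn p' hp'), fun a b => ?_⟩
  rw [matchDist_eq]
  change _ ≤ √(q (a - b)) ∧ √(q (a - b)) ≤ _
  rcases eq_or_ne (a - b) 0 with h | h
  · have : q 0 = 0 := by simpa using hhom 0 0
    simp [h, this]
  · have hnorm : 0 < ‖a - b‖ := norm_pos_iff.2 h
    set w := ‖a - b‖⁻¹ • (a - b) with hw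
    have hws : w ∈ Metric.sphere (0 : Cov k) 1 := by
      simp [hw, norm_smul, hnorm.ne']
    have hab : a - b = ‖a - b‖ • w := by
      rw [hw, smul_smul, mul_inv_cancel₀ hnorm.ne', one_smul]
    have e : √(q (a - b)) = √(q w) * ‖a - b‖ := by
      conv_lhs => rw [hab, hhom]
      rw [Real.sqrt_mul (by positivity), Real.sqrt_sq hnorm.le, mul_comm]
    rw [e]
    exact ⟨by gcongr; exact hmin hws, by gcongr; exact hmax hws⟩

lemma apply_sort_le_of_lt_card {n : ℕ} {f : Fin n → ℝ} {t : ℝ} {m : ℕ}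
    (h : m < (Finset.univ.filter fun j => f j ≤ t).card) :
    ∃ hm : m < n, f (Tuple.sort f ⟨m, hm⟩) ≤ t := by
  have hm : m < n := h.trans_le ((Finset.card_filter_le _ _).trans (by simp))
  refine ⟨hm, ?_⟩
  refine (Tuple.lt_card_le_iff_apply_le_of_monotone (f := f ∘ Tuple.sort f) (j := ⟨m, hm⟩)
    (Tuple.monotone_sort f)).1 ?_
  have : (Finset.univ.filter fun i => (f ∘ Tuple.sort f) i ≤ t).card
      = (Finset.univ.filter fun j => f j ≤ t).card :=
    Finset.card_bijective (Tuple.sort f) (Tuple.sort f).bijective (by simp)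
  rw [this]
  exact h

lemma measurable_sort_apply {α : Type*} [MeasurableSpace α] {n : ℕ} {f : α → Fin n → ℝ}
    (hf : ∀ j, Measurable fun a => f a j) (m : Fin n) :
    Measurable fun a => Tuple.sort (f a) m := by
  let _ : MeasurableSpace (Equiv.Perm (Fin n)) := ⊤
  have hdisc : DiscreteMeasurableSpace (Equiv.Perm (Fin n)) :=
    ⟨fun _ => MeasurableSpace.measurableSet_top⟩
  have h : Measurable fun a => Tuple.sort (f a) := by
    refine measurable_to_countable' fun σ => ?_
    have : (fun a => Tuple.sort (f a)) ⁻¹' {σ}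
        = {a | ∀ i j, (i ≤ j → f a (σ i) ≤ f a (σ j)) ∧
            (i < j → f a (σ i) = f a (σ j) → σ i < σ j)} := by
      ext a
      simp only [Set.mem_preimage, Set.mem_singleton_iff, Set.mem_ofPred_eq]
      rw [eq_comm, Tuple.eq_sort_iff]
      constructor
      · rintro ⟨h1, h2⟩ i j
        exact ⟨fun hij => h1 hij, h2 i j⟩
      · intro h
        exact ⟨fun i j hij => (h i j).1 hij, fun i j => (h i j).2⟩
    rw [this]
    have e : {a | ∀ i j, (i ≤ j → f a (σ i) ≤ f a (σ j)) ∧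
            (i < j → f a (σ i) = f a (σ j) → σ i < σ j)}
        = ⋂ i, ⋂ j, {a | (i ≤ j → f a (σ i) ≤ f a (σ j)) ∧
            (i < j → f a (σ i) = f a (σ j) → σ i < σ j)} := by
      ext a; simp
    rw [e]
    refine MeasurableSet.iInter fun i => MeasurableSet.iInter fun j => ?_
    refine MeasurableSet.inter (s₁ := {a | i ≤ j → f a (σ i) ≤ f a (σ j)})
      (s₂ := {a | i < j → f a (σ i) = f a (σ j) → σ i < σ j}) ?_ ?_
    · by_cases hij : i ≤ j
      · simpa [hij] using measurableSet_le (hf _) (hf _)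
      · simp [hij]
    · by_cases hij : i < j ∧ ¬ σ i < σ j
      · simp only [hij.1, hij.2, true_imp_iff, imp_false]
        exact (measurableSet_eq_fun (hf _) (hf _)).compl
      · have : {a | i < j → f a (σ i) = f a (σ j) → σ i < σ j} = Set.univ := by
          ext a; simp only [Set.mem_ofPred_eq, Set.mem_univ, iff_true]; tauto
        rw [this]
        exact MeasurableSet.univ
  exact (Measurable.of_discrete (f := fun σ : Equiv.Perm (Fin n) => σ m)).comp h

lemma measurable_matchedOutcomes {k N₁ N₀ : ℕ} (V : Matrix (Fin k) (Fin k) ℝ) (M : ℕ) (c : ℝ)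
    (i : Fin N₁) (j : Fin (M + 1)) :
    Measurable fun z : Fin N₁ ⊕ Fin N₀ → ℝ × Cov k => matchedOutcomes V M c z i j := by
  unfold matchedOutcomes
  refine Fin.cases ?_ (fun m => ?_) j
  · simp only [Fin.cons_zero]
    fun_prop
  · simp only [Fin.cons_succ]
    unfold neighborOutcome
    by_cases h : (m : ℕ) < N₀
    · simp only [h, dite_true]
      have hs := measurable_sort_apply (α := Fin N₁ ⊕ Fin N₀ → ℝ × Cov k)
        (f := fun z j => matchDist V (z (Sum.inl i)).2 (z (Sum.inr j)).2)
        (fun j => (measurable_matchDist V).comp (by fun_prop :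
          Measurable fun z : Fin N₁ ⊕ Fin N₀ → ℝ × Cov k =>
            ((z (Sum.inl i)).2, (z (Sum.inr j)).2))) ⟨m, h⟩
      have hp : Measurable fun p : (Fin N₁ ⊕ Fin N₀ → ℝ × Cov k) × Fin N₀ =>
          (p.1 (Sum.inr p.2)).1 :=
        measurable_from_prod_countable_left fun j =>
          measurable_fst.comp (measurable_pi_apply (Sum.inr j))
      exact hp.comp (measurable_id.prodMk hs)
    · simp [h]

/-- The unit that occupies a place of the matched array: the treated unit itself in place `0`, its
`m`-th nearest control in place `m`. The place is filled by the treated unit again when there are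
too few controls. -/
noncomputable def matchIdx {k N₁ N₀ : ℕ} (V : Matrix (Fin k) (Fin k) ℝ) {M : ℕ}
    (x : Fin N₁ ⊕ Fin N₀ → Cov k) (p : Fin N₁ × Fin (M + 1)) : Fin N₁ ⊕ Fin N₀ :=
  Fin.cases (motive := fun _ => Fin N₁ ⊕ Fin N₀) (Sum.inl p.1)
    (fun m : Fin M => if h : (m : ℕ) < N₀ then
      Sum.inr (Tuple.sort (fun j => matchDist V (x (Sum.inl p.1)) (x (Sum.inr j))) ⟨m, h⟩)
      else Sum.inl p.1) p.2

@[simp] lemma matchIdx_zero {k N₁ N₀ : ℕ} (V : Matrix (Fin k) (Fin k) ℝ) {M : ℕ}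
    (x : Fin N₁ ⊕ Fin N₀ → Cov k) (i : Fin N₁) :
    matchIdx V (M := M) x (i, 0) = Sum.inl i := rfl

lemma matchIdx_succ {k N₁ N₀ : ℕ} (V : Matrix (Fin k) (Fin k) ℝ) {M : ℕ}
    (x : Fin N₁ ⊕ Fin N₀ → Cov k) (i : Fin N₁) (m : Fin M) (h : (m : ℕ) < N₀) :
    matchIdx V (M := M) x (i, m.succ) =
      Sum.inr (Tuple.sort (fun j => matchDist V (x (Sum.inl i)) (x (Sum.inr j))) ⟨m, h⟩) := by
  simp [matchIdx, h]

lemma matchedOutcomes_eq {k N₁ N₀ : ℕ} (V : Matrix (Fin k) (Fin k) ℝ) {M : ℕ} (hM : M ≤ N₀) (c : ℝ)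
    (z : Fin N₁ ⊕ Fin N₀ → ℝ × Cov k) (i : Fin N₁) (j : Fin (M + 1)) :
    matchedOutcomes V M c z i j
      = (z (matchIdx V (fun e => (z e).2) (i, j))).1 - if j = 0 then c else 0 := by
  refine Fin.cases ?_ (fun m => ?_) j
  · simp [matchedOutcomes]
  · have h : (m : ℕ) < N₀ := m.2.trans_le hM
    rw [matchIdx_succ V _ i m h]
    simp [matchedOutcomes, neighborOutcome, h]

/-- A configuration of covariates in which the treated units are far apart and each has at least
`M` controls nearby. -/
def WellMatched {k N₁ N₀ : ℕ} (M : ℕ) (r R : ℝ) (x : Fin N₁ ⊕ Fin N₀ → Cov k) : Prop :=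
  (∀ i i' : Fin N₁, i ≠ i' → R < ‖x (Sum.inl i) - x (Sum.inl i')‖) ∧
  ∀ i : Fin N₁, M ≤ (Finset.univ.filter fun j : Fin N₀ =>
    ‖x (Sum.inl i) - x (Sum.inr j)‖ ≤ r).card

/-- The `M` nearest controls are at least as close as the `M` nearby ones, up to the distortion
`u / l` of the matching metric. -/
lemma WellMatched.dist_le {k N₁ N₀ M : ℕ} {r R l u : ℝ} (hl : 0 < l) (hu : 0 < u)
    {V : Matrix (Fin k) (Fin k) ℝ}
    (hV : ∀ a b : Cov k, l * ‖a - b‖ ≤ matchDist V a b ∧ matchDist V a b ≤ u * ‖a - b‖)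
    {x : Fin N₁ ⊕ Fin N₀ → Cov k} (hx : WellMatched M r R x) (hM : M ≤ N₀) (hr : 0 ≤ r)
    (i : Fin N₁) (j : Fin (M + 1)) :
    ‖x (Sum.inl i) - x (matchIdx V x (i, j))‖ ≤ u / l * r := by
  refine Fin.cases ?_ (fun m => ?_) j
  · simp only [matchIdx_zero, sub_self, norm_zero]
    positivity
  · have h : (m : ℕ) < N₀ := m.2.trans_le hM
    rw [matchIdx_succ V _ i m h]
    obtain ⟨h', hle⟩ := apply_sort_le_of_lt_card
      (f := fun j => matchDist V (x (Sum.inl i)) (x (Sum.inr j))) (t := u * r) (m := m) (by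
        refine (m.2.trans_le (hx.2 i)).trans_le (Finset.card_le_card fun j hj => ?_)
        simp only [Finset.mem_filter, Finset.mem_univ, true_and] at hj ⊢
        exact (hV _ _).2.trans (by gcongr))
    have := (hV _ _).1.trans hle
    rw [div_mul_eq_mul_div, le_div_iff₀ hl]
    linarith

/-- When treated units are further apart than twice the matching discrepancy, they share no
matches. -/
lemma WellMatched.injective {k N₁ N₀ M : ℕ} {r R l u : ℝ} (hl : 0 < l) (hu : 0 < u)
    {V : Matrix (Fin k) (Fin k) ℝ}
    (hV : ∀ a b : Cov k, l * ‖a - b‖ ≤ matchDist V a b ∧ matchDist V a b ≤ u * ‖a - b‖)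
    {x : Fin N₁ ⊕ Fin N₀ → Cov k} (hx : WellMatched M r R x) (hM : M ≤ N₀) (hr : 0 ≤ r)
    (hR : 2 * (u / l * r) ≤ R) : Function.Injective (matchIdx V (M := M) x) := by
  rintro ⟨i, j⟩ ⟨i', j'⟩ h
  have hi : i = i' := by
    by_contra hne
    have h1 := hx.dist_le hl hu hV hM hr i j
    have h2 := hx.dist_le hl hu hV hM hr i' j'
    rw [h] at h1
    have h3 := hx.1 i i' hne
    have h4 := norm_sub_le_norm_sub_add_norm_sub (x (Sum.inl i)) (x (matchIdx V x (i', j')))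
      (x (Sum.inl i'))
    rw [norm_sub_rev (x (matchIdx V x (i', j')))] at h4
    linarith
  subst hi
  refine Prod.ext rfl ?_
  revert h
  refine Fin.cases ?_ (fun m => ?_) j <;> refine Fin.cases ?_ (fun m' => ?_) j'
  · simp
  · rw [matchIdx_succ V _ i m' (m'.2.trans_le hM)]
    simp
  · rw [matchIdx_succ V _ i m (m.2.trans_le hM)]
    simp
  · rw [matchIdx_succ V _ i m (m.2.trans_le hM), matchIdx_succ V _ i m' (m'.2.trans_le hM)]
    intro h
    have := (Tuple.sort _).injective (Sum.inr_injective h)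
    simpa [Fin.ext_iff] using this

end Matching

namespace Matching

/-! ### Representation of the conditional outcome laws -/

namespace Population

variable {k : ℕ} {Ω : Type*} [MeasurableSpace Ω] (pop : Population k Ω)

instance isProbabilityMeasure_arm (w : Fin 2) : IsProbabilityMeasure (pop.arm w) :=
  cond_isProbabilityMeasure (pop.pos_arm w)

lemma measurable_obs : Measurable pop.obs := by
  have h : Measurable fun p : Ω × Fin 2 => pop.Y p.2 p.1 :=
    measurable_from_prod_countable_left fun w => pop.measurable_Y w
  exact h.comp (measurable_id.prodMk pop.measurable_W)

instance isProbabilityMeasure_lawX (w : Fin 2) : IsProbabilityMeasure (pop.lawX w) :=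
  Measure.isProbabilityMeasure_map pop.measurable_X.aemeasurable

instance isProbabilityMeasure_lawYX (w : Fin 2) : IsProbabilityMeasure (pop.lawYX w) :=
  Measure.isProbabilityMeasure_map (pop.measurable_obs.prodMk pop.measurable_X).aemeasurable

lemma ae_arm_W (w : Fin 2) : ∀ᵐ ω ∂pop.arm w, pop.W ω = w :=
  ae_cond_mem (pop.measurable_W (measurableSet_singleton w))

lemma ae_lawX_mem_supp (w : Fin 2) : ∀ᵐ x ∂pop.lawX w, x ∈ pop.supp w :=
  Measure.support_mem_ae_of_regular

lemma ae_arm_mem_supp (w : Fin 2) : ∀ᵐ ω ∂pop.arm w, pop.X ω ∈ pop.supp w :=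
  ae_of_ae_map pop.measurable_X.aemeasurable (pop.ae_lawX_mem_supp w)

/-- A kernel that disintegrates the law of `(X, Y)` given `W = w` over `X` computes conditional
expectations. -/
lemma ae_integral_kernel_eq {w : Fin 2} {κ : Kernel (Cov k) ℝ} [IsMarkovKernel κ]
    (hκ : (pop.arm w).map (fun ω => (pop.X ω, pop.obs ω)) = pop.lawX w ⊗ₘ κ)
    {F : Ω → ℝ} {f : Cov k × ℝ → ℝ} (hf : Measurable f)
    (hF : F =ᵐ[pop.arm w] fun ω => f (pop.X ω, pop.obs ω)) (hFi : Integrable F (pop.arm w)) :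
    (pop.arm w)[F | MeasurableSpace.comap pop.X inferInstance] =ᵐ[pop.arm w]
      (fun ω => ∫ y, f (pop.X ω, y) ∂κ (pop.X ω)) ∧
    ∀ᵐ x ∂pop.lawX w, Integrable (fun y => f (x, y)) (κ x) := by
  have hi : Integrable (fun ω => f (pop.X ω, pop.obs ω)) (pop.arm w) := hFi.congr hF
  constructor
  · refine (condExp_congr_ae hF).trans ?_
    refine (condExp_prod_ae_eq_integral_condDistrib pop.measurable_X
      pop.measurable_obs.aemeasurable hf.stronglyMeasurable hi).trans ?_
    have h := (condDistrib_ae_eq_iff_measure_eq_compProd pop.X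
      pop.measurable_obs.aemeasurable κ).2 hκ
    filter_upwards [ae_of_ae_map pop.measurable_X.aemeasurable h] with ω hω
    rw [hω]
  · have h2 : Integrable f (pop.lawX w ⊗ₘ κ) := by
      rw [← hκ]
      exact (integrable_map_measure hf.aestronglyMeasurable
        (pop.measurable_X.prodMk pop.measurable_obs).aemeasurable).2 hi
    exact ((Measure.integrable_compProd_iff hf.aestronglyMeasurable).1 h2).1

lemma IsCondMean.ae_integral_kernel_eq {w : Fin 2} {κ : Kernel (Cov k) ℝ} [IsMarkovKernel κ]
    (hκ : (pop.arm w).map (fun ω => (pop.X ω, pop.obs ω)) = pop.lawX w ⊗ₘ κ)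
    {F : Ω → ℝ} {f : Cov k × ℝ → ℝ} (hf : Measurable f)
    (hF : F =ᵐ[pop.arm w] fun ω => f (pop.X ω, pop.obs ω)) {g g' : Cov k → ℝ}
    (hg : pop.IsCondMean w F g) (hg' : Measurable g') (hgg : ∀ x ∈ pop.supp w, g' x = g x) :
    ∀ᵐ x ∂pop.lawX w, Integrable (fun y => f (x, y)) (κ x) ∧ ∫ y, f (x, y) ∂κ x = g' x := by
  obtain ⟨h1, h2⟩ := pop.ae_integral_kernel_eq hκ hf hF hg.1
  suffices h3 : ∀ᵐ x ∂pop.lawX w, ∫ y, f (x, y) ∂κ x = g' x by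
    filter_upwards [h2, h3] with x a b using ⟨a, b⟩
  have hm : MeasurableSet {x | ∫ y, f (x, y) ∂κ x = g' x} :=
    measurableSet_eq_fun hf.stronglyMeasurable.integral_kernel_prod_right'.measurable hg'
  refine (ae_map_iff pop.measurable_X.aemeasurable hm).2 ?_
  filter_upwards [h1, hg.2, pop.ae_arm_mem_supp w] with ω a b c
  rw [← a, b, hgg _ c]

lemma IsCondMean.ae_integral_kernel_le {w : Fin 2} {κ : Kernel (Cov k) ℝ} [IsMarkovKernel κ]
    (hκ : (pop.arm w).map (fun ω => (pop.X ω, pop.obs ω)) = pop.lawX w ⊗ₘ κ)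
    {F : Ω → ℝ} {f : Cov k × ℝ → ℝ} (hf : Measurable f)
    (hF : F =ᵐ[pop.arm w] fun ω => f (pop.X ω, pop.obs ω)) {g : Cov k → ℝ}
    (hg : pop.IsCondMean w F g) {C : ℝ} (hgC : ∀ x ∈ pop.supp w, g x ≤ C) :
    ∀ᵐ x ∂pop.lawX w, Integrable (fun y => f (x, y)) (κ x) ∧ ∫ y, f (x, y) ∂κ x ≤ C := by
  obtain ⟨h1, h2⟩ := pop.ae_integral_kernel_eq hκ hf hF hg.1
  suffices h3 : ∀ᵐ x ∂pop.lawX w, ∫ y, f (x, y) ∂κ x ≤ C by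
    filter_upwards [h2, h3] with x a b using ⟨a, b⟩
  have hm : MeasurableSet {x | ∫ y, f (x, y) ∂κ x ≤ C} :=
    measurableSet_le hf.stronglyMeasurable.integral_kernel_prod_right'.measurable measurable_const
  refine (ae_map_iff pop.measurable_X.aemeasurable hm).2 ?_
  filter_upwards [h1, hg.2, pop.ae_arm_mem_supp w] with ω a b c
  rw [← a, b]
  exact hgC _ c

/-- By conditional independence, one kernel disintegrates the law of `(X, Y 0)` in both treatment
arms. -/
lemma exists_control_kernel [StandardBorelSpace Ω] (hCIA : pop.CIA) :
    ∃ κ : Kernel (Cov k) ℝ, IsMarkovKernel κ ∧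
      ∀ w, (pop.arm w).map (fun ω => (pop.X ω, pop.Y 0 ω)) = pop.lawX w ⊗ₘ κ := by
  refine ⟨condDistrib (pop.Y 0) pop.X pop.P, inferInstance, fun w => ?_⟩
  set κ := condDistrib (pop.Y 0) pop.X pop.P
  have h := (condIndepFun_iff_condDistrib_prod_ae_eq_prodMkRight (pop.measurable_Y 0)
    pop.measurable_W pop.measurable_X).1 (CondIndepFun.symm hCIA)
  rw [condDistrib_ae_eq_iff_measure_eq_compProd _ (pop.measurable_Y 0).aemeasurable] at h
  have hmXY := pop.measurable_X.prodMk (pop.measurable_Y 0)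
  have hmXW := pop.measurable_X.prodMk pop.measurable_W
  ext A hA
  have hw : MeasurableSet (pop.W ⁻¹' {w}) := pop.measurable_W (measurableSet_singleton w)
  have hAm : Measurable fun x => κ x (Prod.mk x ⁻¹' A) :=
    Kernel.measurable_kernel_prodMk_left hA
  rw [Measure.map_apply hmXY hA, Measure.compProd_apply hA, lawX,
    lintegral_map hAm pop.measurable_X, arm, cond_apply hw, ProbabilityTheory.cond, lintegral_smul_measure]
  congr 1
  let A' : Set ((Cov k × Fin 2) × ℝ) := {p | p.1.2 = w ∧ (p.1.1, p.2) ∈ A}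
  have hA' : MeasurableSet A' := by
    refine MeasurableSet.inter ?_ ?_
    · exact (measurable_snd.comp measurable_fst) (measurableSet_singleton w)
    · exact ((measurable_fst.comp measurable_fst).prodMk measurable_snd) hA
  have h3 := congrArg (fun m => m A') h
  simp only at h3
  rw [Measure.map_apply (hmXW.prodMk (pop.measurable_Y 0)) hA', Measure.compProd_apply hA',
    lintegral_map (Kernel.measurable_kernel_prodMk_left hA') hmXW] at h3
  refine h3.trans ?_
  rw [← lintegral_indicator hw]
  refine lintegral_congr fun ω => ?_
  by_cases hω : pop.W ω = w
  · simp only [Kernel.prodMkRight_apply]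
    rw [Set.indicator_of_mem (by exact hω)]
    congr 1
    ext y
    simp [A', hω]
  · rw [Set.indicator_of_notMem (by exact hω)]
    have : Prod.mk (pop.X ω, pop.W ω) ⁻¹' A' = ∅ := by
      ext y
      simp [A', hω]
    rw [this, measure_empty]

/-- A kernel in each arm that disintegrates the law of `(X, Y)`, the one in the control arm
describing `Y 0` among the treated as well. -/
lemma exists_arm_kernel [StandardBorelSpace Ω] (hCIA : pop.CIA) :
    ∃ κ : Fin 2 → Kernel (Cov k) ℝ, (∀ w, IsMarkovKernel (κ w)) ∧
      (∀ w, (pop.arm w).map (fun ω => (pop.X ω, pop.obs ω)) = pop.lawX w ⊗ₘ κ w) ∧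
      (pop.arm 1).map (fun ω => (pop.X ω, pop.Y 0 ω)) = pop.lawX 1 ⊗ₘ κ 0 := by
  obtain ⟨κ₀, h0, h⟩ := pop.exists_control_kernel hCIA
  refine ⟨![κ₀, condDistrib pop.obs pop.X (pop.arm 1)], ?_, ?_, h 1⟩
  · intro w
    fin_cases w
    · exact h0
    · exact inferInstanceAs (IsMarkovKernel (condDistrib _ _ _))
  · intro w
    fin_cases w
    · refine Eq.trans (Measure.map_congr ?_) (h 0)
      filter_upwards [pop.ae_arm_W 0] with ω hω
      simp [obs, hω]
    · exact (compProd_map_condDistrib pop.measurable_obs.aemeasurable).symm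

/-- The density of the control covariates is positive on the support of the treated ones. -/
lemma lawX_one_absolutelyContinuous (hX : pop.CovariateAssumption) :
    pop.lawX 1 ≪ pop.lawX 0 := by
  obtain ⟨-, -, -, -, ⟨f, hf, -, -, b, hb, hbf⟩, -⟩ := hX
  have hS : MeasurableSet (pop.supp 1) := Measure.isClosed_support.measurableSet
  have hvol : pop.lawX 1 ≪ volume := by
    rw [(hf 1).2.2]
    exact withDensity_absolutelyContinuous _ _
  refine Measure.AbsolutelyContinuous.mk fun A hA hA0 => ?_
  have h1 : pop.lawX 1 A ≤ pop.lawX 1 (A ∩ pop.supp 1) := by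
    refine measure_mono_ae ?_
    filter_upwards [pop.ae_lawX_mem_supp 1] with x hx hxA using ⟨hxA, hx⟩
  refine le_antisymm (h1.trans (le_of_eq (hvol ?_))) (zero_le)
  have h2 : ENNReal.ofReal b * volume (A ∩ pop.supp 1) ≤ pop.lawX 0 (A ∩ pop.supp 1) := by
    rw [(hf 0).2.2, withDensity_apply _ (hA.inter hS), ← setLIntegral_const]
    refine setLIntegral_mono_ae' (hA.inter hS) (.of_forall fun x hx => ?_)
    exact ENNReal.ofReal_le_ofReal (hbf x hx.2)
  have h3 : pop.lawX 0 (A ∩ pop.supp 1) = 0 := measure_mono_null Set.inter_subset_left hA0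
  rw [h3, nonpos_iff_eq_zero, mul_eq_zero] at h2
  exact h2.resolve_left (by simpa using hb)

end Population
end Matching

namespace Matching

/-- The features of a superpopulation on which the asymptotics depend. The outcome of a unit of arm
`w` with covariates `x` is written as `h w x u`, where `u` is uniform on the unit interval; `g` and
`s` are its conditional mean and variance. -/
structure OutcomeModel (k : ℕ) where
  ν : Fin 2 → Measure (Cov k)
  isProb : ∀ w, IsProbabilityMeasure (ν w)
  h : Fin 2 → Cov k → unitInterval → ℝ
  measurable_h : ∀ w, Measurable (Function.uncurry (h w))
  g : Fin 2 → Cov k → ℝ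
  s : Fin 2 → Cov k → ℝ
  L : ℝ≥0
  B : ℝ
  b : ℝ
  b_pos : 0 < b
  lipschitz_g : ∀ w, LipschitzWith L (g w)
  lipschitz_s : ∀ w, LipschitzWith L (s w)
  abs_g_le : ∀ w x, |g w x| ≤ B
  le_s : ∀ w x, b ≤ s w x
  s_le : ∀ w x, s w x ≤ B
  moments : ∀ w, ∀ᵐ x ∂ν w, Integrable (fun u => h w x u ^ 4) ∧ ∫ u, h w x u = g w x ∧
    ∫ u, (h w x u - g w x) ^ 2 = s w x ∧ ∫ u, h w x u ^ 4 ≤ B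

attribute [instance] OutcomeModel.isProb

namespace Population

variable {k : ℕ} {Ω : Type*} [MeasurableSpace Ω] (pop : Population k Ω)

/-- A function that is Lipschitz on the support of the controls, truncated to its range there,
extends to a bounded Lipschitz function. -/
lemma exists_lipschitz_extension {f : Cov k → ℝ} {S : Set (Cov k)} {L : ℝ≥0}
    (hf : LipschitzOnWith L f S) {a B : ℝ} (haB : a ≤ B) :
    ∃ f' : Cov k → ℝ, LipschitzWith L f' ∧ (∀ x, a ≤ f' x ∧ f' x ≤ B) ∧
      ∀ x ∈ S, a ≤ f x → f x ≤ B → f' x = f x := by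
  obtain ⟨F, hF, hFf⟩ := hf.extend_real
  refine ⟨fun x => max a (min B (F x)), (hF.const_min B).const_max a, fun x => ⟨le_max_left _ _,
    max_le haB (min_le_left _ _)⟩, fun x hx h1 h2 => ?_⟩
  simp only [← hFf hx, min_eq_right h2, max_eq_right h1]

lemma pow_four_add_le (a b : ℝ) : (a + b) ^ 4 ≤ 8 * (a ^ 4 + b ^ 4) := by
  nlinarith [sq_nonneg (a - b), sq_nonneg (a + b), sq_nonneg (a ^ 2 - b ^ 2),
    mul_nonneg (sq_nonneg (a - b)) (sq_nonneg (a + b)), mul_nonneg (sq_nonneg (a - b)) (sq_nonneg a),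
    mul_nonneg (sq_nonneg (a - b)) (sq_nonneg b)]

lemma pow_four_le_one_add_rpow {y γ : ℝ} (hγ : 0 < γ) : y ^ 4 ≤ 1 + |y| ^ (4 + γ) := by
  rw [show y ^ 4 = |y| ^ 4 from (Even.pow_abs (by decide) _).symm]
  rcases le_or_gt |y| 1 with h | h
  · have h1 : |y| ^ 4 ≤ 1 := pow_le_one₀ (abs_nonneg _) h
    have h2 : 0 ≤ |y| ^ (4 + γ) := by positivity
    linarith
  · have h1 : |y| ^ (4 : ℕ) = |y| ^ (4 : ℝ) := by
      exact_mod_cast (Real.rpow_natCast |y| 4).symm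
    have h2 : |y| ^ (4 : ℝ) ≤ |y| ^ (4 + γ) := Real.rpow_le_rpow_of_exponent_le h.le (by linarith)
    exact (h1.le.trans h2).trans (le_add_of_nonneg_left zero_le_one)

/-- Every population that satisfies the assumptions has an outcome model. Kernels on `ℝ` are images
of the uniform law, and the regression functions are replaced by bounded Lipschitz functions on the
whole space that agree with them on the supports. By conditional independence, `g 0` is the mean of
`Y(0)` among the treated as well, which gives the expression for the effect on the treated. -/
theorem exists_outcomeModel [StandardBorelSpace Ω] (hCIA : pop.CIA)
    (hX : pop.CovariateAssumption) (hY : pop.OutcomeAssumption) :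
    ∃ m : OutcomeModel k, m.ν = pop.lawX ∧
      (∀ w, pop.lawYX w = ((pop.lawX w).prod volume).map fun p => (m.h w p.1 p.2, p.1)) ∧
      ∫ x, (m.g 1 x - m.g 0 x) ∂pop.lawX 1 = pop.att := by
  have hac := pop.lawX_one_absolutelyContinuous hX
  obtain ⟨-, hsub, -, hcpt, -⟩ := hX
  obtain ⟨μ, σsq, hμ, hσ, hLμ, hLσ, ⟨γ, hγ, hm4⟩, ⟨b, hb, hbσ⟩⟩ := hY
  obtain ⟨κ, hκM, hκ, hκ1⟩ := pop.exists_arm_kernel hCIA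
  have hsub' : ∀ w, pop.supp w ⊆ pop.supp 0 := fun w => by
    fin_cases w
    · exact subset_rfl
    · exact hsub
  choose L₁ hL₁ using hLμ
  choose L₂ hL₂ using hLσ
  choose B₁ hB₁ using fun w => hcpt.exists_bound_of_continuousOn (hL₁ w).continuousOn
  choose B₂ hB₂ using fun w => hcpt.exists_bound_of_continuousOn (hL₂ w).continuousOn
  choose ε4 hε4 C hC using hm4
  set B : ℝ := b + ∑ w, (|B₁ w| + |B₂ w|) with hB
  have hBw : ∀ w, b + |B₁ w| + |B₂ w| ≤ B := fun w => by
    have := Finset.single_le_sum (f := fun w => |B₁ w| + |B₂ w|) (fun _ _ => by positivity)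
      (Finset.mem_univ w)
    simp only [hB]
    linarith
  have hB0 : 0 ≤ B := le_trans (by positivity) (hBw 0)
  choose g hgL hgB hge using fun w => exists_lipschitz_extension (hL₁ w) (neg_le_self hB0)
  choose s hsL hsB hse using fun w => exists_lipschitz_extension (hL₂ w)
    (show b ≤ B from by linarith [hBw w, abs_nonneg (B₁ w), abs_nonneg (B₂ w)])
  have hgμ : ∀ w, ∀ x ∈ pop.supp w, g w x = μ x w := fun w x hx => by
    have h1 := hB₁ w x (hsub' w hx)
    rw [Real.norm_eq_abs, abs_le] at h1
    refine hge w x (hsub' w hx) ?_ ?_ <;>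
      linarith [hBw w, le_abs_self (B₁ w), abs_nonneg (B₂ w), h1.1, h1.2]
  have hsσ : ∀ w, ∀ x ∈ pop.supp w, s w x = σsq x w := fun w x hx => by
    have h1 := hB₂ w x (hsub' w hx)
    rw [Real.norm_eq_abs, abs_le] at h1
    refine hse w x (hsub' w hx) (hbσ w x hx) ?_
    linarith [hBw w, le_abs_self (B₂ w), abs_nonneg (B₁ w), h1.2]
  choose h hmh hmap using fun w => (κ w).exists_measurable_map_eq_unitInterval
  -- the observed arm and the covariates determine the residual, so that it is a function of `(X, Y)`
  have hresid : ∀ w, ∀ᵐ ω ∂pop.arm w,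
      pop.obs ω - μ (pop.X ω) (pop.W ω) = pop.obs ω - g w (pop.X ω) := fun w => by
    filter_upwards [pop.ae_arm_W w, pop.ae_arm_mem_supp w] with ω h1 h2
    rw [h1, hgμ w _ h2]
  have hgm : ∀ w, Measurable (g w) := fun w => (hgL w).continuous.measurable
  have hsm : ∀ w, Measurable (s w) := fun w => (hsL w).continuous.measurable
  set B4 : ℝ := 8 * (1 + ∑ w, |C w| + B ^ 4) with hB4
  -- the conditional moments, read off from the disintegrating kernels
  have hmom : ∀ w, ∀ᵐ x ∂pop.lawX w, Integrable (fun y => y ^ 4) (κ w x) ∧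
      ∫ y, y ∂κ w x = g w x ∧ ∫ y, (y - g w x) ^ 2 ∂κ w x = s w x ∧
      ∫ y, y ^ 4 ∂κ w x ≤ B4 := by
    intro w
    have a1 := IsCondMean.ae_integral_kernel_eq pop (hκ w) (f := fun p => p.2) measurable_snd
      (.of_forall fun _ => rfl) (hμ w) (hgm w) (hgμ w)
    have a2 := IsCondMean.ae_integral_kernel_eq pop (hκ w) (f := fun p => (p.2 - g w p.1) ^ 2)
      (by have := hgm w; fun_prop)
      ((hresid w).mono fun ω hω => by simp only [hω]) (hσ w) (hsm w) (hsσ w)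
    have a3 := IsCondMean.ae_integral_kernel_le pop (hκ w)
      (f := fun p => |p.2 - g w p.1| ^ (4 + γ)) (by have := hgm w; fun_prop)
      ((hresid w).mono fun ω hω => by simp only [hω]) (hε4 w) (hC w)
    filter_upwards [a1, a2, a3] with x h1 h2 h3
    have := hκM w
    have hg4 : g w x ^ 4 ≤ B ^ 4 := by
      rw [show g w x ^ 4 = |g w x| ^ 4 from (Even.pow_abs (by decide) _).symm]
      gcongr
      exact abs_le.2 (hgB w x)
    have hCw : C w ≤ ∑ w, |C w| := (le_abs_self _).trans
      (Finset.single_le_sum (f := fun w => |C w|) (fun _ _ => abs_nonneg _) (Finset.mem_univ w))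
    have hdom : ∀ y, y ^ 4 ≤ 8 * (1 + |y - g w x| ^ (4 + γ) + B ^ 4) := fun y => by
      have h5 := pow_four_add_le (y - g w x) (g w x)
      rw [sub_add_cancel] at h5
      have h6 := pow_four_le_one_add_rpow (y := y - g w x) hγ
      linarith
    have hidom : Integrable (fun y => 8 * (1 + |y - g w x| ^ (4 + γ) + B ^ 4)) (κ w x) :=
      ((((integrable_const 1).add h3.1).add (integrable_const (B ^ 4))).const_mul 8)
    have hi4 : Integrable (fun y => y ^ 4) (κ w x) :=
      hidom.mono' (by fun_prop) (.of_forall fun y => by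
        rw [Real.norm_eq_abs, abs_of_nonneg (by positivity)]
        exact hdom y)
    refine ⟨hi4, h1.2, h2.2, (integral_mono hi4 hidom hdom).trans ?_⟩
    have hsplit : ∫ y, 8 * (1 + |y - g w x| ^ (4 + γ) + B ^ 4) ∂κ w x
        = 8 * (1 + ∫ y, |y - g w x| ^ (4 + γ) ∂κ w x + B ^ 4) := by
      have j1 : Integrable (fun y => 1 + |y - g w x| ^ (4 + γ)) (κ w x) :=
        (integrable_const 1).add h3.1
      rw [integral_const_mul, integral_add j1 (integrable_const _),
        integral_add (integrable_const _) h3.1]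
      simp
    rw [hsplit, hB4]
    linarith [h3.2]
  have hB4B : 0 ≤ B4 := by positivity
  refine ⟨⟨pop.lawX, inferInstance, h, hmh, g, s, (∑ w, (L₁ w + L₂ w)), B + B4, b, hb,
    fun w => (hgL w).weaken ?_, fun w => (hsL w).weaken ?_, fun w x => ?_, fun w x => (hsB w x).1,
    fun w x => ?_, fun w => ?_⟩, rfl, fun w => ?_, ?_⟩
  · exact (le_add_of_nonneg_right (zero_le)).trans (Finset.single_le_sum
      (f := fun w => L₁ w + L₂ w) (fun _ _ => zero_le) (Finset.mem_univ w))
  · exact (le_add_of_nonneg_left (zero_le)).trans (Finset.single_le_sum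
      (f := fun w => L₁ w + L₂ w) (fun _ _ => zero_le) (Finset.mem_univ w))
  · have := abs_le.2 (hgB w x)
    linarith
  · linarith [(hsB w x).2]
  · filter_upwards [hmom w] with x hx
    have hmx : AEMeasurable (h w x) volume := (by
      have := hmh w
      exact (this.comp (measurable_const.prodMk measurable_id)).aemeasurable)
    rw [← hmap w x] at hx
    rw [integrable_map_measure (by fun_prop) hmx, integral_map hmx (by fun_prop),
      integral_map hmx (by fun_prop), integral_map hmx (by fun_prop)] at hx
    exact ⟨hx.1, hx.2.1, hx.2.2.1, by linarith [hx.2.2.2]⟩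
  · have e1 : pop.lawYX w = ((pop.lawX w) ⊗ₘ (κ w)).map Prod.swap := by
      rw [← hκ w, Measure.map_map measurable_swap (pop.measurable_X.prodMk pop.measurable_obs)]
      rfl
    have hmp : Measurable fun p : Cov k × unitInterval => (h w p.1 p.2, p.1) :=
      (hmh w).prodMk measurable_fst
    rw [e1]
    have := hκM w
    ext A hA
    rw [Measure.map_apply measurable_swap hA, Measure.map_apply hmp hA,
      Measure.compProd_apply (measurable_swap hA), Measure.prod_apply (hmp hA)]
    refine lintegral_congr fun x => ?_
    rw [← hmap w x, Measure.map_apply]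
    · rfl
    · exact (hmh w).comp (measurable_const.prodMk measurable_id)
    · exact measurable_prodMk_left (measurable_swap hA)
  · have hi1 : Integrable (pop.Y 1) (pop.arm 1) := (hμ 1).1.congr (by
      filter_upwards [pop.ae_arm_W 1] with ω hω
      simp [obs, hω])
    have e1 : ∫ ω, pop.Y 1 ω ∂pop.arm 1 = ∫ x, g 1 x ∂pop.lawX 1 := by
      have e : ∫ ω, pop.Y 1 ω ∂pop.arm 1 = ∫ ω, pop.obs ω ∂pop.arm 1 := by
        refine integral_congr_ae ?_
        filter_upwards [pop.ae_arm_W 1] with ω hω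
        simp [obs, hω]
      rw [e, ← integral_condExp pop.measurable_X.comap_le, lawX,
        integral_map pop.measurable_X.aemeasurable (hgm 1).aestronglyMeasurable]
      refine integral_congr_ae ?_
      filter_upwards [(hμ 1).2, pop.ae_arm_mem_supp 1] with ω h1 h2
      rw [h1, hgμ 1 _ h2]
    have := hκM 0
    have hmXY := pop.measurable_X.prodMk (pop.measurable_Y 0)
    have hi0' : Integrable (fun p : Cov k × ℝ => p.2) (pop.lawX 1 ⊗ₘ κ 0) := by
      rw [Measure.integrable_compProd_iff (by fun_prop)]
      -- the fourth moments under `κ 0` hold almost everywhere for the treated law too, since it is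
      -- absolutely continuous with respect to the control law
      have hy : ∀ y : ℝ, ‖y‖ ≤ 1 + y ^ 4 := fun y => by
        rw [Real.norm_eq_abs, show y ^ 4 = |y| ^ 4 from (Even.pow_abs (by decide) _).symm]
        nlinarith [sq_nonneg (|y| ^ 2 - 1), sq_nonneg (|y| - 1), abs_nonneg y]
      have hint : ∀ᵐ x ∂pop.lawX 1, Integrable (fun y : ℝ => y) (κ 0 x) ∧
          ∫ y, ‖y‖ ∂κ 0 x ≤ 1 + B4 := by
        filter_upwards [hac.ae_le (hmom 0)] with x hx
        have hd : Integrable (fun y => 1 + y ^ 4) (κ 0 x) := (integrable_const 1).add hx.1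
        have hi : Integrable (fun y : ℝ => y) (κ 0 x) :=
          hd.mono' (by fun_prop) (.of_forall hy)
        refine ⟨hi, (integral_mono hi.norm hd hy).trans ?_⟩
        rw [integral_add (integrable_const 1) hx.1]
        simpa using hx.2.2.2
      refine ⟨hint.mono fun x hx => hx.1, ?_⟩
      refine Integrable.of_bound (C := 1 + B4) ?_ (hint.mono fun x hx => ?_)
      · exact (StronglyMeasurable.integral_kernel_prod_right' (κ := κ 0)
          (f := fun p : Cov k × ℝ => ‖p.2‖) (by fun_prop)).aestronglyMeasurable
      · rw [Real.norm_eq_abs, abs_of_nonneg (integral_nonneg fun _ => norm_nonneg _)]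
        exact hx.2
    have hi0 : Integrable (pop.Y 0) (pop.arm 1) := by
      rw [← hκ1, integrable_map_measure (by fun_prop) hmXY.aemeasurable] at hi0'
      exact hi0'
    have e0 : ∫ ω, pop.Y 0 ω ∂pop.arm 1 = ∫ x, g 0 x ∂pop.lawX 1 := by
      have e2 : ∫ ω, pop.Y 0 ω ∂pop.arm 1 = ∫ p, p.2 ∂(pop.lawX 1 ⊗ₘ κ 0) := by
        rw [← hκ1, integral_map hmXY.aemeasurable (by fun_prop)]
      rw [e2, Measure.integral_compProd hi0']
      refine integral_congr_ae ?_
      filter_upwards [hac.ae_le (hmom 0)] with x hx using hx.2.1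
    have hgi : ∀ w, Integrable (g w) (pop.lawX 1) := fun w =>
      Integrable.of_bound (C := B) (hgm w).aestronglyMeasurable
        (.of_forall fun x => abs_le.2 (hgB w x))
    rw [att, integral_sub hi1 hi0, e1, e0, integral_sub (hgi 1) (hgi 0)]

end Population
end Matching

namespace Matching

/-! ### Matched arrays with independent entries -/

/-- The weight of a place in the contrast of a matched group. -/
noncomputable def weight {M : ℕ} (j : Fin (M + 1)) : ℝ := if j = 0 then 1 else -(1 / (M : ℝ))

lemma headContrast_eq_sum {M : ℕ} (v : Fin (M + 1) → ℝ) :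
    headContrast v = ∑ j, weight j * v j := by
  rw [Fin.sum_univ_succ]
  simp [headContrast, weight, Fin.succ_ne_zero, Finset.mul_sum, sub_eq_add_neg]

lemma abs_weight_le {M : ℕ} (j : Fin (M + 1)) : |weight j| ≤ 1 := by
  unfold weight
  split_ifs
  · simp
  · rw [abs_neg, abs_of_nonneg (by positivity), one_div]
    exact Nat.cast_inv_le_one M

lemma weight_sq_le {M : ℕ} (j : Fin (M + 1)) : weight j ^ 2 ≤ 1 := by
  rw [← sq_abs]
  exact pow_le_one₀ (abs_nonneg _) (abs_weight_le j)

/-- Independent random variables with given means and variances and fourth moments at most `B`. -/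
structure IndepArray {ι Ω : Type*} [MeasurableSpace Ω] (P : Measure Ω) (Y : ι → Ω → ℝ)
    (m v : ι → ℝ) (B : ℝ) : Prop where
  measurable : ∀ p, Measurable (Y p)
  indep : iIndepFun Y P
  integrable : ∀ p, Integrable (fun ω => Y p ω ^ 4) P
  mean : ∀ p, ∫ ω, Y p ω ∂P = m p
  var : ∀ p, ∫ ω, (Y p ω - m p) ^ 2 ∂P = v p
  fourth : ∀ p, ∫ ω, Y p ω ^ 4 ∂P ≤ B

/-- The array of matched outcomes, the outcomes of the treated units being shifted by `c`. -/
noncomputable def shiftedArray {N M : ℕ} (c : ℝ) (y : Fin N × Fin (M + 1) → ℝ) (i : Fin N)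
    (j : Fin (M + 1)) : ℝ := y (i, j) - if j = 0 then c else 0

lemma contrast_shiftedArray {N M : ℕ} (c : ℝ) (y : Fin N × Fin (M + 1) → ℝ) (i : Fin N) :
    contrast (shiftedArray c y) i = ∑ j, weight j * y (i, j) - c := by
  rw [contrast_eq, headContrast_eq_sum]
  simp only [shiftedArray, mul_sub, Finset.sum_sub_distrib]
  congr 1
  rw [Fin.sum_univ_succ]
  simp [weight, Fin.succ_ne_zero]

section
variable {ι Ω : Type*} [MeasurableSpace Ω] {P : Measure Ω} [IsProbabilityMeasure P]
  {Y : ι → Ω → ℝ} {m v : ι → ℝ} {B : ℝ}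

open Population (pow_four_add_le)

omit [IsProbabilityMeasure P] in
lemma IndepArray.memLp (h : IndepArray P Y m v B) (p : ι) : MemLp (Y p) 4 P :=
  memLp_of_integrable_pow_four (h.measurable p).aestronglyMeasurable (h.integrable p)

lemma IndepArray.mean_pow_four_le (h : IndepArray P Y m v B) (p : ι) : m p ^ 4 ≤ B := by
  have h1 := sq_integral_le ((h.memLp p).mono_exponent (by norm_num : (2 : ℝ≥0∞) ≤ 4))
  have h2 := sq_integral_sq_le (h.measurable p).aestronglyMeasurable (h.integrable p)
  rw [h.mean] at h1
  calc m p ^ 4 = (m p ^ 2) ^ 2 := by ring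
    _ ≤ (∫ ω, Y p ω ^ 2 ∂P) ^ 2 := by gcongr
    _ ≤ B := h2.trans (h.fourth p)

lemma integrable_sub_pow_four {X : Ω → ℝ} (hX : MemLp X 4 P) (c : ℝ) :
    Integrable (fun ω => (X ω - c) ^ 4) P := by
  have h2 : MemLp (fun ω => X ω - c) 4 P := hX.sub (memLp_const c)
  have := h2.integrable_norm_pow (by norm_num)
  refine this.congr (.of_forall fun ω => ?_)
  simp only [Real.norm_eq_abs]
  exact Even.pow_abs (by decide) _

lemma integral_sub_pow_four_le {X : Ω → ℝ} (hX : AEStronglyMeasurable X P)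
    (h4 : Integrable (fun ω => X ω ^ 4) P) (c : ℝ) :
    ∫ ω, (X ω - c) ^ 4 ∂P ≤ 8 * (∫ ω, X ω ^ 4 ∂P + c ^ 4) := by
  have e : ∫ ω, 8 * (X ω ^ 4 + c ^ 4) ∂P = 8 * (∫ ω, X ω ^ 4 ∂P + c ^ 4) := by
    rw [integral_const_mul, integral_add h4 (integrable_const _)]
    simp
  rw [← e]
  refine integral_mono (integrable_sub_pow_four (memLp_of_integrable_pow_four hX h4) c)
    ((h4.add (integrable_const _)).const_mul 8) fun ω => ?_
  have := pow_four_add_le (X ω) (-c)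
  rwa [Even.neg_pow (by decide), ← sub_eq_add_neg] at this

lemma IndepArray.var_le (h : IndepArray P Y m v B) (p : ι) : v p ≤ 1 + 16 * B := by
  have h4 := integrable_sub_pow_four (h.memLp p) (m p)
  have h1 := integral_sub_pow_four_le (h.measurable p).aestronglyMeasurable (h.integrable p) (m p)
  rw [← h.var]
  have hm : Measurable fun ω => Y p ω - m p := (h.measurable p).sub_const _
  have h2 := sq_integral_sq_le hm.aestronglyMeasurable h4
  nlinarith [h.fourth p, h.mean_pow_four_le p, sq_nonneg (∫ ω, (Y p ω - m p) ^ 2 ∂P - 1)]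

variable {N M : ℕ} {Y : Fin N × Fin (M + 1) → Ω → ℝ} {m v : Fin N × Fin (M + 1) → ℝ}

/-- The characteristic function of the normalized sum of the contrasts. -/
lemma IndepArray.norm_integral_exp_sub_le (h : IndepArray P Y m v B) (hN : 0 < N) (hB : 0 < B)
    (c : ℝ) {t : ℝ} (ht : t ≠ 0) :
    ‖∫ ω, Complex.exp ((t / √N * ∑ i, contrast (shiftedArray c fun p => Y p ω) i : ℝ)
          * Complex.I) ∂P
        - Complex.exp ((t / √N * ∑ i, (∑ j, weight j * m (i, j) - c) : ℝ) * Complex.I)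
          * Complex.exp (-(t ^ 2 / N * ∑ i, ∑ j, weight j ^ 2 * v (i, j) : ℝ) / 2)‖
      ≤ 2 * √(16 * t ^ 4 * (M + 1) * B / N) * (t ^ 2 * (M + 1) * (1 + 16 * B) + 1)
        + 16 * t ^ 4 * (M + 1) * B / N := by
  have hN' : (0 : ℝ) < N := by exact_mod_cast hN
  set τ : ℝ := t / √N with hτ
  have hτ2 : τ ^ 2 = t ^ 2 / N := by rw [hτ, div_pow, Real.sq_sqrt hN'.le]
  have hτ4 : τ ^ 4 = t ^ 4 / N ^ 2 := by
    rw [show τ ^ 4 = (τ ^ 2) ^ 2 by ring, hτ2]; ring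
  -- the centred and normalized summands of the sum of the contrasts
  set ξ : Fin N × Fin (M + 1) → Ω → ℝ := fun p ω => τ * weight p.2 * (Y p ω - m p) with hξ
  have hξm : ∀ p, Measurable (ξ p) := fun p => ((h.measurable p).sub_const _).const_mul _
  have hξi : iIndepFun ξ P :=
    h.indep.comp (fun p y => τ * weight p.2 * (y - m p)) (fun p => by fun_prop)
  have hi1 : ∀ p, Integrable (Y p) P := fun p => (h.memLp p).integrable (by norm_num)
  have hξ0 : ∀ p, ∫ ω, ξ p ω ∂P = 0 := fun p => by
    simp only [hξ]
    rw [integral_const_mul, integral_sub (hi1 p) (integrable_const _), h.mean]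
    simp
  have hξ4 : ∀ p, Integrable (fun ω => ξ p ω ^ 4) P := fun p => by
    simp only [hξ, mul_pow]
    exact (integrable_sub_pow_four (h.memLp p) (m p)).const_mul _
  have hξ2 : ∀ p, ∫ ω, ξ p ω ^ 2 ∂P = t ^ 2 / N * (weight p.2 ^ 2 * v p) := fun p => by
    simp only [hξ, mul_pow]
    rw [integral_const_mul, h.var, hτ2, mul_assoc]
  have hcard : (Fintype.card (Fin N × Fin (M + 1)) : ℝ) = N * (M + 1) := by simp
  have hl : ∑ p, ∫ ω, ξ p ω ^ 4 ∂P ≤ 16 * t ^ 4 * (M + 1) * B / N := by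
    have : ∀ p, ∫ ω, ξ p ω ^ 4 ∂P ≤ t ^ 4 / N ^ 2 * (16 * B) := fun p => by
      simp only [hξ, mul_pow]
      rw [integral_const_mul, hτ4, mul_assoc]
      refine mul_le_mul_of_nonneg_left ?_ (by positivity)
      have h1 : weight p.2 ^ 4 ≤ 1 := by
        rw [show weight p.2 ^ 4 = |weight p.2| ^ 4 from (Even.pow_abs (by decide) _).symm]
        exact pow_le_one₀ (abs_nonneg _) (abs_weight_le _)
      have h2 := integral_sub_pow_four_le (h.measurable p).aestronglyMeasurable
        (h.integrable p) (m p)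
      have h3 : 0 ≤ ∫ ω, (Y p ω - m p) ^ 4 ∂P := integral_nonneg fun _ => by positivity
      calc _ ≤ 1 * ∫ ω, (Y p ω - m p) ^ 4 ∂P := by gcongr
        _ ≤ 16 * B := by linarith [h.fourth p, h.mean_pow_four_le p]
    refine (Finset.sum_le_sum fun p _ => this p).trans (le_of_eq ?_)
    rw [Finset.sum_const, Finset.card_univ, nsmul_eq_mul, hcard]
    field_simp
  have hb := norm_integral_exp_sum_sub_le hξm hξi hξ0 hξ4 (l := 16 * t ^ 4 * (M + 1) * B / N)
    (by positivity) hl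
  simp only [hξ2] at hb
  have hV : ∑ p : Fin N × Fin (M + 1), t ^ 2 / N * (weight p.2 ^ 2 * v p)
      = t ^ 2 / N * ∑ i, ∑ j, weight j ^ 2 * v (i, j) := by
    rw [← Finset.mul_sum, Fintype.sum_prod_type]
  have hVle : t ^ 2 / N * ∑ i, ∑ j, weight j ^ 2 * v (i, j)
      ≤ t ^ 2 * (M + 1) * (1 + 16 * B) := by
    rw [← hV]
    calc _ ≤ ∑ _p : Fin N × Fin (M + 1), t ^ 2 / N * (1 * (1 + 16 * B)) := by
          refine Finset.sum_le_sum fun p _ => ?_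
          have hv0 : 0 ≤ v p := by
            rw [← h.var]; exact integral_nonneg fun _ => sq_nonneg _
          have := h.var_le p
          have := weight_sq_le p.2
          gcongr
      _ = _ := by
          rw [Finset.sum_const, Finset.card_univ, nsmul_eq_mul, hcard]
          field_simp
  rw [hV] at hb
  have hsum : ∀ ω, τ * ∑ i, contrast (shiftedArray c fun p => Y p ω) i
      = τ * ∑ i, (∑ j, weight j * m (i, j) - c) + ∑ p, ξ p ω := fun ω => by
    simp only [hξ, Fintype.sum_prod_type, contrast_shiftedArray]
    rw [Finset.mul_sum, Finset.mul_sum, ← Finset.sum_add_distrib]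
    refine Finset.sum_congr rfl fun i _ => ?_
    simp only [mul_assoc, ← Finset.mul_sum]
    rw [← mul_add]
    congr 1
    simp only [mul_sub, Finset.sum_sub_distrib]
    ring
  have hexp : ∫ ω, Complex.exp ((τ * ∑ i, contrast (shiftedArray c fun p => Y p ω) i : ℝ)
        * Complex.I) ∂P
      = Complex.exp ((τ * ∑ i, (∑ j, weight j * m (i, j) - c) : ℝ) * Complex.I)
        * ∫ ω, Complex.exp ((∑ p, ξ p ω : ℝ) * Complex.I) ∂P := by
    rw [← integral_const_mul]
    refine integral_congr_ae (.of_forall fun ω => ?_)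
    simp only [hsum]
    rw [← Complex.exp_add, ← add_mul, ← Complex.ofReal_add]
  rw [hexp, ← mul_sub, norm_mul, Complex.norm_exp_ofReal_mul_I, one_mul]
  refine hb.trans ?_
  have : 2 * √(16 * t ^ 4 * (M + 1) * B / N) *
      (t ^ 2 / N * ∑ i, ∑ j, weight j ^ 2 * v (i, j))
      ≤ 2 * √(16 * t ^ 4 * (M + 1) * B / N) * (t ^ 2 * (M + 1) * (1 + 16 * B)) := by gcongr
  linarith

lemma IndepArray.integrable_shiftedArray_pow_four (h : IndepArray P Y m v B) (c : ℝ) (i : Fin N)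
    (j : Fin (M + 1)) : Integrable (fun ω => shiftedArray c (fun p => Y p ω) i j ^ 4) P :=
  integrable_sub_pow_four (h.memLp (i, j)) _

lemma IndepArray.integral_shiftedArray_pow_four_le (h : IndepArray P Y m v B) (c : ℝ) (i : Fin N)
    (j : Fin (M + 1)) :
    ∫ ω, shiftedArray c (fun p => Y p ω) i j ^ 4 ∂P ≤ 8 * (B + c ^ 4) := by
  refine (integral_sub_pow_four_le (h.measurable (i, j)).aestronglyMeasurable
    (h.integrable (i, j)) _).trans ?_
  have hc : (if j = 0 then c else 0) ^ 4 ≤ c ^ 4 := by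
    split_ifs
    · exact le_rfl
    · rw [zero_pow (by norm_num)]
      positivity
  linarith [h.fourth (i, j)]

lemma IndepArray.integral_sum_pow_four_le (h : IndepArray P Y m v B) (c : ℝ) (i : Fin N) :
    ∫ ω, ∑ j, shiftedArray c (fun p => Y p ω) i j ^ 4 ∂P ≤ (M + 1) * (8 * (B + c ^ 4)) := by
  rw [integral_finsetSum _ fun j _ => h.integrable_shiftedArray_pow_four c i j]
  refine (Finset.sum_le_sum fun j _ => h.integral_shiftedArray_pow_four_le c i j).trans ?_
  simp

omit [IsProbabilityMeasure P] in
lemma IndepArray.measurable_contrast (h : IndepArray P Y m v B) (c : ℝ) (i : Fin N) :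
    Measurable fun ω => contrast (shiftedArray c fun p => Y p ω) i := by
  simp only [contrast_shiftedArray]
  exact (Finset.measurable_fun_sum _ fun j _ => (h.measurable (i, j)).const_mul _).sub_const _

/-- The mean square of the contrasts concentrates around its expectation. -/
lemma IndepArray.measure_sum_sq_contrast_le (h : IndepArray P Y m v B) (hM : 1 ≤ M) (c : ℝ)
    {δ : ℝ} (hδ : 0 < δ) :
    P {ω | δ ≤ |∑ i, contrast (shiftedArray c fun p => Y p ω) i ^ 2
        - ∑ i, ((∑ j, weight j * m (i, j) - c) ^ 2 + ∑ j, weight j ^ 2 * v (i, j))|}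
      ≤ ENNReal.ofReal (N * (16 * ((M + 1) * (8 * (B + c ^ 4)))) / δ ^ 2) := by
  set D : Fin N → Ω → ℝ := fun i ω => contrast (shiftedArray c fun p => Y p ω) i with hD
  have hDm : ∀ i, Measurable (D i) := fun i => h.measurable_contrast c i
  have hL2 : ∀ p, MemLp (Y p) 2 P := fun p => (h.memLp p).mono_exponent (by norm_num)
  have hdom : ∀ i ω, D i ω ^ 4 ≤ 16 * ∑ j, shiftedArray c (fun p => Y p ω) i j ^ 4 := fun i ω =>
    headContrast_pow_four_le hM _
  have hsum4 : ∀ i, Integrable (fun ω => 16 * ∑ j, shiftedArray c (fun p => Y p ω) i j ^ 4) P :=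
    fun i => (integrable_finsetSum _ fun j _ =>
      h.integrable_shiftedArray_pow_four c i j).const_mul _
  have hD4 : ∀ i, Integrable (fun ω => D i ω ^ 4) P := fun i =>
    (hsum4 i).mono' ((hDm i).pow_const 4).aestronglyMeasurable (.of_forall fun ω => by
      rw [Real.norm_eq_abs, abs_of_nonneg (by positivity)]
      exact hdom i ω)
  have hD4le : ∀ i, ∫ ω, D i ω ^ 4 ∂P ≤ 16 * ((M + 1) * (8 * (B + c ^ 4))) := fun i => by
    refine (integral_mono (hD4 i) (hsum4 i) (hdom i)).trans ?_
    rw [integral_const_mul]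
    gcongr
    exact h.integral_sum_pow_four_le c i
  have hZ : ∀ p : Fin N × Fin (M + 1), MemLp (fun ω => weight p.2 * Y p ω) 2 P := fun p =>
    (hL2 p).const_mul _
  have hDL2 : ∀ i, MemLp (D i) 2 P := fun i =>
    (memLp_of_integrable_pow_four (hDm i).aestronglyMeasurable (hD4 i)).mono_exponent
      (by norm_num)
  have hmean : ∀ i, ∫ ω, D i ω ∂P = ∑ j, weight j * m (i, j) - c := fun i => by
    simp only [hD, contrast_shiftedArray]
    rw [integral_sub (integrable_finsetSum _ fun j _ => (hZ (i, j)).integrable (by norm_num))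
      (integrable_const _), integral_finsetSum _ fun j _ => (hZ (i, j)).integrable (by norm_num)]
    simp only [integral_const_mul, h.mean]
    simp
  have hvar : ∀ i, Var[D i; P] = ∑ j, weight j ^ 2 * v (i, j) := fun i => by
    have e : D i = fun ω => (∑ j, fun ω => weight j * Y (i, j) ω) ω - c := by
      ext ω
      simp only [hD, contrast_shiftedArray, Finset.sum_apply]
    rw [e, variance_sub_const
      (memLp_finsetSum' _ fun j _ => hZ (i, j)).aestronglyMeasurable,
      IndepFun.variance_sum (fun j _ => hZ (i, j))]
    · refine Finset.sum_congr rfl fun j _ => ?_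
      rw [variance_const_mul, variance_eq_integral (h.measurable _).aemeasurable, h.mean, h.var]
    · intro j _ j' _ hjj
      exact (h.indep.indepFun (i := (i, j)) (j := (i, j')) (by simpa using hjj)).comp
        (φ := (weight j * ·)) (ψ := (weight j' * ·)) (by fun_prop) (by fun_prop)
  have hsq : ∀ i, ∫ ω, D i ω ^ 2 ∂P
      = (∑ j, weight j * m (i, j) - c) ^ 2 + ∑ j, weight j ^ 2 * v (i, j) := fun i => by
    have := variance_eq_sub (hDL2 i)
    rw [hvar, hmean] at this
    simp only [Pi.pow_apply] at this
    linarith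
  have hind : Pairwise fun i i' => IndepFun (fun ω => D i ω ^ 2) (fun ω => D i' ω ^ 2) P := by
    intro i i' hii
    have hdis : Disjoint ((Finset.univ : Finset (Fin (M + 1))).map
        ⟨fun j => (i, j), fun _ _ h => (Prod.ext_iff.1 h).2⟩)
        ((Finset.univ : Finset (Fin (M + 1))).map
        ⟨fun j => (i', j), fun _ _ h => (Prod.ext_iff.1 h).2⟩) := by
      rw [Finset.disjoint_left]
      intro p hp hp'
      simp only [Finset.mem_map, Finset.mem_univ, true_and] at hp hp'
      obtain ⟨j, rfl⟩ := hp
      obtain ⟨j', hj'⟩ := hp'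
      exact hii (Prod.ext_iff.1 hj').1.symm
    have hi := h.indep.indepFun_finset _ _ hdis h.measurable
    have hφ : ∀ i : Fin N, Measurable fun y : ((Finset.univ : Finset (Fin (M + 1))).map
        ⟨fun j => (i, j), fun _ _ h => (Prod.ext_iff.1 h).2⟩) → ℝ =>
        (∑ j, weight j * y ⟨(i, j), Finset.mem_map.2 ⟨j, Finset.mem_univ _, rfl⟩⟩ - c) ^ 2 := fun i => by fun_prop
    have hc := hi.comp (hφ i) (hφ i')
    simp only [hD, contrast_shiftedArray]
    exact hc
  have hfin := measure_abs_sum_sub_ge_le (X := fun i ω => D i ω ^ 2)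
    (B := N * (16 * ((M + 1) * (8 * (B + c ^ 4)))))
    (fun i => memLp_sq_of_pow_four (hDm i).aestronglyMeasurable (hD4 i)) hind hδ (by
      simp only [← pow_mul]
      refine (Finset.sum_le_sum fun i _ => hD4le i).trans ?_
      simp)
  simpa only [hsq] using hfin

lemma IndepArray.measure_sum_pow_four_le (h : IndepArray P Y m v B) (c : ℝ) {a : ℝ} (ha : 0 < a) :
    P {ω | a ≤ ∑ i, ∑ j, shiftedArray c (fun p => Y p ω) i j ^ 4}
      ≤ ENNReal.ofReal (N * ((M + 1) * (8 * (B + c ^ 4))) / a) := by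
  have hi : ∀ i, Integrable (fun ω => ∑ j, shiftedArray c (fun p => Y p ω) i j ^ 4) P := fun i =>
    integrable_finsetSum _ fun j _ => h.integrable_shiftedArray_pow_four c i j
  have h1 := mul_meas_ge_le_integral_of_nonneg (μ := P)
    (f := fun ω => ∑ i, ∑ j, shiftedArray c (fun p => Y p ω) i j ^ 4)
    (.of_forall fun ω => by simp only [Pi.zero_apply]; positivity)
    (integrable_finsetSum _ fun i _ => hi i) a
  rw [integral_finsetSum _ fun i _ => hi i] at h1
  have h2 : ∑ i : Fin N, ∫ ω, ∑ j, shiftedArray c (fun p => Y p ω) i j ^ 4 ∂P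
      ≤ N * ((M + 1) * (8 * (B + c ^ 4))) :=
    (Finset.sum_le_sum fun i _ => h.integral_sum_pow_four_le c i).trans (by simp)
  rw [← ofReal_measureReal]
  refine ENNReal.ofReal_le_ofReal ?_
  rw [le_div_iff₀ ha]
  linarith

end
end Matching

namespace Matching

/-! ### The scale of the matching discrepancies -/

/-- A scale `ρ` at which balls around treated units contain many controls but, with high
probability, no second treated unit, and which is negligible against `N₁ ^ (-1/2)`. -/
lemma exists_matching_scale {k : ℕ} (hk : 1 ≤ k) {N₁ N₀ : ℕ → ℕ} (hN₁ : Tendsto N₁ atTop atTop)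
    (hN₀ : Tendsto N₀ atTop atTop) (h : SamplingRates k N₁ N₀) :
    ∃ ρ : ℕ → ℝ, (∀ᶠ n in atTop, 0 < ρ n) ∧ Tendsto ρ atTop (𝓝 0) ∧
      Tendsto (fun n => √(N₁ n) * ρ n) atTop (𝓝 0) ∧
      Tendsto (fun n => (N₁ n : ℝ) ^ 2 * ρ n ^ k) atTop (𝓝 0) ∧
      ∀ κ : ℝ, 0 < κ →
        Tendsto (fun n => (N₁ n : ℝ) * Real.exp (-(κ * (N₀ n * ρ n ^ k)))) atTop (𝓝 0) := by
  obtain ⟨r, θ, hr, hθ, hlim⟩ := h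
  -- `ρ = N₁ ^ (-β / k)` for an exponent `β` strictly between `max (k / 2) 2` and `r`
  obtain ⟨β, hβ, hβr⟩ := exists_between hr
  have hk0 : (0 : ℝ) < k := by exact_mod_cast hk
  have hβ2 : 2 < β := (le_max_right _ _).trans_lt hβ
  have hβk : (k : ℝ) / 2 < β := (le_max_left _ _).trans_lt hβ
  have hN : Tendsto (fun n => (N₁ n : ℝ)) atTop atTop := tendsto_natCast_atTop_atTop.comp hN₁
  have hpos : ∀ᶠ n in atTop, (0 : ℝ) < N₁ n := hN.eventually_gt_atTop 0
  have hpow : ∀ n, 0 < (N₁ n : ℝ) → ((N₁ n : ℝ) ^ (-(β / k))) ^ k = (N₁ n : ℝ) ^ (-β) := by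
    intro n hn
    rw [← Real.rpow_mul_natCast hn.le]
    congr 1
    field_simp
  have hneg : ∀ s : ℝ, 0 < s → Tendsto (fun n => (N₁ n : ℝ) ^ (-s)) atTop (𝓝 0) := fun s hs =>
    (tendsto_rpow_neg_atTop hs).comp hN
  refine ⟨fun n => (N₁ n : ℝ) ^ (-(β / k)), ?_, hneg _ (by positivity), ?_, ?_, ?_⟩
  · filter_upwards [hpos] with n hn using Real.rpow_pos_of_pos hn _
  · have hs : 0 < β / k - 1 / 2 := by
      rw [sub_pos, lt_div_iff₀ hk0]
      linarith
    refine (hneg _ hs).congr' ?_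
    filter_upwards [hpos] with n hn
    rw [Real.sqrt_eq_rpow, ← Real.rpow_add hn]
    congr 1
    ring
  · refine (hneg (β - 2) (by linarith)).congr' ?_
    filter_upwards [hpos] with n hn
    rw [hpow n hn, ← Real.rpow_natCast, ← Real.rpow_add hn]
    congr 1
    push_cast
    ring
  · intro κ hκ
    have hrβ : 0 < r - β := by linarith
    have h1 : Tendsto (fun n => ((N₁ n : ℝ) ^ (r - β)) ^ (1 / (r - β)) *
        Real.exp (-(κ / (2 * θ)) * (N₁ n : ℝ) ^ (r - β))) atTop (𝓝 0) :=
      (tendsto_rpow_mul_exp_neg_mul_atTop_nhds_zero _ _ (by positivity)).comp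
        ((tendsto_rpow_atTop hrβ).comp hN)
    refine squeeze_zero' (.of_forall fun n => by positivity) ?_ h1
    filter_upwards [hpos, hlim.eventually_lt_const (show θ < 2 * θ by linarith),
      hN₀.eventually_gt_atTop 0] with n hn hn2 hn0
    have hn0' : (0 : ℝ) < N₀ n := by exact_mod_cast hn0
    rw [div_lt_iff₀ hn0'] at hn2
    rw [← Real.rpow_mul hn.le, mul_one_div_cancel hrβ.ne', Real.rpow_one]
    refine mul_le_mul_of_nonneg_left (Real.exp_le_exp.2 ?_) hn.le
    rw [hpow n hn, neg_mul, neg_le_neg_iff]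
    have h2 : (N₁ n : ℝ) ^ (r - β) = (N₁ n : ℝ) ^ r * (N₁ n : ℝ) ^ (-β) := by
      rw [← Real.rpow_add hn, sub_eq_add_neg]
    have h3 : 0 < (N₁ n : ℝ) ^ (-β) := Real.rpow_pos_of_pos hn _
    rw [h2, div_mul_eq_mul_div, div_le_iff₀ (by positivity)]
    have h4 := mul_le_mul_of_nonneg_right hn2.le (mul_nonneg hκ.le h3.le)
    nlinarith

namespace Population

variable {k : ℕ} {Ω : Type*} [MeasurableSpace Ω] (pop : Population k Ω)

/-- Small balls around treated covariates have control probability of the order of their volume, and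
balls have treated probability of at most that order. -/
lemma exists_ball_mass (hk : 1 ≤ k) (hX : pop.CovariateAssumption) :
    ∃ κ C ρ₀ : ℝ, 0 < κ ∧ 0 < C ∧ 0 < ρ₀ ∧
      (∀ᵐ x ∂pop.lawX 1, ∀ ρ, 0 < ρ → ρ ≤ ρ₀ →
        κ * ρ ^ k ≤ (pop.lawX 0).real (Metric.closedBall x ρ)) ∧
      ∀ x ρ, 0 ≤ ρ → (pop.lawX 1).real (Metric.closedBall x ρ) ≤ C * ρ ^ k := by
  obtain ⟨-, -, -, -, ⟨f, hf, -, ⟨C, hC⟩, b, hb, hbf⟩, φ, hφ, ρ₀, hρ₀, hball⟩ := hX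
  have : Nonempty (Fin k) := ⟨⟨0, hk⟩⟩
  have hnt : Nontrivial (Cov k) := inferInstance
  have hS : MeasurableSet (pop.supp 1) := Measure.isClosed_support.measurableSet
  set ω : ℝ≥0∞ := volume (Metric.ball (0 : Cov k) 1) with hω
  have hω0 : ω ≠ 0 := (Metric.measure_ball_pos volume _ one_pos).ne'
  have hωt : ω ≠ ∞ := measure_ball_lt_top.ne
  have hωr : 0 < ω.toReal := ENNReal.toReal_pos hω0 hωt
  have hvol : ∀ (x : Cov k) ρ, 0 ≤ ρ → volume (Metric.ball x ρ) = ENNReal.ofReal (ρ ^ k) * ω :=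
    fun x ρ hρ => by
      rw [Measure.addHaar_ball volume x hρ]
      simp [hω]
  have hvol' : ∀ (x : Cov k) ρ, 0 ≤ ρ →
      volume (Metric.closedBall x ρ) = ENNReal.ofReal (ρ ^ k) * ω := fun x ρ hρ => by
    rw [Measure.addHaar_closedBall volume x hρ]
    simp [hω]
  refine ⟨b * φ * ω.toReal, (|C| + 1) * ω.toReal, ρ₀, by positivity, by positivity, hρ₀, ?_, ?_⟩
  · filter_upwards [pop.ae_lawX_mem_supp 1] with x hx ρ h0 hρ
    have h1 := hball x hx ρ h0 hρ
    have h2 : ENNReal.ofReal b * volume (Metric.ball x ρ ∩ pop.supp 1)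
        ≤ pop.lawX 0 (Metric.closedBall x ρ) := by
      refine le_trans ?_ (measure_mono
        (Set.inter_subset_left.trans Metric.ball_subset_closedBall : _ ∩ pop.supp 1 ⊆ _))
      rw [(hf 0).2.2, withDensity_apply _ (Metric.isOpen_ball.measurableSet.inter hS),
        ← setLIntegral_const]
      refine setLIntegral_mono_ae' (Metric.isOpen_ball.measurableSet.inter hS)
        (.of_forall fun y hy => ?_)
      exact ENNReal.ofReal_le_ofReal (hbf y hy.2)
    rw [hvol x ρ h0.le] at h1
    rw [Measure.real, ← ENNReal.ofReal_le_iff_le_toReal (measure_ne_top _ _)]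
    refine le_trans (le_of_eq ?_) ((mul_le_mul_right h1 _).trans h2)
    rw [ENNReal.ofReal_mul (by positivity), ENNReal.ofReal_mul (by positivity),
      ENNReal.ofReal_mul hb.le, ENNReal.ofReal_toReal hωt]
    ring
  · intro x ρ hρ
    refine ENNReal.toReal_le_of_le_ofReal (by positivity) ?_
    have h1 : pop.lawX 1 (Metric.closedBall x ρ)
        ≤ pop.lawX 1 (Metric.closedBall x ρ ∩ pop.supp 1) := by
      refine measure_mono_ae ?_
      filter_upwards [pop.ae_lawX_mem_supp 1] with y hy hyA using ⟨hyA, hy⟩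
    refine h1.trans ?_
    have hm := (Metric.isClosed_closedBall (x := x) (ε := ρ)).measurableSet.inter hS
    calc pop.lawX 1 (Metric.closedBall x ρ ∩ pop.supp 1)
        ≤ ENNReal.ofReal (|C| + 1) * volume (Metric.closedBall x ρ ∩ pop.supp 1) := by
          rw [(hf 1).2.2, withDensity_apply _ hm, ← setLIntegral_const]
          refine setLIntegral_mono_ae' hm (.of_forall fun y hy => ?_)
          exact ENNReal.ofReal_le_ofReal (by linarith [hC 1 y hy.2, le_abs_self C])
      _ ≤ ENNReal.ofReal (|C| + 1) * (ENNReal.ofReal (ρ ^ k) * ω) := by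
          rw [← hvol' x ρ hρ]
          exact mul_le_mul_right (measure_mono Set.inter_subset_left) _
      _ = _ := by
          rw [ENNReal.ofReal_mul (by positivity), ENNReal.ofReal_mul (by positivity),
            ENNReal.ofReal_toReal hωt]
          ring

end Population

/-! ### Independent covariates -/

/-- The treatment arm of a unit of the pooled sample. -/
def unitArm {N₁ N₀ : ℕ} : Fin N₁ ⊕ Fin N₀ → Fin 2 := Sum.elim (fun _ => 1) fun _ => 0

section

variable {k : ℕ} {ν : Fin 2 → Measure (Cov k)} [∀ w, IsProbabilityMeasure (ν w)]

/-- The law of the covariates of a pooled sample. -/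
noncomputable def covLaw (ν : Fin 2 → Measure (Cov k)) (N₁ N₀ : ℕ) :
    Measure (Fin N₁ ⊕ Fin N₀ → Cov k) := Measure.pi fun e => ν (unitArm e)

instance (N₁ N₀ : ℕ) : IsProbabilityMeasure (covLaw ν N₁ N₀) := by
  unfold covLaw
  infer_instance

variable {N₁ N₀ : ℕ}

lemma measurePreserving_covLaw (e : Fin N₁ ⊕ Fin N₀) :
    MeasurePreserving (fun x : Fin N₁ ⊕ Fin N₀ → Cov k => x e) (covLaw ν N₁ N₀)
      (ν (unitArm e)) :=
  measurePreserving_eval _ e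

lemma integral_treated {F : Cov k → ℝ} (hF : Measurable F) (i : Fin N₁) :
    ∫ x, F (x (Sum.inl i)) ∂covLaw ν N₁ N₀ = ∫ y, F y ∂ν 1 := by
  have h := measurePreserving_covLaw (ν := ν) (N₀ := N₀) (Sum.inl i)
  rw [show ν 1 = _ from h.map_eq.symm,
    integral_map h.measurable.aemeasurable hF.aestronglyMeasurable]

lemma iIndepFun_covLaw :
    iIndepFun (fun (e : Fin N₁ ⊕ Fin N₀) (x : Fin N₁ ⊕ Fin N₀ → Cov k) => x e)
      (covLaw ν N₁ N₀) :=
  iIndepFun_pi (μ := fun e : Fin N₁ ⊕ Fin N₀ => ν (unitArm e)) (X := fun _ x => x)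
    fun _ => aemeasurable_id

/-- Treated units are unlikely to be close to each other. -/
lemma covLaw_treated_close_le {C R : ℝ} (hC : ∀ x, (ν 1).real (Metric.closedBall x R) ≤ C) :
    (covLaw ν N₁ N₀).real {x | ∃ i i' : Fin N₁, i ≠ i' ∧ ‖x (Sum.inl i) - x (Sum.inl i')‖ ≤ R}
      ≤ N₁ ^ 2 * C := by
  have hpair : ∀ i i' : Fin N₁, i ≠ i' →
      (covLaw ν N₁ N₀).real {x | ‖x (Sum.inl i) - x (Sum.inl i')‖ ≤ R} ≤ C := by
    intro i i' hne
    have hind := (iIndepFun_covLaw (ν := ν) (N₁ := N₁) (N₀ := N₀)).indepFun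
      (i := Sum.inl i) (j := Sum.inl i') (by simpa using hne)
    rw [indepFun_iff_map_prod_eq_prod_map_map (measurable_pi_apply _).aemeasurable
      (measurable_pi_apply _).aemeasurable,
      (measurePreserving_covLaw _).map_eq, (measurePreserving_covLaw _).map_eq] at hind
    have hm : MeasurableSet {p : Cov k × Cov k | ‖p.1 - p.2‖ ≤ R} :=
      measurableSet_le (by fun_prop) measurable_const
    have e1 : (covLaw ν N₁ N₀) {x | ‖x (Sum.inl i) - x (Sum.inl i')‖ ≤ R}
        = ((ν 1).prod (ν 1)) {p : Cov k × Cov k | ‖p.1 - p.2‖ ≤ R} := by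
      rw [show (ν 1).prod (ν 1) = _ from hind.symm, Measure.map_apply (by fun_prop) hm]
      rfl
    have hC0 : 0 ≤ C := measureReal_nonneg.trans (hC 0)
    refine ENNReal.toReal_le_of_le_ofReal hC0 ?_
    rw [e1, Measure.prod_apply hm]
    refine (lintegral_mono (g := fun _ => ENNReal.ofReal C) fun x => ?_).trans (by simp)
    have : Prod.mk x ⁻¹' {p : Cov k × Cov k | ‖p.1 - p.2‖ ≤ R} = Metric.closedBall x R := by
      ext y
      simp [dist_eq_norm, norm_sub_rev]
    rw [this, ENNReal.le_ofReal_iff_toReal_le (measure_ne_top _ _) hC0]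
    exact hC x
  have hsub : {x : Fin N₁ ⊕ Fin N₀ → Cov k |
        ∃ i i' : Fin N₁, i ≠ i' ∧ ‖x (Sum.inl i) - x (Sum.inl i')‖ ≤ R}
      ⊆ ⋃ p ∈ (Finset.univ.filter fun p : Fin N₁ × Fin N₁ => p.1 ≠ p.2),
        {x | ‖x (Sum.inl p.1) - x (Sum.inl p.2)‖ ≤ R} := by
    rintro x ⟨i, i', hne, h⟩
    simp only [Set.mem_iUnion]
    exact ⟨(i, i'), by simpa using hne, h⟩
  have hC0 : 0 ≤ C := measureReal_nonneg.trans (hC 0)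
  refine (measureReal_mono hsub (measure_ne_top _ _)).trans ((measureReal_biUnion_finset_le _ _).trans ?_)
  refine (Finset.sum_le_sum fun p hp => hpair p.1 p.2 (by simpa using hp)).trans ?_
  rw [Finset.sum_const, nsmul_eq_mul]
  refine mul_le_mul_of_nonneg_right ?_ hC0
  have := Finset.card_filter_le (Finset.univ : Finset (Fin N₁ × Fin N₁)) fun p => p.1 ≠ p.2
  rw [Finset.card_univ, Fintype.card_prod, Fintype.card_fin, ← sq] at this
  exact_mod_cast this

lemma measurePreserving_treated_controls (i : Fin N₁) :
    MeasurePreserving (fun x : Fin N₁ ⊕ Fin N₀ → Cov k => (x (Sum.inl i), fun j => x (Sum.inr j)))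
      (covLaw ν N₁ N₀) ((ν 1).prod (Measure.pi fun _ : Fin N₀ => ν 0)) := by
  have h1 := (measurePreserving_sumPiEquivProdPi_symm (X := fun _ : Fin N₁ ⊕ Fin N₀ => Cov k)
    fun e => ν (unitArm e)).symm
  have h2 := (measurePreserving_eval (fun _ : Fin N₁ => ν 1) i).prod
    (MeasurePreserving.id (Measure.pi fun _ : Fin N₀ => ν 0))
  exact h2.comp h1

/-- The generating function at `1 / 2` of the number of controls near a treated unit. -/
lemma integral_prod_half_le {A : Cov k → Cov k → Prop} [∀ a y, Decidable (A a y)]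
    (hA : MeasurableSet {q : Cov k × Cov k | A q.1 q.2}) {p : ℝ}
    (hp : ∀ᵐ a ∂ν 1, p ≤ (ν 0).real {y | A a y}) :
    ∫ q, ∏ j, (if A q.1 (q.2 j) then (1 / 2 : ℝ) else 1)
      ∂((ν 1).prod (Measure.pi fun _ : Fin N₀ => ν 0)) ≤ Real.exp (-(p / 2 * N₀)) := by
  have hm : Measurable fun q : Cov k × Cov k => if A q.1 q.2 then (1 / 2 : ℝ) else 1 :=
    Measurable.ite hA measurable_const measurable_const
  have h0 : ∀ a y, (0 : ℝ) ≤ if A a y then 1 / 2 else 1 := fun a y => by split_ifs <;> norm_num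
  have h1 : ∀ a y, (if A a y then (1 / 2 : ℝ) else 1) ≤ 1 := fun a y => by
    split_ifs <;> norm_num
  have hFm : Measurable fun q : Cov k × (Fin N₀ → Cov k) =>
      ∏ j, (if A q.1 (q.2 j) then (1 / 2 : ℝ) else 1) := Finset.measurable_fun_prod _ fun j _ =>
    hm.comp (measurable_fst.prodMk ((measurable_pi_apply j).comp measurable_snd))
  rw [integral_prod _ (Integrable.of_bound (C := 1) hFm.aestronglyMeasurable (.of_forall fun q => by
    rw [Real.norm_eq_abs, abs_of_nonneg (Finset.prod_nonneg fun j _ => h0 _ _)]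
    exact Finset.prod_le_one (fun j _ => h0 _ _) fun j _ => h1 _ _))]
  have hinner : ∀ a, ∫ y, ∏ j, (if A a (y j) then (1 / 2 : ℝ) else 1)
      ∂Measure.pi (fun _ : Fin N₀ => ν 0) = (1 - (ν 0).real {y | A a y} / 2) ^ N₀ := fun a => by
    have hAa : MeasurableSet {y | A a y} := measurable_prodMk_left hA
    have e : (fun y => if A a y then (1 / 2 : ℝ) else 1)
        = fun y => 1 - {y | A a y}.indicator (fun _ => (1 / 2 : ℝ)) y := by
      ext y
      simp only [Set.indicator, Set.mem_ofPred_eq]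
      split_ifs <;> norm_num
    rw [integral_fintype_prod_eq_prod (𝕜 := ℝ)
      (fun (_ : Fin N₀) y => if A a y then (1 / 2 : ℝ) else 1), e,
      integral_sub (integrable_const _) ((integrable_const _).indicator hAa),
      integral_indicator_const _ hAa]
    simp [div_eq_mul_inv]
  simp only [hinner]
  refine (integral_mono_of_nonneg (.of_forall fun a => ?_)
    (integrable_const (Real.exp (-(p / 2 * N₀)))) ?_).trans (by simp)
  · have : (ν 0).real {y | A a y} ≤ 1 := measureReal_le_one
    exact pow_nonneg (by linarith) _
  · filter_upwards [hp] with a ha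
    have h2 : (ν 0).real {y | A a y} ≤ 1 := measureReal_le_one
    rw [show -(p / 2 * (N₀ : ℝ)) = N₀ * (-(p / 2)) by ring, Real.exp_nat_mul]
    refine pow_le_pow_left₀ (by linarith) ?_ _
    have := Real.add_one_le_exp (-(p / 2))
    linarith

/-- A treated unit is unlikely to have fewer than `M` controls in relation `A` to it, by a
Chernoff bound for the binomial number of such controls. -/
lemma covLaw_few_controls_le {A : Cov k → Cov k → Prop} [∀ a y, Decidable (A a y)]
    (hA : MeasurableSet {q : Cov k × Cov k | A q.1 q.2}) {M : ℕ} {p : ℝ}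
    (hp : ∀ᵐ a ∂ν 1, p ≤ (ν 0).real {y | A a y}) (i : Fin N₁) :
    (covLaw ν N₁ N₀).real {x | (Finset.univ.filter fun j : Fin N₀ =>
        A (x (Sum.inl i)) (x (Sum.inr j))).card < M}
      ≤ 2 ^ M * Real.exp (-(p / 2 * N₀)) := by
  have hint := integral_prod_half_le (N₀ := N₀) hA hp
  have hφ : Measurable fun q : Cov k × Cov k => if A q.1 q.2 then (1 / 2 : ℝ) else 1 :=
    Measurable.ite hA measurable_const measurable_const
  have hGm : Measurable fun q : Cov k × (Fin N₀ → Cov k) =>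
      ∏ j, (if A q.1 (q.2 j) then (1 / 2 : ℝ) else 1) := Finset.measurable_fun_prod _ fun j _ =>
    hφ.comp (measurable_fst.prodMk ((measurable_pi_apply j).comp measurable_snd))
  have hmp := measurePreserving_treated_controls (ν := ν) (N₀ := N₀) i
  rw [← hmp.map_eq, integral_map hmp.measurable.aemeasurable hGm.aestronglyMeasurable] at hint
  have hcard : ∀ x : Fin N₁ ⊕ Fin N₀ → Cov k,
      ∏ j, (if A (x (Sum.inl i)) (x (Sum.inr j)) then (1 / 2 : ℝ) else 1)
        = (1 / 2) ^ (Finset.univ.filter fun j : Fin N₀ =>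
          A (x (Sum.inl i)) (x (Sum.inr j))).card := fun x => by
    rw [Finset.prod_ite, Finset.prod_const, Finset.prod_const_one, mul_one]
  have hint' : Integrable (fun x : Fin N₁ ⊕ Fin N₀ → Cov k =>
      ∏ j, (if A (x (Sum.inl i)) (x (Sum.inr j)) then (1 / 2 : ℝ) else 1)) (covLaw ν N₁ N₀) :=
    Integrable.of_bound (C := 1) (hGm.comp hmp.measurable).aestronglyMeasurable
      (.of_forall fun x => by
        rw [hcard, Real.norm_eq_abs, abs_of_nonneg (by positivity)]
        exact pow_le_one₀ (by norm_num) (by norm_num))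
  have hmarkov := mul_meas_ge_le_integral_of_nonneg (.of_forall fun x => by
    rw [hcard]; simp only [Pi.zero_apply]; positivity) hint' ((1 / 2) ^ M)
  have hsub : {x : Fin N₁ ⊕ Fin N₀ → Cov k | (Finset.univ.filter fun j : Fin N₀ =>
        A (x (Sum.inl i)) (x (Sum.inr j))).card < M} ⊆ {x | (1 / 2 : ℝ) ^ M ≤
      ∏ j, (if A (x (Sum.inl i)) (x (Sum.inr j)) then (1 / 2 : ℝ) else 1)} := by
    intro x hx
    rw [Set.mem_ofPred_eq] at hx ⊢
    rw [hcard]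
    exact pow_le_pow_of_le_one (by norm_num) (by norm_num) hx.le
  refine (measureReal_mono hsub (measure_ne_top _ _)).trans ?_
  have h3 := mul_le_mul_of_nonneg_left (hmarkov.trans hint) (show (0 : ℝ) ≤ 2 ^ M by positivity)
  rwa [← mul_assoc, ← mul_pow, mul_one_div_cancel two_ne_zero, one_pow, one_mul] at h3

lemma covLaw_not_wellMatched_le {M : ℕ} {C p r R : ℝ}
    (hC : ∀ x, (ν 1).real (Metric.closedBall x R) ≤ C)
    (hp : ∀ᵐ x ∂ν 1, p ≤ (ν 0).real (Metric.closedBall x r)) :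
    (covLaw ν N₁ N₀).real {x | ¬ WellMatched M r R x}
      ≤ N₁ ^ 2 * C + N₁ * (2 ^ M * Real.exp (-(p / 2 * N₀))) := by
  have hA : MeasurableSet {q : Cov k × Cov k | ‖q.1 - q.2‖ ≤ r} :=
    measurableSet_le (by fun_prop) measurable_const
  have hp' : ∀ᵐ a ∂ν 1, p ≤ (ν 0).real {y | ‖a - y‖ ≤ r} := by
    filter_upwards [hp] with a ha
    convert ha using 2
    ext y
    simp [dist_eq_norm, norm_sub_rev]
  have hsub : {x : Fin N₁ ⊕ Fin N₀ → Cov k | ¬ WellMatched M r R x} ⊆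
      {x | ∃ i i' : Fin N₁, i ≠ i' ∧ ‖x (Sum.inl i) - x (Sum.inl i')‖ ≤ R} ∪
      ⋃ i ∈ (Finset.univ : Finset (Fin N₁)), {x | (Finset.univ.filter fun j : Fin N₀ =>
        ‖x (Sum.inl i) - x (Sum.inr j)‖ ≤ r).card < M} := by
    intro x hx
    by_contra hcon
    simp only [Set.mem_union, Set.mem_iUnion, Set.mem_ofPred_eq, not_or, not_exists, not_and, not_le,
      not_lt, Finset.mem_univ, true_implies] at hcon
    exact hx ⟨fun i i' h => hcon.1 i i' h, hcon.2⟩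
  refine (measureReal_mono hsub (measure_ne_top _ _)).trans ((measureReal_union_le _ _).trans
    (add_le_add (covLaw_treated_close_le hC) ?_))
  refine (measureReal_biUnion_finset_le _ _).trans
    ((Finset.sum_le_sum fun i _ => covLaw_few_controls_le hA hp' i).trans ?_)
  simp

/-- Averages of a bounded function over the treated units concentrate around its mean. -/
lemma covLaw_sum_sub_ge_le {f : Cov k → ℝ} (hf : Measurable f) {B : ℝ} (hB : ∀ x, |f x| ≤ B)
    {δ : ℝ} (hδ : 0 < δ) (hN : 0 < N₁) :
    (covLaw ν N₁ N₀).real {x | δ * N₁ ≤ |∑ i : Fin N₁, f (x (Sum.inl i)) - N₁ * ∫ y, f y ∂ν 1|}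
      ≤ B ^ 2 / (δ ^ 2 * N₁) := by
  have hN' : (0 : ℝ) < N₁ := by exact_mod_cast hN
  have hX : ∀ i : Fin N₁, Measurable fun x : Fin N₁ ⊕ Fin N₀ → Cov k => f (x (Sum.inl i)) :=
    fun i => hf.comp (measurable_pi_apply _)
  have hmean : ∀ i : Fin N₁, ∫ x, f (x (Sum.inl i)) ∂covLaw ν N₁ N₀ = ∫ y, f y ∂ν 1 := fun i =>
    integral_treated hf i
  have h := measure_abs_sum_sub_ge_le (P := covLaw ν N₁ N₀)
    (X := fun (i : Fin N₁) x => f (x (Sum.inl i)))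
    (fun i => MemLp.of_bound (hX i).aestronglyMeasurable B (.of_forall fun x => hB _))
    (fun i j hij => ((iIndepFun_covLaw (ν := ν)).indepFun (i := Sum.inl i) (j := Sum.inl j)
      (by simpa using hij)).comp hf hf) (δ := δ * N₁) (B := N₁ * B ^ 2) (by positivity) (by
      refine (Finset.sum_le_sum (g := fun _ => B ^ 2) fun i _ => ?_).trans (by simp)
      refine (integral_mono_of_nonneg (.of_forall fun x => sq_nonneg _) (integrable_const (B ^ 2))
        (.of_forall fun x => ?_)).trans (by simp)
      exact sq_le_sq' (abs_le.1 (hB _)).1 (abs_le.1 (hB _)).2)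
  simp only [hmean, Finset.sum_const, Finset.card_univ, Fintype.card_fin, nsmul_eq_mul] at h
  refine (ENNReal.toReal_le_of_le_ofReal (by positivity) h).trans (le_of_eq ?_)
  field_simp

/-- The central limit theorem for averages of a bounded function over the treated units. -/
lemma covLaw_norm_integral_exp_sub_le {f : Cov k → ℝ} (hf : Measurable f) {B : ℝ} (hB0 : 0 < B)
    (hB : ∀ x, |f x| ≤ B) (hf0 : ∫ y, f y ∂ν 1 = 0) {t : ℝ} (ht : t ≠ 0) (hN : 0 < N₁) :
    ‖∫ x, Complex.exp ((t / √N₁ * ∑ i : Fin N₁, f (x (Sum.inl i)) : ℝ) * Complex.I) ∂covLaw ν N₁ N₀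
        - Complex.exp (-(t ^ 2 * ∫ y, f y ^ 2 ∂ν 1 : ℝ) / 2)‖
      ≤ 2 * √(t ^ 4 * B ^ 4 / N₁) * (t ^ 2 * ∫ y, f y ^ 2 ∂ν 1) + 2 * √(t ^ 4 * B ^ 4 / N₁)
        + t ^ 4 * B ^ 4 / N₁ := by
  have hN' : (0 : ℝ) < N₁ := by exact_mod_cast hN
  have hX : ∀ i : Fin N₁, Measurable fun x : Fin N₁ ⊕ Fin N₀ → Cov k => t / √N₁ * f (x (Sum.inl i)) :=
    fun i => (hf.comp (measurable_pi_apply (Sum.inl i))).const_mul _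
  have hmean : ∀ (F : Cov k → ℝ), Measurable F → ∀ i : Fin N₁,
      ∫ x, F (x (Sum.inl i)) ∂covLaw ν N₁ N₀ = ∫ y, F y ∂ν 1 := fun F hF i =>
    integral_treated hF i
  have hind : iIndepFun (fun (i : Fin N₁) (x : Fin N₁ ⊕ Fin N₀ → Cov k) =>
      t / √N₁ * f (x (Sum.inl i))) (covLaw ν N₁ N₀) :=
    ((iIndepFun_covLaw (ν := ν)).precomp (g := (Sum.inl : Fin N₁ → Fin N₁ ⊕ Fin N₀))
      Sum.inl_injective).comp (fun _ y => t / √N₁ * f y) fun _ => hf.const_mul _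
  have h4le : ∀ x, f x ^ 4 ≤ B ^ 4 := fun x => by
    rw [show f x ^ 4 = |f x| ^ 4 from (Even.pow_abs (by decide) _).symm]
    exact pow_le_pow_left₀ (abs_nonneg _) (hB x) 4
  have hs2 : (√(N₁ : ℝ)) ^ 2 = N₁ := Real.sq_sqrt hN'.le
  have hτ4 : (t / √N₁) ^ 4 = t ^ 4 / N₁ ^ 2 := by
    rw [div_pow, show (√(N₁ : ℝ)) ^ 4 = ((√(N₁ : ℝ)) ^ 2) ^ 2 by ring, hs2]
  have h := norm_integral_exp_sum_sub_le hX hind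
    (fun i => by rw [integral_const_mul, hmean f hf, hf0, mul_zero])
    (fun i => Integrable.of_bound (C := (t / √N₁) ^ 4 * B ^ 4)
      ((hX i).pow_const 4).aestronglyMeasurable (.of_forall fun x => by
        rw [Real.norm_eq_abs, abs_of_nonneg (by positivity), mul_pow]
        exact mul_le_mul_of_nonneg_left (h4le _) (by positivity))) (l := t ^ 4 * B ^ 4 / N₁) (by positivity) (by
      have : ∀ i : Fin N₁, ∫ x, (t / √N₁ * f (x (Sum.inl i))) ^ 4 ∂covLaw ν N₁ N₀
          ≤ t ^ 4 / N₁ ^ 2 * B ^ 4 := fun i => by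
        refine (integral_mono_of_nonneg (.of_forall fun x => by positivity)
          (integrable_const (t ^ 4 / N₁ ^ 2 * B ^ 4)) (.of_forall fun x => ?_)).trans (by simp)
        simp only [mul_pow, hτ4]
        exact mul_le_mul_of_nonneg_left (h4le _) (by positivity)
      refine (Finset.sum_le_sum fun i _ => this i).trans (le_of_eq ?_)
      simp only [Finset.sum_const, Finset.card_univ, Fintype.card_fin, nsmul_eq_mul]
      field_simp)
  have hvar : ∑ i : Fin N₁, ∫ x, (t / √N₁ * f (x (Sum.inl i))) ^ 2 ∂covLaw ν N₁ N₀
      = t ^ 2 * ∫ y, f y ^ 2 ∂ν 1 := by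
    simp only [mul_pow, integral_const_mul]
    simp only [hmean (fun y => f y ^ 2) (hf.pow_const 2), Finset.sum_const, Finset.card_univ,
      Fintype.card_fin, nsmul_eq_mul, div_pow, hs2]
    field_simp
  rw [hvar] at h
  simp only [← Finset.mul_sum] at h
  exact h

end
end Matching

namespace Matching

/-! ### The matched sample given the covariates -/

lemma unitArm_matchIdx {k N₁ N₀ M : ℕ} (V : Matrix (Fin k) (Fin k) ℝ) (hM : M ≤ N₀)
    (x : Fin N₁ ⊕ Fin N₀ → Cov k) (i : Fin N₁) (j : Fin (M + 1)) :
    unitArm (matchIdx V x (i, j)) = if j = 0 then 1 else 0 := by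
  refine Fin.cases ?_ (fun m => ?_) j
  · simp [matchIdx_zero, unitArm]
  · rw [matchIdx_succ V x i m (m.2.trans_le hM)]
    simp [unitArm, Fin.succ_ne_zero]

namespace OutcomeModel

variable {k : ℕ} (m : OutcomeModel k)

/-- The conditional moments of the outcomes at a covariate value are those of the model. -/
def Regular (w : Fin 2) (x : Cov k) : Prop :=
  Integrable (fun u => m.h w x u ^ 4) ∧ ∫ u, m.h w x u = m.g w x ∧
    ∫ u, (m.h w x u - m.g w x) ^ 2 = m.s w x ∧ ∫ u, m.h w x u ^ 4 ≤ m.B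

/-- The pooled sample with covariates `x` and outcomes generated by `u`. -/
def sample {N₁ N₀ : ℕ} (x : Fin N₁ ⊕ Fin N₀ → Cov k) (u : Fin N₁ ⊕ Fin N₀ → unitInterval) :
    Fin N₁ ⊕ Fin N₀ → ℝ × Cov k :=
  fun e => (m.h (unitArm e) (x e) (u e), x e)

/-- The conditional effect of the treatment in excess of `c`. -/
def effect (c : ℝ) (x : Cov k) : ℝ := m.g 1 x - m.g 0 x - c

/-- The conditional variance of a contrast in which all matches are exact. -/
noncomputable def noise (M : ℕ) (x : Cov k) : ℝ := m.s 1 x + m.s 0 x / M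

lemma B_pos : 0 < m.B := m.b_pos.trans_le ((m.le_s 0 0).trans (m.s_le 0 0))

lemma measurable_effect (c : ℝ) : Measurable (m.effect c) :=
  ((m.lipschitz_g 1).continuous.measurable.sub (m.lipschitz_g 0).continuous.measurable).sub_const c

lemma measurable_noise (M : ℕ) : Measurable (m.noise M) :=
  (m.lipschitz_s 1).continuous.measurable.add
    ((m.lipschitz_s 0).continuous.measurable.div_const _)

lemma abs_effect_le (c : ℝ) (x : Cov k) : |m.effect c x| ≤ 2 * m.B + |c| := by
  have h1 := abs_le.1 (m.abs_g_le 1 x)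
  have h0 := abs_le.1 (m.abs_g_le 0 x)
  have hc := abs_le.1 (le_refl |c|)
  rw [effect, abs_le]
  constructor <;> linarith

lemma le_noise (M : ℕ) (x : Cov k) : m.b ≤ m.noise M x :=
  (m.le_s 1 x).trans (le_add_of_nonneg_right
    (div_nonneg (m.b_pos.le.trans (m.le_s 0 x)) (Nat.cast_nonneg M)))

lemma noise_le {M : ℕ} (hM : 1 ≤ M) (x : Cov k) : m.noise M x ≤ 2 * m.B := by
  have h1 : m.s 0 x / M ≤ m.s 0 x :=
    div_le_self (m.b_pos.le.trans (m.le_s 0 x)) (by exact_mod_cast hM)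
  rw [noise]
  linarith [m.s_le 0 x, m.s_le 1 x]

lemma ae_regular (N₁ N₀ : ℕ) : ∀ᵐ x ∂covLaw m.ν N₁ N₀, ∀ e, m.Regular (unitArm e) (x e) :=
  ae_all_iff.2 fun e =>
    (measurePreserving_covLaw (ν := m.ν) e).quasiMeasurePreserving.ae (m.moments _)

lemma measurable_h_apply (w : Fin 2) (x : Cov k) : Measurable (m.h w x) :=
  (m.measurable_h w).comp (measurable_const.prodMk measurable_id)

lemma measurable_sample (N₁ N₀ : ℕ) :
    Measurable fun p : (Fin N₁ ⊕ Fin N₀ → Cov k) × (Fin N₁ ⊕ Fin N₀ → unitInterval) =>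
      m.sample p.1 p.2 := by
  refine measurable_pi_lambda _ fun e => ?_
  have hx : Measurable fun p : (Fin N₁ ⊕ Fin N₀ → Cov k) × (Fin N₁ ⊕ Fin N₀ → unitInterval) =>
      p.1 e := (measurable_pi_apply e).comp measurable_fst
  have hu : Measurable fun p : (Fin N₁ ⊕ Fin N₀ → Cov k) × (Fin N₁ ⊕ Fin N₀ → unitInterval) =>
      p.2 e := (measurable_pi_apply e).comp measurable_snd
  exact ((m.measurable_h _).comp (hx.prodMk hu)).prodMk hx

variable {N₁ N₀ M : ℕ} (V : Matrix (Fin k) (Fin k) ℝ)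

lemma matchedOutcomes_sample (hM : M ≤ N₀) (c : ℝ) (x : Fin N₁ ⊕ Fin N₀ → Cov k)
    (u : Fin N₁ ⊕ Fin N₀ → unitInterval) :
    matchedOutcomes V M c (m.sample x u) = shiftedArray c fun p : Fin N₁ × Fin (M + 1) =>
      m.h (unitArm (matchIdx V x p)) (x (matchIdx V x p)) (u (matchIdx V x p)) := by
  ext i j
  exact matchedOutcomes_eq V hM c _ i j

variable {V}

/-- If no unit is used in two matches, the matched outcomes are independent given the
covariates. -/
lemma indepArray_matched {x : Fin N₁ ⊕ Fin N₀ → Cov k}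
    (hJ : Function.Injective (matchIdx V (M := M) x))
    (hreg : ∀ e, m.Regular (unitArm e) (x e)) :
    IndepArray (Measure.pi fun _ : Fin N₁ ⊕ Fin N₀ => (volume : Measure unitInterval))
      (fun (p : Fin N₁ × Fin (M + 1)) u =>
        m.h (unitArm (matchIdx V x p)) (x (matchIdx V x p)) (u (matchIdx V x p)))
      (fun p => m.g (unitArm (matchIdx V x p)) (x (matchIdx V x p)))
      (fun p => m.s (unitArm (matchIdx V x p)) (x (matchIdx V x p))) m.B := by
  have hmp : ∀ e, MeasurePreserving (fun u : Fin N₁ ⊕ Fin N₀ → unitInterval => u e)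
      (Measure.pi fun _ => volume) volume := fun e => measurePreserving_eval _ e
  have hint : ∀ e (F : unitInterval → ℝ), Measurable F →
      ∫ u : Fin N₁ ⊕ Fin N₀ → unitInterval, F (u e) ∂(Measure.pi fun _ => volume) = ∫ v, F v := by
    intro e F hF
    have h := integral_map (hmp e).measurable.aemeasurable (hF.aestronglyMeasurable
      (μ := Measure.map (fun u : Fin N₁ ⊕ Fin N₀ → unitInterval => u e)
        (Measure.pi fun _ => volume)))
    rw [(hmp e).map_eq] at h
    exact h.symm
  have hm := fun e => m.measurable_h_apply (unitArm e) (x e)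
  refine ⟨fun p => (hm _).comp (measurable_pi_apply _), ?_, fun p => ?_, fun p => ?_, fun p => ?_,
    fun p => ?_⟩
  · exact (iIndepFun_pi (μ := fun _ : Fin N₁ ⊕ Fin N₀ => (volume : Measure unitInterval))
      (X := fun e => m.h (unitArm e) (x e)) fun e => (hm e).aemeasurable).precomp hJ
  · exact (hmp _).integrable_comp_of_integrable (hreg (matchIdx V x p)).1
  · exact (hint _ _ (hm _)).trans (hreg (matchIdx V x p)).2.1
  · exact (hint _ (fun v => (m.h _ _ v - m.g _ _) ^ 2)
      (((hm (matchIdx V x p)).sub_const _).pow_const 2)).trans (hreg (matchIdx V x p)).2.2.1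
  · exact (hint _ (fun v => m.h _ _ v ^ 4) ((hm (matchIdx V x p)).pow_const 4)).le.trans
      (hreg (matchIdx V x p)).2.2.2

lemma abs_sum_weight_mul_sub_le {w F F' : Fin (M + 1) → ℝ} (hw : ∀ j, |w j| ≤ 1) {ε : ℝ}
    (h : ∀ j, |F j - F' j| ≤ ε) : |∑ j, w j * F j - ∑ j, w j * F' j| ≤ (M + 1) * ε := by
  rw [← Finset.sum_sub_distrib]
  refine (Finset.abs_sum_le_sum_abs _ _).trans ?_
  refine (Finset.sum_le_sum (g := fun _ => ε) fun j _ => ?_).trans (by simp)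
  rw [← mul_sub, abs_mul]
  exact (mul_le_of_le_one_left (abs_nonneg _) (hw j)).trans (h j)

section
variable {x : Fin N₁ ⊕ Fin N₀ → Cov k} {d : ℝ} (hM : 1 ≤ M) (hMN : M ≤ N₀)
  (hd : ∀ (i : Fin N₁) (j : Fin (M + 1)), ‖x (Sum.inl i) - x (matchIdx V x (i, j))‖ ≤ d)
include hM hMN hd

/-- The bias of a contrast is of the order of the matching discrepancies. -/
lemma abs_mean_sub_effect_le (c : ℝ) (i : Fin N₁) :
    |(∑ j : Fin (M + 1), weight j * m.g (unitArm (matchIdx V x (i, j))) (x (matchIdx V x (i, j)))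
        - c) - m.effect c (x (Sum.inl i))| ≤ (M + 1) * (m.L * d) := by
  have hM' : (M : ℝ) ≠ 0 := by positivity
  have e : m.effect c (x (Sum.inl i)) = ∑ j : Fin (M + 1),
      weight j * m.g (unitArm (matchIdx V x (i, j))) (x (Sum.inl i)) - c := by
    simp only [unitArm_matchIdx V hMN]
    rw [Fin.sum_univ_succ]
    simp [weight, Fin.succ_ne_zero, effect, ← mul_assoc, mul_inv_cancel₀ hM']
    ring
  rw [e, sub_sub_sub_cancel_right]
  refine abs_sum_weight_mul_sub_le abs_weight_le fun j => ?_
  rw [← Real.dist_eq]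
  refine ((m.lipschitz_g _).dist_le_mul _ _).trans ?_
  rw [dist_eq_norm, norm_sub_rev]
  exact mul_le_mul_of_nonneg_left (hd i j) (NNReal.coe_nonneg _)

lemma abs_var_sub_noise_le (i : Fin N₁) :
    |(∑ j : Fin (M + 1),
        weight j ^ 2 * m.s (unitArm (matchIdx V x (i, j))) (x (matchIdx V x (i, j))))
        - m.noise M (x (Sum.inl i))| ≤ (M + 1) * (m.L * d) := by
  have hM' : (M : ℝ) ≠ 0 := by positivity
  have e : m.noise M (x (Sum.inl i)) = ∑ j : Fin (M + 1),
      weight j ^ 2 * m.s (unitArm (matchIdx V x (i, j))) (x (Sum.inl i)) := by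
    simp only [unitArm_matchIdx V hMN]
    rw [Fin.sum_univ_succ]
    simp [weight, Fin.succ_ne_zero, noise]
    field_simp
  rw [e]
  refine abs_sum_weight_mul_sub_le (fun j => ?_) fun j => ?_
  · rw [abs_of_nonneg (sq_nonneg _)]
    exact weight_sq_le j
  · rw [← Real.dist_eq]
    refine ((m.lipschitz_s _).dist_le_mul _ _).trans ?_
    rw [dist_eq_norm, norm_sub_rev]
    exact mul_le_mul_of_nonneg_left (hd i j) (NNReal.coe_nonneg _)

end

lemma norm_exp_mul_exp_sub_le {a a' v v' : ℝ} (hv : 0 ≤ v) (hv' : 0 ≤ v') :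
    ‖Complex.exp ((a : ℂ) * Complex.I) * Complex.exp (-(v : ℂ) / 2)
      - Complex.exp ((a' : ℂ) * Complex.I) * Complex.exp (-(v' : ℂ) / 2)‖
      ≤ |a - a'| + |v - v'| / 2 := by
  have h1 : ‖Complex.exp ((a : ℂ) * Complex.I) - Complex.exp ((a' : ℂ) * Complex.I)‖
      ≤ |a - a'| := by
    have e : Complex.exp ((a : ℂ) * Complex.I) - Complex.exp ((a' : ℂ) * Complex.I)
        = Complex.exp ((a' : ℂ) * Complex.I) * (Complex.exp (Complex.I * ((a - a' : ℝ) : ℂ)) - 1) := by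
      rw [mul_sub, ← Complex.exp_add, mul_one]
      congr 2
      push_cast
      ring
    rw [e, norm_mul, Complex.norm_exp_ofReal_mul_I, one_mul]
    exact Real.norm_exp_I_mul_ofReal_sub_one_le.trans (le_of_eq (Real.norm_eq_abs _))
  have e2 : ∀ r : ℝ, Complex.exp (-(r : ℂ) / 2) = (Real.exp (-r / 2) : ℂ) := fun r => by
    push_cast
    rfl
  have h2 : |Real.exp (-v / 2) - Real.exp (-v' / 2)| ≤ |v - v'| / 2 := by
    have key : ∀ r r' : ℝ, 0 ≤ r → r ≤ r' →
        |Real.exp (-r / 2) - Real.exp (-r' / 2)| ≤ (r' - r) / 2 := fun r r' hr hrr => by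
      have h3 : Real.exp (-r' / 2) = Real.exp (-r / 2) * Real.exp (-(r' - r) / 2) := by
        rw [← Real.exp_add]
        congr 1
        ring
      have h4 := Real.add_one_le_exp (-(r' - r) / 2)
      have h5 : Real.exp (-r / 2) ≤ 1 := Real.exp_le_one_iff.2 (by linarith)
      have h6 : Real.exp (-(r' - r) / 2) ≤ 1 := Real.exp_le_one_iff.2 (by linarith)
      have h7 := Real.exp_pos (-r / 2)
      rw [h3, abs_of_nonneg (by nlinarith)]
      nlinarith
    rcases le_total v v' with h | h
    · rw [abs_sub_comm v v', abs_of_nonneg (sub_nonneg.2 h)]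
      exact key v v' hv h
    · rw [abs_sub_comm, abs_of_nonneg (sub_nonneg.2 h)]
      exact key v' v hv' h
  have e : Complex.exp ((a : ℂ) * Complex.I) * Complex.exp (-(v : ℂ) / 2)
      - Complex.exp ((a' : ℂ) * Complex.I) * Complex.exp (-(v' : ℂ) / 2)
      = (Complex.exp ((a : ℂ) * Complex.I) - Complex.exp ((a' : ℂ) * Complex.I))
          * (Real.exp (-v / 2) : ℂ)
        + Complex.exp ((a' : ℂ) * Complex.I) * ((Real.exp (-v / 2) - Real.exp (-v' / 2) : ℝ) : ℂ) := by
    rw [e2, e2]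
    push_cast
    ring
  rw [e]
  refine (norm_add_le _ _).trans (add_le_add ?_ ?_)
  · rw [norm_mul, Complex.norm_real, Real.norm_eq_abs, Real.abs_exp]
    exact (mul_le_of_le_one_right (norm_nonneg _) (Real.exp_le_one_iff.2 (by linarith))).trans h1
  · rw [norm_mul, Complex.norm_exp_ofReal_mul_I, one_mul, Complex.norm_real, Real.norm_eq_abs]
    exact h2

section
variable {x : Fin N₁ ⊕ Fin N₀ → Cov k} {d : ℝ} (hM : 1 ≤ M) (hMN : M ≤ N₀) (hN : 0 < N₁)
  (hJ : Function.Injective (matchIdx V (M := M) x)) (hreg : ∀ e, m.Regular (unitArm e) (x e))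
  (hd : ∀ (i : Fin N₁) (j : Fin (M + 1)), ‖x (Sum.inl i) - x (matchIdx V x (i, j))‖ ≤ d)
include hM hMN hN hJ hreg hd

/-- The conditional characteristic function of the normalized sum of the contrasts. -/
lemma norm_integral_exp_contrast_sub_le (c : ℝ) {t : ℝ} (ht : t ≠ 0) {σ δ : ℝ} (hσ : 0 ≤ σ)
    (hδ : |∑ i, m.noise M (x (Sum.inl i)) - N₁ * σ| ≤ δ * N₁) :
    ‖∫ u, Complex.exp ((t / √N₁ * ∑ i, contrast (matchedOutcomes V M c (m.sample x u)) i : ℝ)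
          * Complex.I) ∂(Measure.pi fun _ => volume)
        - Complex.exp ((t / √N₁ * ∑ i, m.effect c (x (Sum.inl i)) : ℝ) * Complex.I)
          * Complex.exp (-(t ^ 2 * σ : ℝ) / 2)‖
      ≤ 2 * √(16 * t ^ 4 * (M + 1) * m.B / N₁) * (t ^ 2 * (M + 1) * (1 + 16 * m.B) + 1)
        + 16 * t ^ 4 * (M + 1) * m.B / N₁
        + (|t| * ((M + 1) * m.L * (√N₁ * d)) + t ^ 2 * ((M + 1) * m.L * d + δ) / 2) := by
  have hN' : (0 : ℝ) < N₁ := by exact_mod_cast hN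
  have hs : 0 < √(N₁ : ℝ) := Real.sqrt_pos.2 hN'
  have hss : √(N₁ : ℝ) * √N₁ = N₁ := Real.mul_self_sqrt hN'.le
  simp only [m.matchedOutcomes_sample V hMN]
  refine (norm_sub_le_norm_sub_add_norm_sub _ _ _).trans (add_le_add
    ((m.indepArray_matched hJ hreg).norm_integral_exp_sub_le hN m.B_pos c ht) ?_)
  have hvpos : ∀ i, 0 ≤ ∑ j : Fin (M + 1),
      weight j ^ 2 * m.s (unitArm (matchIdx V x (i, j))) (x (matchIdx V x (i, j))) := fun i =>
    Finset.sum_nonneg fun j _ => mul_nonneg (sq_nonneg _) (m.b_pos.le.trans (m.le_s _ _))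
  refine (norm_exp_mul_exp_sub_le (mul_nonneg (by positivity)
    (Finset.sum_nonneg fun i _ => hvpos i)) (by positivity)).trans (add_le_add ?_ ?_)
  · rw [← mul_sub, ← Finset.sum_sub_distrib, abs_mul, abs_div, abs_of_pos hs]
    have h1 : |∑ i : Fin N₁, ((∑ j : Fin (M + 1), weight j *
        m.g (unitArm (matchIdx V x (i, j))) (x (matchIdx V x (i, j))) - c)
        - m.effect c (x (Sum.inl i)))| ≤ N₁ * ((M + 1) * (m.L * d)) := by
      refine (Finset.abs_sum_le_sum_abs _ _).trans ?_
      refine (Finset.sum_le_sum fun i _ => m.abs_mean_sub_effect_le hM hMN hd c i).trans ?_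
      simp
    calc _ ≤ |t| / √N₁ * (N₁ * ((M + 1) * (m.L * d))) := by gcongr
      _ = _ := by
        rw [div_mul_eq_mul_div, div_eq_iff hs.ne']
        linear_combination (-(|t| * ((M + 1) * m.L * d))) * hss
  · have h1 : |∑ i : Fin N₁, ((∑ j : Fin (M + 1), weight j ^ 2 *
        m.s (unitArm (matchIdx V x (i, j))) (x (matchIdx V x (i, j))))
        - m.noise M (x (Sum.inl i)))| ≤ N₁ * ((M + 1) * (m.L * d)) := by
      refine (Finset.abs_sum_le_sum_abs _ _).trans ?_
      refine (Finset.sum_le_sum fun i _ => m.abs_var_sub_noise_le hM hMN hd i).trans ?_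
      simp
    rw [Finset.sum_sub_distrib] at h1
    have h2 := (abs_sub_le _ _ _).trans (add_le_add h1 hδ)
    rw [show ∀ S : ℝ, t ^ 2 / N₁ * S - t ^ 2 * σ = t ^ 2 / N₁ * (S - N₁ * σ) from fun S => by
      field_simp, abs_mul, abs_of_nonneg (by positivity : 0 ≤ t ^ 2 / (N₁ : ℝ))]
    refine div_le_div_of_nonneg_right ?_ (by norm_num)
    calc _ ≤ t ^ 2 / N₁ * (N₁ * ((M + 1) * (m.L * d)) + δ * N₁) := by gcongr
      _ = _ := by field_simp

/-- Given the covariates, the mean square of the contrasts is unlikely to fall far below the average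
of the squared effects plus noise. -/
lemma measure_sum_sq_contrast_lt_le (c : ℝ) {q δ : ℝ} (hδ0 : 0 < δ)
    (hq : N₁ * (q - δ) ≤ ∑ i, (m.effect c (x (Sum.inl i)) ^ 2 + m.noise M (x (Sum.inl i))))
    (hdδ : (2 * (2 * m.B + |c|) + 1) * ((M + 1) * (m.L * d)) ≤ δ) :
    (Measure.pi fun _ : Fin N₁ ⊕ Fin N₀ => (volume : Measure unitInterval))
        {u | ∑ i, contrast (matchedOutcomes V M c (m.sample x u)) i ^ 2 < (q - 3 * δ) * N₁}
      ≤ ENNReal.ofReal (16 * ((M + 1) * (8 * (m.B + c ^ 4))) / δ ^ 2 / N₁) := by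
  have hN' : (0 : ℝ) < N₁ := by exact_mod_cast hN
  simp only [m.matchedOutcomes_sample V hMN]
  refine le_trans (measure_mono ?_) (((m.indepArray_matched hJ hreg).measure_sum_sq_contrast_le hM c
    (δ := δ * N₁) (by positivity)).trans (le_of_eq (by congr 1; field_simp)))
  intro u hu
  rw [Set.mem_ofPred_eq] at hu ⊢
  have hlow : ∑ i, (m.effect c (x (Sum.inl i)) ^ 2 + m.noise M (x (Sum.inl i))) - N₁ * δ
      ≤ ∑ i, ((∑ j : Fin (M + 1), weight j *
          m.g (unitArm (matchIdx V x (i, j))) (x (matchIdx V x (i, j))) - c) ^ 2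
        + ∑ j : Fin (M + 1), weight j ^ 2 *
          m.s (unitArm (matchIdx V x (i, j))) (x (matchIdx V x (i, j)))) := by
    have e : (N₁ : ℝ) * δ = ∑ _i : Fin N₁, δ := by simp
    rw [e, ← Finset.sum_sub_distrib]
    refine Finset.sum_le_sum fun i _ => ?_
    have h1 := m.abs_mean_sub_effect_le hM hMN hd c i
    have h2 := (abs_le.1 (m.abs_var_sub_noise_le hM hMN hd i)).1
    set a := ∑ j : Fin (M + 1), weight j *
      m.g (unitArm (matchIdx V x (i, j))) (x (matchIdx V x (i, j))) - c
    set f := m.effect c (x (Sum.inl i))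
    have h3 : |f * (a - f)| ≤ (2 * m.B + |c|) * ((M + 1) * (m.L * d)) := by
      rw [abs_mul]
      exact mul_le_mul (m.abs_effect_le c _) h1 (abs_nonneg _)
        ((abs_nonneg _).trans (m.abs_effect_le c (x (Sum.inl i))))
    have h4 := (abs_le.1 h3).1
    nlinarith [sq_nonneg (a - f)]
  rw [abs_sub_comm]
  refine le_trans ?_ (le_abs_self _)
  linarith

omit hd in
lemma measure_lt_sum_pow_four_le (c : ℝ) :
    (Measure.pi fun _ : Fin N₁ ⊕ Fin N₀ => (volume : Measure unitInterval))
        {u | N₁ * √N₁ < ∑ i, ∑ j, matchedOutcomes V M c (m.sample x u) i j ^ 4}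
      ≤ ENNReal.ofReal ((M + 1) * (8 * (m.B + c ^ 4)) / √N₁) := by
  have hN' : (0 : ℝ) < N₁ := by exact_mod_cast hN
  simp only [m.matchedOutcomes_sample V hMN]
  refine le_trans (measure_mono fun u hu => ?_)
    (((m.indepArray_matched hJ hreg).measure_sum_pow_four_le c
      (a := N₁ * √N₁) (by positivity)).trans (le_of_eq (by congr 1; field_simp)))
  exact (Set.mem_ofPred_eq ▸ hu : _ < _).le

end

end OutcomeModel
end Matching

namespace Matching

/-! ### Critical values -/

/-- Two-sided normal quantiles on either side of the one of level `α`. -/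
lemma exists_gaussian_quantiles {α η : ℝ} (hα₀ : 0 < α) (hα₁ : α < 1) (hη : 0 < η) :
    ∃ z z' : ℝ, 0 ≤ z ∧ z < z' ∧ gaussianReal 0 1 {w | |w| ≤ z'} < ENNReal.ofReal (1 - α) ∧
      gaussianReal 0 1 {w | z ≤ |w|} ≤ ENNReal.ofReal (α + η) := by
  set G := gaussianReal 0 1 with hG
  set h : ℝ → ℝ := fun z => ∫ w in -z..z, gaussianPDFReal 0 1 w with hh
  have hint : Integrable (gaussianPDFReal 0 1) := integrable_gaussianPDFReal 0 1
  have hii : ∀ a b, IntervalIntegrable (gaussianPDFReal 0 1) volume a b := fun a b =>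
    hint.intervalIntegrable
  have hcont : Continuous h := by
    have h1 := intervalIntegral.continuous_primitive hii 0
    have e : h = fun z => (∫ w in (0 : ℝ)..z, gaussianPDFReal 0 1 w)
        - ∫ w in (0 : ℝ)..-z, gaussianPDFReal 0 1 w := by
      ext z
      exact (intervalIntegral.integral_interval_sub_left (hii _ _) (hii _ _)).symm
    rw [e]
    exact h1.sub (h1.comp continuous_neg)
  have htop : Tendsto h atTop (𝓝 1) := by
    have := intervalIntegral_tendsto_integral hint tendsto_neg_atTop_atBot tendsto_id
    rwa [integral_gaussianPDFReal_eq_one 0 one_ne_zero] at this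
  have hle : ∀ z, 0 ≤ z → G {w | |w| ≤ z} = ENNReal.ofReal (h z) := fun z hz => by
    have e : {w : ℝ | |w| ≤ z} = Set.Icc (-z) z := by
      ext w
      rw [Set.mem_ofPred_eq, Set.mem_Icc, abs_le]
    rw [e, hG, gaussianReal_apply_eq_integral 0 one_ne_zero, integral_Icc_eq_integral_Ioc,
      ← intervalIntegral.integral_of_le (neg_le_self hz)]
  have h0 : h 0 = 0 := by simp [hh]
  have hIVT : ∀ y : ℝ, 0 ≤ y → y < 1 → ∃ z, 0 ≤ z ∧ h z = y := fun y hy hy1 => by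
    obtain ⟨z₁, hz₁, hz⟩ := ((htop.eventually_const_lt hy1).and (eventually_ge_atTop 0)).exists
    obtain ⟨z, hz', hzy⟩ := intermediate_value_Icc hz hcont.continuousOn
      (show y ∈ Set.Icc (h 0) (h z₁) from ⟨by rw [h0]; exact hy, hz₁.le⟩)
    exact ⟨z, hz'.1, hzy⟩
  have hmono : ∀ z z', 0 ≤ z' → z' ≤ z → h z' ≤ h z := fun z z' hz' hzz => by
    have h1 : G {w | |w| ≤ z'} ≤ G {w | |w| ≤ z} := measure_mono fun w hw => le_trans hw hzz
    rw [hle _ hz', hle _ (hz'.trans hzz)] at h1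
    have h2 : 0 ≤ h z := intervalIntegral.integral_nonneg (by linarith) fun w _ =>
      gaussianPDFReal_nonneg 0 1 w
    exact (ENNReal.ofReal_le_ofReal_iff h2).1 h1
  -- two levels a little below `1 - α`
  set η' := min η (1 - α) with hη'
  have h1 : 0 < η' := lt_min hη (by linarith)
  have h2 : η' ≤ 1 - α := min_le_right _ _
  obtain ⟨z₀, hz₀, hz₀'⟩ := hIVT (1 - α - η') (by linarith) (by linarith)
  obtain ⟨z₂, hz₂, hz₂'⟩ := hIVT (1 - α - η' / 2) (by linarith) (by linarith)
  have hlt : z₀ < z₂ := by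
    by_contra! hcon
    have := hmono z₀ z₂ hz₂ hcon
    linarith
  obtain ⟨z, hzl, hzr⟩ := exists_between hlt
  refine ⟨z, z₂, hz₀.trans hzl.le, hzr, ?_, ?_⟩
  · rw [hle z₂ hz₂, hz₂']
    exact (ENNReal.ofReal_lt_ofReal_iff (by linarith)).2 (by linarith)
  · have hm : MeasurableSet {w : ℝ | |w| ≤ z₀} := measurableSet_le (by fun_prop) measurable_const
    calc G {w | z ≤ |w|} ≤ G {w | |w| ≤ z₀}ᶜ := measure_mono fun w hw =>
          not_le.2 (hzl.trans_le hw)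
      _ = ENNReal.ofReal (α + η') := by
          rw [prob_compl_eq_one_sub hm, hle z₀ hz₀, hz₀', ← ENNReal.ofReal_one,
            ← ENNReal.ofReal_sub _ (by linarith)]
          congr 1
          ring
      _ ≤ ENNReal.ofReal (α + η) := ENNReal.ofReal_le_ofReal (by linarith [min_le_left η (1 - α)])

/-- A rejection forces a large normalized sum of the contrasts, unless the contrasts are
atypically small or the outcomes have atypically large fourth powers. -/
lemma exists_forall_permTestRejects_imp {M : ℕ} (hM : 1 ≤ M) {z z' α q a : ℝ} (hz : 0 ≤ z)
    (hα₀ : 0 < α) (hα₁ : α < 1) (hzz : z < z')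
    (hz' : gaussianReal 0 1 {w | |w| ≤ z'} < ENNReal.ofReal (1 - α)) (hq : 0 < q) (ha : 0 < a)
    (haq : z ^ 2 * q < ((z + z') / 2) ^ 2 * a) :
    ∃ n₀ : ℕ, ∀ (N : ℕ) (S : Fin N → Fin (M + 1) → ℝ), n₀ ≤ N → PermTestRejects α S →
      z ≤ |(∑ i, contrast S i) / (√q * √N)| ∨ ∑ i, contrast S i ^ 2 < a * N ∨
        N * √N < ∑ i, ∑ j, S i j ^ 4 := by
  set z₁ := (z + z') / 2 with hz₁
  obtain ⟨n₁, hn₁⟩ := exists_lt_orderStat_stdStat hM (z := z₁) (z' := z') (by linarith)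
    (by linarith) ha hα₀ hα₁ hz'
  -- beyond `n₂`, the factor `1 + z₁ ^ 2 / N` of the studentization fits into the gap in `haq`
  obtain ⟨n₂, hn₂⟩ := exists_nat_ge (z₁ ^ 2 * (z ^ 2 * q) / (z₁ ^ 2 * a - z ^ 2 * q))
  refine ⟨max (max n₁ n₂) 2, fun N S hN hrej => ?_⟩
  by_contra! hcon
  obtain ⟨h1, h2, h3⟩ := hcon
  have hN2 : 2 ≤ N := (le_max_right _ _).trans hN
  have hN' : (0 : ℝ) < N := by positivity
  have hord := hn₁ N S ((le_max_left _ _).trans ((le_max_left _ _).trans hN)) h2 h3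
  have ht : z₁ / √N < tStat (contrast S) := by
    rw [← stdStat_eq_tStat]
    exact hord.trans hrej
  have h4 := le_sq_sum_of_lt_tStat hN2 (by linarith) ht
  have h5 : (1 + z₁ ^ 2 / N) * (z ^ 2 * q) ≤ z₁ ^ 2 * a := by
    have h6 : (n₂ : ℝ) ≤ N := by
      exact_mod_cast (le_max_right n₁ n₂).trans ((le_max_left _ _).trans hN)
    have h7 := (div_le_iff₀ (sub_pos.2 haq)).1 (hn₂.trans h6)
    rw [add_mul, one_mul, div_mul_eq_mul_div, ← le_sub_iff_add_le', div_le_iff₀ hN']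
    linarith
  have h8 : (∑ i, contrast S i) ^ 2 < z ^ 2 * q * N := by
    have h9 : |∑ i, contrast S i| < z * (√q * √N) := by
      have hs : 0 < √q * √(N : ℝ) := by positivity
      rwa [abs_div, abs_of_pos hs, div_lt_iff₀ hs] at h1
    have h10 := pow_lt_pow_left₀ h9 (abs_nonneg _) two_ne_zero
    rwa [sq_abs, mul_pow, mul_pow, Real.sq_sqrt hq.le, Real.sq_sqrt hN'.le, ← mul_assoc] at h10
  have h11 : z₁ ^ 2 * (a * N) ≤ z₁ ^ 2 * ∑ i, contrast S i ^ 2 := by gcongr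
  have h12 : 0 < 1 + z₁ ^ 2 / N := by positivity
  have h13 := mul_lt_mul_of_pos_left h8 h12
  nlinarith

/-! ### Bounds by conditioning -/

section
variable {α β : Type*} [MeasurableSpace α] [MeasurableSpace β] {μ : Measure α} {ν : Measure β}
  [IsProbabilityMeasure μ] [IsProbabilityMeasure ν]

lemma prod_measure_le_of_forall_mem {A : Set (α × β)} (hA : MeasurableSet A) {H : Set α} {η : ℝ≥0∞}
    (h : ∀ x ∈ H, ν (Prod.mk x ⁻¹' A) ≤ η) : μ.prod ν A ≤ η + μ Hᶜ := by
  rw [Measure.prod_apply hA, ← measure_toMeasurable Hᶜ]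
  calc ∫⁻ x, ν (Prod.mk x ⁻¹' A) ∂μ
      ≤ ∫⁻ x, (η + (toMeasurable μ Hᶜ).indicator 1 x) ∂μ := by
        refine lintegral_mono fun x => ?_
        by_cases hx : x ∈ toMeasurable μ Hᶜ
        · simp only [Set.indicator_of_mem hx, Pi.one_apply]
          exact prob_le_one.trans le_add_self
        · have : x ∈ H := by
            by_contra hc
            exact hx (subset_toMeasurable μ Hᶜ hc)
          exact (h x this).trans le_self_add
    _ = η + μ (toMeasurable μ Hᶜ) := by
        rw [lintegral_add_left measurable_const, lintegral_indicator_one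
          (measurableSet_toMeasurable μ _)]
        simp

omit [MeasurableSpace β] in
lemma norm_integral_le_of_forall_mem {F : α → ℂ} (hF : ∀ x, ‖F x‖ ≤ 2) {H : Set α} {η : ℝ}
    (hη : 0 ≤ η) (h : ∀ x ∈ H, ‖F x‖ ≤ η) : ‖∫ x, F x ∂μ‖ ≤ η + 2 * μ.real Hᶜ := by
  have hm := measurableSet_toMeasurable μ Hᶜ
  have hi : Integrable (fun x => η + (toMeasurable μ Hᶜ).indicator (fun _ => (2 : ℝ)) x) μ :=
    (integrable_const _).add ((integrable_const _).indicator hm)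
  refine (norm_integral_le_of_norm_le hi (.of_forall fun x => ?_)).trans (le_of_eq ?_)
  · by_cases hx : x ∈ toMeasurable μ Hᶜ
    · rw [Set.indicator_of_mem hx]
      linarith [hF x]
    · have : x ∈ H := by
        by_contra hc
        exact hx (subset_toMeasurable μ Hᶜ hc)
      rw [Set.indicator_of_notMem hx, add_zero]
      exact h x this
  · rw [integral_add (integrable_const _) ((integrable_const _).indicator hm),
      integral_indicator_const _ hm, measureReal_def, measure_toMeasurable, ← measureReal_def]
    simp [mul_comm]

end

end Matching

namespace Matching

/-! ### Asymptotics under vanishing matching discrepancies -/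

lemma measurable_contrast_matchedOutcomes {k N₁ N₀ : ℕ} (V : Matrix (Fin k) (Fin k) ℝ) (M : ℕ)
    (c : ℝ) (i : Fin N₁) :
    Measurable fun z : Fin N₁ ⊕ Fin N₀ → ℝ × Cov k => contrast (matchedOutcomes V M c z) i :=
  (measurable_matchedOutcomes V M c i 0).sub
    ((Finset.measurable_fun_sum _ fun j _ => measurable_matchedOutcomes V M c i j.succ).const_mul _)

lemma integrable_exp_ofReal_mul_I {α : Type*} [MeasurableSpace α] {μ : Measure α}
    [IsProbabilityMeasure μ] {f : α → ℝ} (hf : Measurable f) :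
    Integrable (fun x => Complex.exp ((f x : ℂ) * Complex.I)) μ :=
  Integrable.of_bound (C := 1) (by fun_prop) (.of_forall fun x =>
    (Complex.norm_exp_ofReal_mul_I (f x)).le)

namespace OutcomeModel

variable {k : ℕ} (m : OutcomeModel k)

/-- The law of the covariates and of the uniform variables that generate the outcomes. -/
noncomputable def sampleLaw (N₁ N₀ : ℕ) :
    Measure ((Fin N₁ ⊕ Fin N₀ → Cov k) × (Fin N₁ ⊕ Fin N₀ → unitInterval)) :=
  (covLaw m.ν N₁ N₀).prod (Measure.pi fun _ => volume)

instance (N₁ N₀ : ℕ) : IsProbabilityMeasure (m.sampleLaw N₁ N₀) := by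
  unfold sampleLaw
  infer_instance

/-- The asymptotic variance of the normalized sum of the contrasts. -/
noncomputable def asympVar (M : ℕ) (c : ℝ) : ℝ :=
  ∫ x, (m.effect c x ^ 2 + m.noise M x) ∂m.ν 1

/-- On covariate configurations `G n` of probability tending to one, no unit is used twice and the
matching discrepancies are at most `d n`, which is negligible against `N₁ ^ (-1/2)`. -/
structure VanishingDiscrepancy (V : Matrix (Fin k) (Fin k) ℝ) (M : ℕ) (N₁ N₀ : ℕ → ℕ) (d : ℕ → ℝ)
    (G : ∀ n, Set (Fin (N₁ n) ⊕ Fin (N₀ n) → Cov k)) : Prop where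
  tendsto_treated : Tendsto N₁ atTop atTop
  le_controls : ∀ᶠ n in atTop, M ≤ N₀ n
  nonneg : ∀ᶠ n in atTop, 0 ≤ d n
  tendsto_zero : Tendsto d atTop (𝓝 0)
  tendsto_sqrt_mul : Tendsto (fun n => √(N₁ n) * d n) atTop (𝓝 0)
  tendsto_compl : Tendsto (fun n => (covLaw m.ν (N₁ n) (N₀ n)).real (G n)ᶜ) atTop (𝓝 0)
  injective : ∀ᶠ n in atTop, ∀ x ∈ G n, Function.Injective (matchIdx V (M := M) x)
  norm_sub_le : ∀ᶠ n in atTop, ∀ x ∈ G n, ∀ (i : Fin (N₁ n)) (j : Fin (M + 1)),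
    ‖x (Sum.inl i) - x (matchIdx V x (i, j))‖ ≤ d n

/-- The configurations in `G` at which the averages that determine the asymptotic variance are
within `δ` of their means. -/
def typical (M : ℕ) (c δ : ℝ) {N₁ N₀ : ℕ} (G : Set (Fin N₁ ⊕ Fin N₀ → Cov k)) :
    Set (Fin N₁ ⊕ Fin N₀ → Cov k) :=
  {x | x ∈ G ∧ (∀ e, m.Regular (unitArm e) (x e)) ∧
    |∑ i : Fin N₁, m.noise M (x (Sum.inl i)) - N₁ * ∫ y, m.noise M y ∂m.ν 1| < δ * N₁ ∧
    |∑ i : Fin N₁, (m.effect c (x (Sum.inl i)) ^ 2 + m.noise M (x (Sum.inl i)))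
      - N₁ * m.asympVar M c| < δ * N₁}

lemma abs_noise_le {M : ℕ} (hM : 1 ≤ M) (x : Cov k) : |m.noise M x| ≤ 2 * m.B := by
  rw [abs_of_nonneg (m.b_pos.le.trans (m.le_noise M x))]
  exact m.noise_le hM x

lemma effect_sq_le (c : ℝ) (x : Cov k) : m.effect c x ^ 2 ≤ (2 * m.B + |c|) ^ 2 :=
  sq_le_sq' (abs_le.1 (m.abs_effect_le c x)).1 (abs_le.1 (m.abs_effect_le c x)).2

lemma integrable_noise {M : ℕ} (hM : 1 ≤ M) : Integrable (m.noise M) (m.ν 1) :=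
  Integrable.of_bound (m.measurable_noise M).aestronglyMeasurable (2 * m.B)
    (.of_forall (m.abs_noise_le hM))

lemma integrable_effect_sq (c : ℝ) : Integrable (fun x => m.effect c x ^ 2) (m.ν 1) :=
  Integrable.of_bound ((m.measurable_effect c).pow_const 2).aestronglyMeasurable
    ((2 * m.B + |c|) ^ 2) (.of_forall fun x => by
      rw [Real.norm_eq_abs, abs_of_nonneg (sq_nonneg _)]
      exact m.effect_sq_le c x)

lemma asympVar_eq {M : ℕ} (hM : 1 ≤ M) (c : ℝ) :
    m.asympVar M c = ∫ x, m.effect c x ^ 2 ∂m.ν 1 + ∫ x, m.noise M x ∂m.ν 1 :=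
  integral_add (m.integrable_effect_sq c) (m.integrable_noise hM)

lemma asympVar_pos {M : ℕ} (hM : 1 ≤ M) (c : ℝ) : 0 < m.asympVar M c := by
  have h : m.b ≤ ∫ x, m.noise M x ∂m.ν 1 := by
    have := integral_mono (integrable_const m.b) (m.integrable_noise hM) fun x => m.le_noise M x
    simpa using this
  rw [m.asympVar_eq hM]
  have h2 : 0 ≤ ∫ x, m.effect c x ^ 2 ∂m.ν 1 := integral_nonneg fun _ => sq_nonneg _
  linarith [m.b_pos]

variable {m} {V : Matrix (Fin k) (Fin k) ℝ} {M : ℕ} {N₁ N₀ : ℕ → ℕ} {d : ℕ → ℝ}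
  {G : ∀ n, Set (Fin (N₁ n) ⊕ Fin (N₀ n) → Cov k)}

namespace VanishingDiscrepancy

lemma tendsto_cast (h : m.VanishingDiscrepancy V M N₁ N₀ d G) :
    Tendsto (fun n => (N₁ n : ℝ)) atTop atTop :=
  tendsto_natCast_atTop_atTop.comp h.tendsto_treated

lemma tendsto_const_div (h : m.VanishingDiscrepancy V M N₁ N₀ d G) (C : ℝ) :
    Tendsto (fun n => C / (N₁ n : ℝ)) atTop (𝓝 0) :=
  tendsto_const_nhds.div_atTop h.tendsto_cast

lemma tendsto_typical_compl (h : m.VanishingDiscrepancy V M N₁ N₀ d G) (hM : 1 ≤ M) (c : ℝ)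
    {δ : ℝ} (hδ : 0 < δ) :
    Tendsto (fun n => (covLaw m.ν (N₁ n) (N₀ n)).real (m.typical M c δ (G n))ᶜ) atTop (𝓝 0) := by
  have hlim := (h.tendsto_compl.add ((h.tendsto_const_div ((2 * m.B) ^ 2 / δ ^ 2)).add
    (h.tendsto_const_div (((2 * m.B + |c|) ^ 2 + 2 * m.B) ^ 2 / δ ^ 2))))
  rw [add_zero, add_zero] at hlim
  refine squeeze_zero' (.of_forall fun n => measureReal_nonneg) ?_ hlim
  filter_upwards [h.tendsto_treated.eventually_gt_atTop 0] with n hn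
  set P := covLaw m.ν (N₁ n) (N₀ n)
  have hb1 := covLaw_sum_sub_ge_le (ν := m.ν) (N₀ := N₀ n) (m.measurable_noise M)
    (m.abs_noise_le hM) hδ hn
  have hb2 := covLaw_sum_sub_ge_le (ν := m.ν) (N₀ := N₀ n)
    (f := fun x => m.effect c x ^ 2 + m.noise M x)
    (((m.measurable_effect c).pow_const 2).add (m.measurable_noise M))
    (B := (2 * m.B + |c|) ^ 2 + 2 * m.B) (fun x => by
      refine (abs_add_le _ _).trans (add_le_add ?_ (m.abs_noise_le hM x))
      rw [abs_of_nonneg (sq_nonneg _)]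
      exact m.effect_sq_le c x) hδ hn
  have hreg : P.real {x | ∀ e, m.Regular (unitArm e) (x e)}ᶜ = 0 := by
    rw [measureReal_def, show P {x | ∀ e, m.Regular (unitArm e) (x e)}ᶜ = 0 from
      m.ae_regular (N₁ n) (N₀ n), ENNReal.toReal_zero]
  have hsub : (m.typical M c δ (G n))ᶜ ⊆ ((G n)ᶜ ∪ {x | ∀ e, m.Regular (unitArm e) (x e)}ᶜ) ∪
      ({x | δ * N₁ n ≤ |∑ i : Fin (N₁ n), m.noise M (x (Sum.inl i))
        - N₁ n * ∫ y, m.noise M y ∂m.ν 1|} ∪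
       {x | δ * N₁ n ≤ |∑ i : Fin (N₁ n), (m.effect c (x (Sum.inl i)) ^ 2
        + m.noise M (x (Sum.inl i))) - N₁ n * ∫ y, (m.effect c y ^ 2 + m.noise M y) ∂m.ν 1|}) := by
    intro x hx
    by_contra hcon
    simp only [Set.mem_union, Set.mem_compl_iff, Set.mem_ofPred_eq, not_or, not_not, not_le] at hcon
    exact hx ⟨hcon.1.1, hcon.1.2, hcon.2.1, hcon.2.2⟩
  refine (measureReal_mono hsub (measure_ne_top _ _)).trans ((measureReal_union_le _ _).trans
    (add_le_add ((measureReal_union_le _ _).trans (by rw [hreg, add_zero]))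
    ((measureReal_union_le _ _).trans (add_le_add ?_ ?_))))
  · rw [div_div]
    exact hb1
  · rw [div_div]
    exact hb2

lemma tendsto_sampleLaw (h : m.VanishingDiscrepancy V M N₁ N₀ d G) (hM : 1 ≤ M) (c : ℝ)
    {δ : ℝ} (hδ : 0 < δ)
    {A : ∀ n, Set ((Fin (N₁ n) ⊕ Fin (N₀ n) → Cov k) × (Fin (N₁ n) ⊕ Fin (N₀ n) → unitInterval))}
    (hA : ∀ n, MeasurableSet (A n)) {η : ℕ → ℝ} (hη : Tendsto η atTop (𝓝 0))
    (hAη : ∀ᶠ n in atTop, ∀ x ∈ m.typical M c δ (G n),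
      (Measure.pi fun _ => (volume : Measure unitInterval)) (Prod.mk x ⁻¹' A n)
        ≤ ENNReal.ofReal (η n)) :
    Tendsto (fun n => m.sampleLaw (N₁ n) (N₀ n) (A n)) atTop (𝓝 0) := by
  have hlim := (ENNReal.tendsto_ofReal hη).add
    (ENNReal.tendsto_ofReal (h.tendsto_typical_compl hM c hδ))
  rw [ENNReal.ofReal_zero, add_zero] at hlim
  refine tendsto_of_tendsto_of_tendsto_of_le_of_le' tendsto_const_nhds hlim
    (.of_forall fun n => zero_le) ?_
  filter_upwards [hAη] with n hn
  rw [ofReal_measureReal]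
  exact prod_measure_le_of_forall_mem (hA n) hn

variable (V M) in
lemma measurable_contrast_sample (m : OutcomeModel k) (N₁ N₀ : ℕ) (c : ℝ) (i : Fin N₁) :
    Measurable fun p : (Fin N₁ ⊕ Fin N₀ → Cov k) × (Fin N₁ ⊕ Fin N₀ → unitInterval) =>
      contrast (matchedOutcomes V M c (m.sample p.1 p.2)) i :=
  (measurable_contrast_matchedOutcomes V M c i).comp (m.measurable_sample N₁ N₀)

/-- The mean square of the contrasts is not much smaller than the asymptotic variance. -/
lemma tendsto_sum_sq_contrast_lt (h : m.VanishingDiscrepancy V M N₁ N₀ d G) (hM : 1 ≤ M) (c : ℝ)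
    {δ : ℝ} (hδ : 0 < δ) :
    Tendsto (fun n => m.sampleLaw (N₁ n) (N₀ n) {p |
      ∑ i, contrast (matchedOutcomes V M c (m.sample p.1 p.2)) i ^ 2
        < (m.asympVar M c - 3 * δ) * N₁ n}) atTop (𝓝 0) := by
  refine h.tendsto_sampleLaw hM c hδ (fun n => measurableSet_lt (Finset.measurable_fun_sum _
    fun i _ => (measurable_contrast_sample V M m _ _ c i).pow_const 2) measurable_const)
    (h.tendsto_const_div (16 * ((M + 1) * (8 * (m.B + c ^ 4))) / δ ^ 2)) ?_
  have hd : Tendsto (fun n => (2 * (2 * m.B + |c|) + 1) * ((M + 1) * (m.L * d n))) atTop (𝓝 0) := by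
    have := ((h.tendsto_zero.const_mul (m.L : ℝ)).const_mul ((M : ℝ) + 1)).const_mul
      (2 * (2 * m.B + |c|) + 1)
    simpa using this
  filter_upwards [h.injective, h.norm_sub_le, h.le_controls,
    h.tendsto_treated.eventually_gt_atTop 0, hd.eventually_le_const hδ] with n hJ hd' hMN hN hdδ
    x hx
  refine m.measure_sum_sq_contrast_lt_le hM hMN hN (hJ x hx.1) hx.2.1 (hd' x hx.1) c hδ ?_ hdδ
  have := (abs_lt.1 hx.2.2.2).1
  linarith

lemma tendsto_lt_sum_pow_four (h : m.VanishingDiscrepancy V M N₁ N₀ d G) (hM : 1 ≤ M) (c : ℝ) :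
    Tendsto (fun n => m.sampleLaw (N₁ n) (N₀ n) {p |
      N₁ n * √(N₁ n) < ∑ i, ∑ j, matchedOutcomes V M c (m.sample p.1 p.2) i j ^ 4})
      atTop (𝓝 0) := by
  refine h.tendsto_sampleLaw hM c one_pos (fun n => measurableSet_lt measurable_const
    (Finset.measurable_fun_sum _ fun i _ => Finset.measurable_fun_sum _ fun j _ =>
      ((measurable_matchedOutcomes V M c i j).comp (m.measurable_sample _ _)).pow_const 4))
    (η := fun n => (M + 1) * (8 * (m.B + c ^ 4)) / √(N₁ n))
    (tendsto_const_nhds.div_atTop (Real.tendsto_sqrt_atTop.comp h.tendsto_cast)) ?_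
  filter_upwards [h.injective, h.le_controls, h.tendsto_treated.eventually_gt_atTop 0]
    with n hJ hMN hN x hx
  exact m.measure_lt_sum_pow_four_le hM hMN hN (hJ x hx.1) hx.2.1 c

/-- The characteristic function of the normalized sum of the contrasts is asymptotically the product
of that of the normalized sum of the effects and that of a centred normal law. -/
lemma tendsto_integral_exp_sub (h : m.VanishingDiscrepancy V M N₁ N₀ d G) (hM : 1 ≤ M) (c : ℝ)
    {t : ℝ} (ht : t ≠ 0) :
    Tendsto (fun n => ∫ p, Complex.exp ((t / √(N₁ n) * ∑ i, contrast
          (matchedOutcomes V M c (m.sample p.1 p.2)) i : ℝ) * Complex.I) ∂m.sampleLaw (N₁ n) (N₀ n)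
        - (∫ x, Complex.exp ((t / √(N₁ n) * ∑ i : Fin (N₁ n), m.effect c (x (Sum.inl i)) : ℝ)
          * Complex.I) ∂covLaw m.ν (N₁ n) (N₀ n))
          * Complex.exp (-(t ^ 2 * ∫ y, m.noise M y ∂m.ν 1 : ℝ) / 2)) atTop (𝓝 0) := by
  set σ := ∫ y, m.noise M y ∂m.ν 1 with hσ
  have hσ0 : 0 ≤ σ := integral_nonneg fun x => m.b_pos.le.trans (m.le_noise M x)
  -- the error bound for configurations that are typical up to `δ`, and its limit
  set η : ℝ → ℕ → ℝ := fun δ n =>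
    2 * √(16 * t ^ 4 * (M + 1) * m.B / N₁ n) * (t ^ 2 * (M + 1) * (1 + 16 * m.B) + 1)
      + 16 * t ^ 4 * (M + 1) * m.B / N₁ n
      + (|t| * ((M + 1) * m.L * (√(N₁ n) * d n)) + t ^ 2 * ((M + 1) * m.L * d n + δ) / 2) with hη
  have hηlim : ∀ δ, Tendsto (η δ) atTop (𝓝 (t ^ 2 * δ / 2)) := fun δ => by
    have h1 := h.tendsto_const_div (16 * t ^ 4 * (M + 1) * m.B)
    have h2 := ((h1.sqrt.const_mul 2).mul_const (t ^ 2 * (M + 1) * (1 + 16 * m.B) + 1)).add h1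
    have h3 := ((h.tendsto_sqrt_mul.const_mul (((M : ℝ) + 1) * m.L)).const_mul |t|)
    have h4 := (((h.tendsto_zero.const_mul (((M : ℝ) + 1) * m.L)).add_const δ).const_mul
      (t ^ 2)).div_const 2
    have h5 := h2.add (h3.add h4)
    simp only [Real.sqrt_zero, mul_zero, zero_mul, zero_add] at h5
    exact h5
  rw [tendsto_zero_iff_norm_tendsto_zero]
  refine tendsto_order.2 ⟨fun a ha => .of_forall fun n => ha.trans_le (norm_nonneg _),
    fun ε hε => ?_⟩
  set δ := ε / (t ^ 2 + 1) with hδ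
  have hδ0 : 0 < δ := by positivity
  have hδε : t ^ 2 * δ / 2 + 2 * 0 < ε := by
    rw [hδ, mul_zero, add_zero, mul_div_assoc', div_div, div_lt_iff₀ (by positivity)]
    nlinarith [sq_nonneg t]
  have hbound := (hηlim δ).add ((h.tendsto_typical_compl hM c hδ0).const_mul 2)
  filter_upwards [h.injective, h.norm_sub_le, h.le_controls,
    h.tendsto_treated.eventually_gt_atTop 0, hbound.eventually_lt_const hδε,
    h.nonneg] with n hJ hd' hMN hN hlt hd0
  refine lt_of_le_of_lt ?_ hlt
  have hcm : Measurable fun p : (Fin (N₁ n) ⊕ Fin (N₀ n) → Cov k) ×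
      (Fin (N₁ n) ⊕ Fin (N₀ n) → unitInterval) => t / √(N₁ n) * ∑ i, contrast
        (matchedOutcomes V M c (m.sample p.1 p.2)) i :=
    (Finset.measurable_fun_sum _ fun i _ =>
      measurable_contrast_sample V M m (N₁ n) (N₀ n) c i).const_mul _
  have hem : Measurable fun x : Fin (N₁ n) ⊕ Fin (N₀ n) → Cov k =>
      t / √(N₁ n) * ∑ i : Fin (N₁ n), m.effect c (x (Sum.inl i)) :=
    (Finset.measurable_fun_sum _ fun i _ =>
      (m.measurable_effect c).comp (measurable_pi_apply (Sum.inl i))).const_mul _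
  have hi := integrable_exp_ofReal_mul_I (μ := m.sampleLaw (N₁ n) (N₀ n)) hcm
  have hi' := (integrable_exp_ofReal_mul_I (μ := covLaw m.ν (N₁ n) (N₀ n)) hem).mul_const
    (Complex.exp (-(t ^ 2 * σ : ℝ) / 2))
  have hK : ‖Complex.exp (-(t ^ 2 * σ : ℝ) / 2)‖ ≤ 1 := by
    rw [Complex.norm_exp]
    refine Real.exp_le_one_iff.2 ?_
    have : (-((t ^ 2 * σ : ℝ) : ℂ) / 2).re = -(t ^ 2 * σ) / 2 := by
      rw [show (-((t ^ 2 * σ : ℝ) : ℂ) / 2) = ((-(t ^ 2 * σ) / 2 : ℝ) : ℂ) by push_cast; rfl,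
        Complex.ofReal_re]
    rw [this]
    have : 0 ≤ t ^ 2 * σ := by positivity
    linarith
  rw [← integral_mul_const, sampleLaw, integral_prod _ hi, ← integral_sub hi.integral_prod_left hi']
  refine norm_integral_le_of_forall_mem (fun x => ?_) (H := m.typical M c δ (G n)) (η := η δ n) ?_
    fun x hx => m.norm_integral_exp_contrast_sub_le hM hMN hN (hJ x hx.1) hx.2.1 (hd' x hx.1) c ht
      hσ0 hx.2.2.1.le
  · refine (_root_.norm_sub_le _ _).trans ?_
    have h1 : ‖∫ u, Complex.exp ((t / √(N₁ n) * ∑ i, contrast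
        (matchedOutcomes V M c (m.sample x u)) i : ℝ) * Complex.I)
        ∂(Measure.pi fun _ => (volume : Measure unitInterval))‖ ≤ 1 :=
      (norm_integral_le_of_norm_le_const (.of_forall fun u =>
        (Complex.norm_exp_ofReal_mul_I _).le)).trans (by simp)
    have h2 : ‖Complex.exp ((t / √(N₁ n) * ∑ i : Fin (N₁ n), m.effect c (x (Sum.inl i)) : ℝ)
        * Complex.I) * Complex.exp (-(t ^ 2 * σ : ℝ) / 2)‖ ≤ 1 := by
      rw [norm_mul, Complex.norm_exp_ofReal_mul_I, one_mul]
      exact hK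
    linarith
  · have := m.B_pos
    positivity

/-- The normalized sum of the contrasts is asymptotically standard normal. -/
lemma tendsto_charFun (h : m.VanishingDiscrepancy V M N₁ N₀ d G) (hM : 1 ≤ M) {c : ℝ}
    (hc : ∫ x, m.effect c x ∂m.ν 1 = 0) (t : ℝ) :
    Tendsto (fun n => charFun ((m.sampleLaw (N₁ n) (N₀ n)).map fun p =>
      (∑ i, contrast (matchedOutcomes V M c (m.sample p.1 p.2)) i)
        / (√(m.asympVar M c) * √(N₁ n))) t) atTop (𝓝 (Complex.exp (-(t : ℂ) ^ 2 / 2))) := by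
  have hm : ∀ n, Measurable fun p : (Fin (N₁ n) ⊕ Fin (N₀ n) → Cov k) ×
      (Fin (N₁ n) ⊕ Fin (N₀ n) → unitInterval) =>
      (∑ i, contrast (matchedOutcomes V M c (m.sample p.1 p.2)) i)
        / (√(m.asympVar M c) * √(N₁ n)) := fun n =>
    (Finset.measurable_fun_sum _ fun i _ =>
      measurable_contrast_sample V M m (N₁ n) (N₀ n) c i).div_const _
  rcases eq_or_ne t 0 with rfl | ht
  · have : ∀ n, IsProbabilityMeasure ((m.sampleLaw (N₁ n) (N₀ n)).map fun p =>
        (∑ i, contrast (matchedOutcomes V M c (m.sample p.1 p.2)) i)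
        / (√(m.asympVar M c) * √(N₁ n))) := fun n =>
      Measure.isProbabilityMeasure_map (hm n).aemeasurable
    simp
  have hq := m.asympVar_pos hM c
  have hs : 0 < √(m.asympVar M c) := Real.sqrt_pos.2 hq
  set τ := t / √(m.asympVar M c) with hτ
  have hτ0 : τ ≠ 0 := div_ne_zero ht hs.ne'
  have hτ2 : τ ^ 2 * m.asympVar M c = t ^ 2 := by
    rw [hτ, div_pow, Real.sq_sqrt hq.le]
    field_simp
  have hB : 0 < 2 * m.B + |c| := by linarith [m.B_pos, abs_nonneg c]
  have h1 := h.tendsto_integral_exp_sub hM c hτ0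
  have h2 : Tendsto (fun n => ∫ x, Complex.exp ((τ / √(N₁ n) * ∑ i : Fin (N₁ n),
      m.effect c (x (Sum.inl i)) : ℝ) * Complex.I) ∂covLaw m.ν (N₁ n) (N₀ n)) atTop
      (𝓝 (Complex.exp (-(τ ^ 2 * ∫ y, m.effect c y ^ 2 ∂m.ν 1 : ℝ) / 2))) := by
    rw [tendsto_iff_norm_sub_tendsto_zero]
    have h3 := h.tendsto_const_div (τ ^ 4 * (2 * m.B + |c|) ^ 4)
    have h4 := (((h3.sqrt.const_mul 2).mul_const (τ ^ 2 * ∫ y, m.effect c y ^ 2 ∂m.ν 1)).add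
      (h3.sqrt.const_mul 2)).add h3
    simp only [Real.sqrt_zero, mul_zero, zero_mul, add_zero] at h4
    refine squeeze_zero' (.of_forall fun n => norm_nonneg _) ?_ h4
    filter_upwards [h.tendsto_treated.eventually_gt_atTop 0] with n hn
    exact covLaw_norm_integral_exp_sub_le (m.measurable_effect c) hB (m.abs_effect_le c) hc hτ0 hn
  have h5 := h1.add (h2.mul_const (Complex.exp (-(τ ^ 2 * ∫ y, m.noise M y ∂m.ν 1 : ℝ) / 2)))
  simp only [sub_add_cancel, zero_add] at h5
  have e : Complex.exp (-(τ ^ 2 * ∫ y, m.effect c y ^ 2 ∂m.ν 1 : ℝ) / 2)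
      * Complex.exp (-(τ ^ 2 * ∫ y, m.noise M y ∂m.ν 1 : ℝ) / 2)
      = Complex.exp (-(t : ℂ) ^ 2 / 2) := by
    rw [← Complex.exp_add, ← Complex.ofReal_pow, ← hτ2, m.asympVar_eq hM]
    congr 1
    push_cast
    ring
  rw [e] at h5
  refine h5.congr fun n => ?_
  rw [charFun_apply_real, integral_map (hm n).aemeasurable (by fun_prop)]
  refine integral_congr_ae (.of_forall fun p => ?_)
  simp only
  rw [← Complex.ofReal_mul]
  congr 3
  rw [hτ]
  simp only [div_eq_mul_inv, mul_inv]
  ring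


end VanishingDiscrepancy

end OutcomeModel
end Matching

namespace Matching

/-! ### Asymptotic validity -/

namespace OutcomeModel

variable {k : ℕ} {m : OutcomeModel k} {V : Matrix (Fin k) (Fin k) ℝ} {M : ℕ} {N₁ N₀ : ℕ → ℕ}

/-- Rejections are covered by a measurable event whose probability is asymptotically at most
`α`. -/
lemma VanishingDiscrepancy.exists_cover {d : ℕ → ℝ}
    {G : ∀ n, Set (Fin (N₁ n) ⊕ Fin (N₀ n) → Cov k)}
    (h : m.VanishingDiscrepancy V M N₁ N₀ d G) (hM : 1 ≤ M) {c : ℝ}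
    (hc : ∫ x, m.effect c x ∂m.ν 1 = 0) {α η : ℝ} (hα₀ : 0 < α) (hα₁ : α < 1) (hη : 0 < η) :
    ∃ A : ∀ n, Set (Fin (N₁ n) ⊕ Fin (N₀ n) → ℝ × Cov k), (∀ n, MeasurableSet (A n)) ∧
      (∀ᶠ n in atTop, ∀ z, PermTestRejects α (matchedOutcomes V M c z) → z ∈ A n) ∧
      ∀ᶠ n in atTop, m.sampleLaw (N₁ n) (N₀ n) {p | m.sample p.1 p.2 ∈ A n}
        ≤ ENNReal.ofReal (α + η) := by
  obtain ⟨z, z', hz, hzz, hz', hzα⟩ := exists_gaussian_quantiles hα₀ hα₁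
    (show 0 < η / 4 by positivity)
  set q := m.asympVar M c with hq
  have hq0 : 0 < q := m.asympVar_pos hM c
  set z₁ := (z + z') / 2 with hz₁
  have hz₁z : z < z₁ := by linarith
  have hz₁0 : 0 < z₁ := by linarith
  have hsq : z ^ 2 < z₁ ^ 2 := by gcongr
  -- small enough for `z ^ 2 * q < z₁ ^ 2 * (q - 3 * δ)`
  set δ := q * (z₁ ^ 2 - z ^ 2) / (6 * z₁ ^ 2) with hδ
  have hδ0 : 0 < δ := div_pos (mul_pos hq0 (sub_pos.2 hsq)) (by positivity)
  have hδe : z₁ ^ 2 * (3 * δ) = q * (z₁ ^ 2 - z ^ 2) / 2 := by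
    rw [hδ]
    field_simp
    ring
  have haq : z ^ 2 * q < z₁ ^ 2 * (q - 3 * δ) := by
    rw [mul_sub, hδe]
    nlinarith [mul_pos hq0 (sub_pos.2 hsq)]
  have ha : 0 < q - 3 * δ := by
    have : 0 < z₁ ^ 2 * (q - 3 * δ) := lt_of_le_of_lt (by positivity) haq
    exact (pos_iff_pos_of_mul_pos this).1 (by positivity)
  obtain ⟨n₀, hn₀⟩ := exists_forall_permTestRejects_imp hM hz hα₀ hα₁ hzz hz' hq0 ha haq
  have hstat : ∀ n, Measurable fun y : Fin (N₁ n) ⊕ Fin (N₀ n) → ℝ × Cov k =>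
      (∑ i, contrast (matchedOutcomes V M c y) i) / (√q * √(N₁ n)) := fun n =>
    (Finset.measurable_fun_sum _ fun i _ =>
      measurable_contrast_matchedOutcomes V M c i).div_const _
  have hF : IsClosed {w : ℝ | z ≤ |w|} := isClosed_le continuous_const continuous_abs
  refine ⟨fun n => {y | z ≤ |(∑ i, contrast (matchedOutcomes V M c y) i) / (√q * √(N₁ n))|} ∪
      ({y | ∑ i, contrast (matchedOutcomes V M c y) i ^ 2 < (q - 3 * δ) * N₁ n} ∪
       {y | N₁ n * √(N₁ n) < ∑ i, ∑ j, matchedOutcomes V M c y i j ^ 4}),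
    fun n => ?_, ?_, ?_⟩
  · refine (hstat n hF.measurableSet).union (MeasurableSet.union ?_ ?_)
    · exact measurableSet_lt (Finset.measurable_fun_sum _ fun i _ =>
        (measurable_contrast_matchedOutcomes V M c i).pow_const 2) measurable_const
    · exact measurableSet_lt measurable_const (Finset.measurable_fun_sum _ fun i _ =>
        Finset.measurable_fun_sum _ fun j _ => (measurable_matchedOutcomes V M c i j).pow_const 4)
  · filter_upwards [h.tendsto_treated.eventually_ge_atTop n₀] with n hn y hy
    exact hn₀ _ _ hn hy
  · have hsm : ∀ n, Measurable fun p : (Fin (N₁ n) ⊕ Fin (N₀ n) → Cov k) ×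
        (Fin (N₁ n) ⊕ Fin (N₀ n) → unitInterval) =>
        (∑ i, contrast (matchedOutcomes V M c (m.sample p.1 p.2)) i) / (√q * √(N₁ n)) := fun n =>
      (hstat n).comp (m.measurable_sample (N₁ n) (N₀ n))
    have hpr : ∀ n, IsProbabilityMeasure ((m.sampleLaw (N₁ n) (N₀ n)).map fun p =>
        (∑ i, contrast (matchedOutcomes V M c (m.sample p.1 p.2)) i) / (√q * √(N₁ n))) := fun n =>
      Measure.isProbabilityMeasure_map (hsm n).aemeasurable
    have h1 := eventually_measure_le_of_tendsto_charFun _ (h.tendsto_charFun hM hc) hF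
      (ε := ENNReal.ofReal (η / 4)) (by simpa using hη)
    have hη4 : (0 : ℝ≥0∞) < ENNReal.ofReal (η / 4) := by simpa using hη
    have h2 := (h.tendsto_sum_sq_contrast_lt hM c hδ0).eventually_le_const hη4
    have h3 := (h.tendsto_lt_sum_pow_four hM c).eventually_le_const hη4
    filter_upwards [h1, h2, h3] with n h1 h2 h3
    rw [Measure.map_apply (hsm n) hF.measurableSet] at h1
    refine (measure_union_le _ _).trans ((add_le_add h1 ((measure_union_le _ _).trans
      (add_le_add h2 h3))).trans ((add_le_add_left (add_le_add_left hzα _) _).trans ?_))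
    rw [← ENNReal.ofReal_add (by positivity) (by positivity),
      ← ENNReal.ofReal_add (by positivity) (by positivity),
      ← ENNReal.ofReal_add (by positivity) (by positivity)]
    exact ENNReal.ofReal_le_ofReal (by linarith)

/-- The outcomes generated from uniform variables have the law of a pooled sample. -/
lemma measurePreserving_sample {Λ : Fin 2 → Measure (ℝ × Cov k)} [∀ w, IsProbabilityMeasure (Λ w)]
    (hΛ : ∀ w, Λ w = ((m.ν w).prod volume).map fun p => (m.h w p.1 p.2, p.1)) (N₁ N₀ : ℕ) :
    MeasurePreserving (fun p => m.sample p.1 p.2) (m.sampleLaw N₁ N₀)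
      (Measure.pi fun e : Fin N₁ ⊕ Fin N₀ => Λ (unitArm e)) := by
  have h1 := (measurePreserving_arrowProdEquivProdArrow (Cov k) unitInterval (Fin N₁ ⊕ Fin N₀)
    (fun e => m.ν (unitArm e)) fun _ => volume).symm
  have h2 := measurePreserving_pi (fun e : Fin N₁ ⊕ Fin N₀ => (m.ν (unitArm e)).prod volume)
    (fun e => Λ (unitArm e)) (f := fun e p => (m.h (unitArm e) p.1 p.2, p.1)) fun e =>
      ⟨(m.measurable_h _).prodMk measurable_fst, (hΛ _).symm⟩
  exact h2.comp h1

end OutcomeModel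

namespace Population

variable {k : ℕ} {Ω : Type*} [MeasurableSpace Ω] (pop : Population k Ω)

lemma IsPooledSample.map_eq {N₁ N₀ : ℕ} {S : Type*} [MeasurableSpace S] {Q : Measure S}
    [IsProbabilityMeasure Q] {Z : Fin N₁ ⊕ Fin N₀ → S → ℝ × Cov k}
    (hZ : pop.IsPooledSample Q Z) :
    (∀ e, AEMeasurable (Z e) Q) ∧
      Q.map (fun s e => Z e s) = Measure.pi fun e => pop.lawYX (unitArm e) := by
  have hlaw : ∀ e, HasLaw (Z e) (pop.lawYX (unitArm e)) Q := by
    rintro (i | j)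
    · exact hZ.law_treated i
    · exact hZ.law_control j
  have hm := fun e => (hlaw e).aemeasurable
  refine ⟨hm, ?_⟩
  rw [(iIndepFun_iff_map_fun_eq_pi_map hm).1 hZ.indep]
  congr 1
  ext1 e
  exact (hlaw e).map_eq

/-- With many more controls than treated units, nearest neighbours are close. -/
lemma exists_vanishingDiscrepancy (hk : 1 ≤ k) (hX : pop.CovariateAssumption)
    {m : OutcomeModel k} (hm : m.ν = pop.lawX) {V : Matrix (Fin k) (Fin k) ℝ} (hV : V.PosDef)
    (M : ℕ) {N₁ N₀ : ℕ → ℕ} (hN₁ : Tendsto N₁ atTop atTop) (hN₀ : Tendsto N₀ atTop atTop)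
    (hrates : SamplingRates k N₁ N₀) :
    ∃ d G, m.VanishingDiscrepancy V M N₁ N₀ d G := by
  obtain ⟨κ, C, ρ₀, hκ, hC, hρ₀, hball, hball'⟩ := pop.exists_ball_mass hk hX
  rw [← hm] at hball hball'
  obtain ⟨l, u, hl, hu, hlu⟩ := exists_matchDist_equiv hk hV
  obtain ⟨ρ, hρ, hρ0, hρs, hρk, hρe⟩ := exists_matching_scale hk hN₁ hN₀ hrates
  have hMN : ∀ᶠ n in atTop, M ≤ N₀ n := hN₀.eventually_ge_atTop M
  refine ⟨fun n => u / l * ρ n, fun n => {x | WellMatched M (ρ n) (2 * (u / l * ρ n)) x}, hN₁, hMN,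
    ?_, ?_, ?_, ?_, ?_, ?_⟩
  · filter_upwards [hρ] with n hn
    positivity
  · simpa using hρ0.const_mul (u / l)
  · have := hρs.const_mul (u / l)
    rw [mul_zero] at this
    refine this.congr fun n => ?_
    ring
  · have hlim := (hρk.const_mul (C * (2 * (u / l)) ^ k)).add
      ((hρe (κ / 2) (by positivity)).const_mul (2 ^ M))
    rw [mul_zero, mul_zero, add_zero] at hlim
    refine squeeze_zero' (.of_forall fun n => measureReal_nonneg) ?_ hlim
    filter_upwards [hρ, hρ0.eventually_le_const hρ₀] with n hn hn₀
    have hb := covLaw_not_wellMatched_le (ν := m.ν) (N₁ := N₁ n) (N₀ := N₀ n) (M := M)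
      (C := C * (2 * (u / l * ρ n)) ^ k) (p := κ * ρ n ^ k) (r := ρ n) (R := 2 * (u / l * ρ n))
      (fun x => hball' x _ (by positivity)) (by
        filter_upwards [hball] with x hx using hx _ hn hn₀)
    refine hb.trans (le_of_eq ?_)
    rw [show κ * ρ n ^ k / 2 * (N₀ n : ℝ) = κ / 2 * (N₀ n * ρ n ^ k) by ring]
    simp only [mul_pow]
    ring
  · filter_upwards [hρ, hMN] with n hn hMn x hx
    exact WellMatched.injective hl hu hlu hx hMn hn.le le_rfl
  · filter_upwards [hρ, hMN] with n hn hMn x hx i j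
    exact WellMatched.dist_le hl hu hlu hx hMn hn.le i j

end Population
end Matching

theorem mainTheorem5 {k M : ℕ} (hk : 1 ≤ k) (hM : 1 ≤ M)
    (V : Matrix (Fin k) (Fin k) ℝ) (hV : V.PosDef)
    {Ω : Type*} [MeasurableSpace Ω] [StandardBorelSpace Ω] (pop : Matching.Population k Ω)
    (hCIA : pop.CIA) (hX : pop.CovariateAssumption) (hY : pop.OutcomeAssumption)
    (N₁ N₀ : ℕ → ℕ) (hN₁ : Tendsto N₁ atTop atTop) (hN₀ : Tendsto N₀ atTop atTop)
    (hrates : Matching.SamplingRates k N₁ N₀)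
    {S : ℕ → Type*} [∀ n, MeasurableSpace (S n)]
    (Q : ∀ n, Measure (S n)) [∀ n, IsProbabilityMeasure (Q n)]
    (Z : ∀ n, Fin (N₁ n) ⊕ Fin (N₀ n) → S n → ℝ × Matching.Cov k)
    (hZ : ∀ n, pop.IsPooledSample (Q n) (Z n))
    (c : ℝ) (hc : pop.att = c) (α : ℝ) (hα₀ : 0 < α) (hα₁ : α < 1) :
    limsup (fun n => Q n {s | Matching.PermTestRejects α
      (Matching.matchedOutcomes V M c (fun i => Z n i s))}) atTop ≤ ENNReal.ofReal α := by
  obtain ⟨m, hν, hlaw, hg⟩ := pop.exists_outcomeModel hCIA hX hY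
  rw [← hν] at hlaw hg
  obtain ⟨d, G, hG⟩ := pop.exists_vanishingDiscrepancy hk hX hν hV M hN₁ hN₀ hrates
  have heff : ∫ x, m.effect c x ∂m.ν 1 = 0 := by
    have hgi : ∀ w, Integrable (m.g w) (m.ν 1) := fun w =>
      Integrable.of_bound (C := m.B) (m.lipschitz_g w).continuous.measurable.aestronglyMeasurable
        (.of_forall (m.abs_g_le w))
    have hd : Integrable (fun x => m.g 1 x - m.g 0 x) (m.ν 1) := (hgi 1).sub (hgi 0)
    simp only [Matching.OutcomeModel.effect]
    rw [integral_sub hd (integrable_const c), hg, hc]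
    simp
  refine ENNReal.le_of_forall_pos_le_add fun ε hε _ => ?_
  obtain ⟨A, hA, hcover, hle⟩ := hG.exists_cover hM heff hα₀ hα₁ (NNReal.coe_pos.2 hε)
  refine limsup_le_of_le (by isBoundedDefault) ?_
  filter_upwards [hcover, hle] with n h1 h2
  obtain ⟨hZm, hmap⟩ := (hZ n).map_eq
  have hmp := m.measurePreserving_sample hlaw (N₁ n) (N₀ n)
  calc Q n {s | Matching.PermTestRejects α (Matching.matchedOutcomes V M c fun i => Z n i s)}
      ≤ Q n ((fun s e => Z n e s) ⁻¹' A n) := measure_mono fun s hs => h1 _ hs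
    _ = m.sampleLaw (N₁ n) (N₀ n) {p | m.sample p.1 p.2 ∈ A n} := by
        rw [← Measure.map_apply_of_aemeasurable (aemeasurable_pi_lambda _ hZm) (hA n), hmap,
          ← hmp.map_eq, Measure.map_apply hmp.measurable (hA n)]
        rfl
    _ ≤ ENNReal.ofReal (α + ε) := h2
    _ = ENNReal.ofReal α + ε := by
        rw [ENNReal.ofReal_add hα₀.le ε.coe_nonneg, ENNReal.ofReal_coe_nnreal]
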